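/- Let $n\ge 0$ and let $L$ be a $\mathbb Z$-graded real $L_\infty$ algebra, with brackets encoded as graded symmetric maps $q_k\colon L[1]^{\otimes k}\to L[1]$ ($k\ge1$) of degree $1$, equipped with a nondegenerate, graded symmetric, cyclic pairing $\langle-,-\rangle\colon L\otimes L\to\mathbb R[n-3]$. Let $\mathcal E_L=\Omega^\bullet(\mathbb R^n)\otimes L$ be the topological AKSZ theory on $\mathbb R^n$ with this target: its fields are $\Omega^\bullet(\mathbb R^n)\otimes L[1]$, and its $L_\infty$ structure is the vector field $Q=(Q_k)_{k\ge 1}$ of degree $1$ given by the de Rham differential and the maps $q_k$, extended by the wedge product. Let $$S(A)=\sum_{k\ge1}\frac{2}{(k+1)!}\int\langle A\wedge Q_k(A,\dots,A)\rangle=\int\langle A\wedge \mathrm dA\rangle+\cdots$$ be its action functional, and let $\{-,-\}$ be the antibracket of the symplectic form $2\int\langle-\wedge-\rangle$ (with this normalization $\int\langle A\wedge TA\rangle$ generates the linear vector field $T$). Functionals are functionals of compactly supported fields; a local functional is one without constant term whose Taylor components are integrals of polydifferential operators in the fields. For a Lie algebra $\mathfrak g$ let $\mathfrak g_{\mathrm{dR}}=\mathfrak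 g[1]\oplus\mathfrak g$, with differential the identity $\mathfrak g[1]\to\mathfrak g$, and with bracket given by the bracket of $\mathfrak g$ and its adjoint action on $\mathfrak g[1]$. Let $\mathfrak{iso}(n)=\mathfrak{so}(n)\ltimes\mathbb R^n$ act on $\mathbb R^n$ by the corresponding infinitesimal isometries (a map of Lie algebras to vector fields). For $(\widetilde X,X)\in\mathfrak{iso}(n)_{\mathrm{dR}}$ put $$S_{\mathrm{eq}}(\widetilde X,X)(A)=S(A)-\int\bigl(\langle A\wedge\iota_{\widetilde X}A\rangle+\langle A\wedge L_XA\rangle\bigr).$$ Then: 1. $S_{\mathrm{eq}}$ is an element of total degree $0$ (the degree in which $S$ lies) of $\mathrm C^\bullet(\mathfrak{iso}(n)_{\mathrm{dR}},\mathcal O_{\mathrm{loc}}(\mathcal E_L))$, and it satisfies the equivariant classical master equation $$\mathrm d_{\mathrm{CE}}S_{\mathrm{eq}}+\tfrac12\{S_{\mathrm{eq}},S_{\mathrm{eq}}\}=0,$$ where $\mathrm d_{\mathrm{CE}}$ is the Chevalley–Eilenberg differential of $\mathfrak{iso}(n)_{\mathrm{dR}}$. 2. $\{S_{\mathrm{eq}},-\}$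 defines a map of dg Lie algebras from $\mathfrak{iso}(n)_{\mathrm{dR}}$ to the dg Lie algebra of (local) vector fields on the formal moduli space $\mathcal E_L$, whose bracket is the graded commutator of derivations and whose differential is $[Q,-]$. That is, $Q$ is the Hamiltonian vector field of $S$ and $[Q,Q]=0$, and there is a linear map $\rho$, preserving degrees, brackets and differentials, such that for homogeneous $x$ the vector field $(-1)^{|x|}\rho(x)$ is the Hamiltonian vector field of the part of $S_{\mathrm{eq}}$ that is linear in $x$. (The sign comes from viewing cochains as functions on $\mathfrak{iso}(n)_{\mathrm{dR}}[1]$.) -/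

import Mathlib

open scoped TensorProduct ContDiff
open MeasureTheory

noncomputable section

namespace AKSZ

/-! ### Graded multilinear algebra -/

section Koszul

variable {V N : Type*}

/-- The Koszul sign of a permutation of `k` homogeneous elements of degrees `d`:
`v₀ ⋯ v_{k-1} = koszulSign σ d • v_{σ 0} ⋯ v_{σ (k-1)}` in a graded commutative algebra. -/
def koszulSign {k : ℕ} (σ : Equiv.Perm (Fin k)) (d : Fin k → ℤ) : ℝ :=
  ∏ i, ∏ j ∈ Finset.univ.filter (fun j => i < j ∧ σ j < σ i), (-1 : ℝ) ^ (d (σ i) * d (σ j))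

/-- The Koszul sign of the unshuffle which moves the positions in `T` to the front. -/
def unshuffleSign {k : ℕ} (T : Finset (Fin k)) (d : Fin k → ℤ) : ℝ :=
  ∏ i ∈ T, ∏ j ∈ Tᶜ.filter (fun j => j < i), (-1 : ℝ) ^ (d i * d j)

/-- The subtuple of `v` at the positions in `T`, in increasing order. -/
def sub {k : ℕ} (v : Fin k → V) (T : Finset (Fin k)) : Fin T.card → V :=
  fun a => v (T.orderEmbOfFin rfl a)

/-- The sum of the degrees at the positions in `T`. -/
def degOn {k : ℕ} (d : Fin k → ℤ) (T : Finset (Fin k)) : ℤ := ∑ i ∈ T, d i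

variable [AddCommGroup V] [Module ℝ V] [AddCommGroup N] [Module ℝ N]

/-- `v` is a tuple of homogeneous elements of degrees `d`. -/
def IsHomog (𝒱 : ℤ → Submodule ℝ V) {k : ℕ} (d : Fin k → ℤ) (v : Fin k → V) : Prop :=
  ∀ i, v i ∈ 𝒱 (d i)

/-- Graded symmetry, with Koszul signs. -/
def IsGradedSymm (𝒱 : ℤ → Submodule ℝ V) {k : ℕ} (f : (Fin k → V) → N) : Prop :=
  ∀ (d : Fin k → ℤ) (v : Fin k → V), IsHomog 𝒱 d v →
    ∀ σ : Equiv.Perm (Fin k), f v = koszulSign σ d • f (fun i => v (σ i))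

/-- The insertion `∑ ± X (Y (v_T), v_{Tᶜ})` over all unshuffles `(T, Tᶜ)` of the homogeneous
elements `v` of degrees `d`. -/
def insertion (X : ∀ k, (Fin k → V) → N) (Y : ∀ k, (Fin k → V) → V) {k : ℕ}
    (d : Fin k → ℤ) (v : Fin k → V) : N :=
  ∑ T : Finset (Fin k), unshuffleSign T d •
    X (Tᶜ.card + 1) (Fin.cons (Y T.card (sub v T)) (sub v Tᶜ))

/-- The shift `V[1]` of a grading, `V[1]^d = V^(d+1)`. -/
def shift (𝒱 : ℤ → Submodule ℝ V) : ℤ → Submodule ℝ V := fun d => 𝒱 (d + 1)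

/-- The projection of a `ℤ`-graded space to its part of parity `p`. -/
def parityProj (𝒱 : ℤ → Submodule ℝ V) [DirectSum.Decomposition 𝒱] (p : ZMod 2) : V →ₗ[ℝ] V :=
  (DirectSum.toModule ℝ ℤ V
      (fun d => if (d : ZMod 2) = p then (𝒱 d).subtype else 0)).comp
    (DirectSum.decomposeLinearEquiv 𝒱).toLinearMap

/-- The parity involution `v ↦ (-1)^|v| v`. -/
def parityInv (𝒱 : ℤ → Submodule ℝ V) [DirectSum.Decomposition 𝒱] : V →ₗ[ℝ] V :=
  parityProj 𝒱 0 - parityProj 𝒱 1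

end Koszul

/-! ### Cyclic `L∞` algebras -/

/-- An `L∞` structure on the graded space `L`, given by its graded symmetric brackets of degree one
on `L[1]`, together with a nondegenerate graded symmetric pairing `L ⊗ L → ℝ[n-3]` that is cyclic:
with the associated symplectic form `(-1)^|x| ⟨x, y⟩` on `L[1]`, the functions
`(x₀, …, x_k) ↦ (-1)^|q_k| ⟨q_k (x₀, …, x_{k-1}), x_k⟩` on `L[1]` are graded symmetric. -/
structure CyclicLInfty (n : ℕ) {L : Type*} [AddCommGroup L] [Module ℝ L]
    (𝓛 : ℤ → Submodule ℝ L) [DirectSum.Decomposition 𝓛] where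
  /-- the brackets on `L[1]` -/
  q : ∀ k : ℕ, MultilinearMap ℝ (fun _ : Fin k => L) L
  q_zero : q 0 = 0
  q_degree : ∀ (k : ℕ) (d : Fin k → ℤ) (x : Fin k → L), IsHomog (shift 𝓛) d x →
    q k x ∈ shift 𝓛 (∑ i, d i + 1)
  q_symm : ∀ k : ℕ, IsGradedSymm (shift 𝓛) (q k)
  q_jacobi : ∀ (k : ℕ) (d : Fin k → ℤ) (x : Fin k → L), IsHomog (shift 𝓛) d x →
    insertion (fun k => ⇑(q k)) (fun k => ⇑(q k)) d x = 0
  /-- the pairing on `L` -/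
  pairing : L →ₗ[ℝ] L →ₗ[ℝ] ℝ
  pairing_degree : ∀ (i j : ℤ) (x y : L), x ∈ 𝓛 i → y ∈ 𝓛 j → i + j ≠ 3 - (n : ℤ) →
    pairing x y = 0
  pairing_symm : ∀ (i j : ℤ) (x y : L), x ∈ 𝓛 i → y ∈ 𝓛 j →
    pairing x y = (-1 : ℝ) ^ (i * j) * pairing y x
  pairing_nondegenerate : ∀ x : L, (∀ y : L, pairing x y = 0) → x = 0
  pairing_cyclic : ∀ k : ℕ, IsGradedSymm (shift 𝓛)
    (fun x : Fin (k + 1) → L => pairing (parityInv 𝓛 (q k (Fin.init x))) (x (Fin.last k)))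

/-! ### Differential forms on `ℝⁿ` -/

/-- Euclidean space `ℝⁿ`. -/
abbrev Rn (n : ℕ) : Type := EuclideanSpace ℝ (Fin n)

/-- The algebra of smooth functions on `ℝⁿ`. -/
def smoothSubalgebra (n : ℕ) : Subalgebra ℝ (Rn n → ℝ) where
  carrier := {f | ContDiff ℝ ∞ f}
  mul_mem' := fun {f g} (hf : ContDiff ℝ ∞ f) (hg : ContDiff ℝ ∞ g) => hf.mul hg
  add_mem' := fun {f g} (hf : ContDiff ℝ ∞ f) (hg : ContDiff ℝ ∞ g) => hf.add hg
  algebraMap_mem' := fun r => (contDiff_const : ContDiff ℝ ∞ fun _ : Rn n => r)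

/-- Smooth functions on `ℝⁿ`. -/
def SmoothFn (n : ℕ) : Type := smoothSubalgebra n

instance (n : ℕ) : CommRing (SmoothFn n) := inferInstanceAs (CommRing (smoothSubalgebra n))

instance (n : ℕ) : Algebra ℝ (SmoothFn n) := inferInstanceAs (Algebra ℝ (smoothSubalgebra n))

/-- The function underlying a smooth function. -/
def SmoothFn.fn {n : ℕ} (f : SmoothFn n) : Rn n → ℝ := Subtype.val f

theorem SmoothFn.contDiff {n : ℕ} (f : SmoothFn n) : ContDiff ℝ ∞ f.fn := Subtype.property f

/-- A smooth function as an element of `SmoothFn n`. -/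
def SmoothFn.of {n : ℕ} (f : Rn n → ℝ) (hf : ContDiff ℝ ∞ f) : SmoothFn n :=
  (⟨f, hf⟩ : smoothSubalgebra n)

theorem SmoothFn.ext {n : ℕ} {f g : SmoothFn n} (h : ∀ x, f.fn x = g.fn x) : f = g :=
  Subtype.ext (funext h)

/-- The `i`-th standard basis vector. -/
def stdVec {n : ℕ} (i : Fin n) : Rn n := EuclideanSpace.single i 1

/-- The partial derivative `∂ᵢ`. -/
def partialD {n : ℕ} (i : Fin n) : SmoothFn n →ₗ[ℝ] SmoothFn n where
  toFun f := SmoothFn.of (fun x => fderiv ℝ f.fn x (stdVec i))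
    ((f.contDiff.fderiv_right (m := ∞) le_rfl).clm_apply contDiff_const)
  map_add' f g := SmoothFn.ext fun x => by
    have h1 := (f.contDiff.differentiable (by simp)).differentiableAt (x := x)
    have h2 := (g.contDiff.differentiable (by simp)).differentiableAt (x := x)
    exact congrArg (fun φ => φ (stdVec i)) (fderiv_add h1 h2)
  map_smul' c f := SmoothFn.ext fun x => by
    have h1 := (f.contDiff.differentiable (by simp)).differentiableAt (x := x)
    exact congrArg (fun φ => φ (stdVec i)) (fderiv_const_smul h1 c)

/-- The exterior algebra of `(ℝⁿ)*`. -/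
abbrev ExtAlg (n : ℕ) : Type := ExteriorAlgebra ℝ (Module.Dual ℝ (Rn n))

/-- The basis `dx₁, …, dxₙ` of `(ℝⁿ)*`. -/
def dxBasis (n : ℕ) : Module.Basis (Fin n) ℝ (Module.Dual ℝ (Rn n)) :=
  (EuclideanSpace.basisFun (Fin n) ℝ).toBasis.dualBasis

/-- Left multiplication by `dxᵢ`. -/
def dxWedge {n : ℕ} (i : Fin n) : ExtAlg n →ₗ[ℝ] ExtAlg n :=
  LinearMap.mulLeft ℝ (ExteriorAlgebra.ι ℝ (dxBasis n i))

/-- Contraction with the coordinate vector field `∂ᵢ`. -/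
def contr {n : ℕ} (i : Fin n) : ExtAlg n →ₗ[ℝ] ExtAlg n :=
  CliffordAlgebra.contractLeft (Module.Dual.eval ℝ (Rn n) (stdVec i))

/-- The differential forms `Ω^•(ℝⁿ) = C^∞(ℝⁿ) ⊗ Λ^•(ℝⁿ)*`; the wedge product is the product of
this algebra. -/
abbrev Forms (n : ℕ) : Type := SmoothFn n ⊗[ℝ] ExtAlg n

/-- The forms of degree `p`. -/
def formDeg (n : ℕ) (p : ℕ) : Submodule ℝ (Forms n) :=
  Submodule.span ℝ {α | ∃ (f : SmoothFn n) (l : ExtAlg n),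
    l ∈ ⋀[ℝ]^p (Module.Dual ℝ (Rn n)) ∧ α = f ⊗ₜ[ℝ] l}

/-- The involution `α ↦ (-1)^|α| α` of the forms. -/
def formInv (n : ℕ) : Forms n →ₗ[ℝ] Forms n :=
  TensorProduct.map LinearMap.id (CliffordAlgebra.involute.toLinearMap)

/-- The exterior derivative `d = ∑ᵢ ∂ᵢ ⊗ (dxᵢ ∧ -)`. -/
def extD (n : ℕ) : Forms n →ₗ[ℝ] Forms n :=
  ∑ i, TensorProduct.map (partialD i) (dxWedge i)

/-- The contraction with the vector field `∑ ξⁱ ∂ᵢ`. -/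
def contrField {n : ℕ} (ξ : Fin n → SmoothFn n) : Forms n →ₗ[ℝ] Forms n :=
  ∑ i, TensorProduct.map (LinearMap.mulLeft ℝ (ξ i)) (contr i)

/-- The Lie derivative along the vector field `ξ = ∑ ξⁱ ∂ᵢ`: the derivation of the algebra of forms
with `f ↦ ξ(f)` and `dxʲ ↦ dξʲ = ∑ᵢ (∂ᵢ ξʲ) dxⁱ`. -/
def lieDer {n : ℕ} (ξ : Fin n → SmoothFn n) : Forms n →ₗ[ℝ] Forms n :=
  ∑ i, TensorProduct.map ((LinearMap.mulLeft ℝ (ξ i)).comp (partialD i)) LinearMap.id +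
  ∑ i, ∑ j, TensorProduct.map (LinearMap.mulLeft ℝ (partialD i (ξ j)))
    ((dxWedge i).comp (contr j))

/-- The coefficient of `dx₁ ∧ ⋯ ∧ dxₙ`. -/
def topCoeff (n : ℕ) : Forms n →ₗ[ℝ] SmoothFn n :=
  (TensorProduct.rid ℝ (SmoothFn n)).toLinearMap.comp
    (TensorProduct.map LinearMap.id
      (ExteriorAlgebra.liftAlternating (R := ℝ) (Pi.single n (dxBasis n).det)))

/-- The integral of a form over `ℝⁿ`, with its standard orientation. -/
def integral {n : ℕ} (α : Forms n) : ℝ := ∫ x, (topCoeff n α).fn x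

/-! ### The isometry algebra and its de Rham version -/

section Iso

attribute [local instance 100] LieRing.ofAssociativeRing

/-- The Lie algebra `𝔦𝔰𝔬(n)` of the group `SO(n) ⋉ ℝⁿ` of affine isometries
`x ↦ R x + r`, realized as the block matrices `[B b; 0 0]` with `B` skew-symmetric. -/
def iso (n : ℕ) : LieSubalgebra ℝ (Matrix (Fin n ⊕ Unit) (Fin n ⊕ Unit) ℝ) where
  carrier := {M | (∀ i j, M (.inl i) (.inl j) = - M (.inl j) (.inl i)) ∧ ∀ j, M (.inr ()) j = 0}
  add_mem' := by
    rintro a b ⟨h1, h2⟩ ⟨h3, h4⟩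
    refine ⟨fun i j => ?_, fun j => ?_⟩
    · simp only [Matrix.add_apply]; rw [h1 i j, h3 i j]; ring
    · simp [h2, h4]
  zero_mem' := by constructor <;> simp
  smul_mem' := by
    rintro c a ⟨h1, h2⟩
    refine ⟨fun i j => ?_, fun j => ?_⟩
    · simp only [Matrix.smul_apply, smul_eq_mul]; rw [h1 i j]; ring
    · simp [h2]
  lie_mem' := by
    rintro a b ⟨h1, h2⟩ ⟨h3, h4⟩
    refine ⟨fun i j => ?_, fun j => ?_⟩
    · have e1 : ∀ l, a (.inl i) (.inl l) * b (.inl l) (.inl j)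
          = b (.inl j) (.inl l) * a (.inl l) (.inl i) := fun l => by
        rw [h1 i l, h3 l j]; ring
      have e2 : ∀ l, b (.inl i) (.inl l) * a (.inl l) (.inl j)
          = a (.inl j) (.inl l) * b (.inl l) (.inl i) := fun l => by
        rw [h3 i l, h1 l j]; ring
      simp [Ring.lie_def, Matrix.mul_apply, h2, h4, e1, e2]
    · simp [Ring.lie_def, Matrix.mul_apply, h2, h4]

instance (n : ℕ) : LieRing (iso n) := inferInstance

instance (n : ℕ) : LieAlgebra ℝ (iso n) := inferInstance

end Iso

/-- The vector field by which `M = [B b; 0 0]` in `𝔦𝔰𝔬(n)` acts on functions and forms, that is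
`x ↦ -(B x + b)`. The sign is that of the left action `g ↦ (g⁻¹)^*` on forms; it makes
`M ↦ isoField M` a map of Lie algebras to vector fields. -/
def isoField {n : ℕ} (M : iso n) (i : Fin n) : SmoothFn n :=
  SmoothFn.of (fun x => -(∑ j, M.1 (.inl i) (.inl j) * x j + M.1 (.inl i) (.inr ())))
    (by fun_prop)

/-- The graded space `𝔤[1] ⊕ 𝔤` underlying `𝔤_dR`; the first component is the one in `𝔤[1]`. -/
abbrev DeRham (𝔤 : Type*) : Type _ := 𝔤 × 𝔤

section DeRham

variable {𝔤 : Type*} [LieRing 𝔤] [LieAlgebra ℝ 𝔤]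

/-- The grading of `𝔤_dR`: `𝔤[1]` is in degree `-1` and `𝔤` in degree `0`. -/
def drDeg (𝔤 : Type*) [LieRing 𝔤] [LieAlgebra ℝ 𝔤] (i : ℤ) : Submodule ℝ (DeRham 𝔤) :=
  if i = 0 then LinearMap.ker (LinearMap.fst ℝ 𝔤 𝔤)
  else if i = -1 then LinearMap.ker (LinearMap.snd ℝ 𝔤 𝔤)
  else ⊥

/-- The differential of `𝔤_dR`, the identity `𝔤[1] → 𝔤`. -/
def drDiff (x : DeRham 𝔤) : DeRham 𝔤 := (0, x.1)

/-- The bracket of `𝔤_dR`: the bracket of `𝔤` and the adjoint action of `𝔤` on `𝔤[1]`. -/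
def drBracket (x y : DeRham 𝔤) : DeRham 𝔤 := (⁅x.2, y.1⁆ + ⁅x.1, y.2⁆, ⁅x.2, y.2⁆)

/-- The brackets of `𝔤_dR` on `𝔤_dR[1]`: `q₁ (s x) = s (d x)`, `q₂ (s x, s y) = (-1)^|x| s [x, y]`,
where `(-1)^|x| x = (-x.1, x.2)`. -/
def drQ : ∀ m : ℕ, (Fin m → DeRham 𝔤) → DeRham 𝔤
  | 1, c => drDiff (c 0)
  | 2, c => drBracket (-(c 0).1, (c 0).2) (c 1)
  | _, _ => 0

end DeRham

/-! ### Fields -/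

section Fields

variable {n : ℕ} {L : Type*} [AddCommGroup L] [Module ℝ L]

/-- `Ω^•(ℝⁿ) ⊗ L`. -/
abbrev Fields (n : ℕ) (L : Type*) [AddCommGroup L] [Module ℝ L] : Type _ := Forms n ⊗[ℝ] L

/-- The grading of the space of fields `Ω^•(ℝⁿ) ⊗ L[1]`. -/
def fieldDeg (n : ℕ) (𝓛 : ℤ → Submodule ℝ L) (d : ℤ) : Submodule ℝ (Fields n L) :=
  Submodule.span ℝ {A | ∃ (p : ℕ) (j : ℤ) (α : Forms n) (x : L),
    α ∈ formDeg n p ∧ x ∈ shift 𝓛 j ∧ (p : ℤ) + j = d ∧ A = α ⊗ₜ[ℝ] x}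

/-- The compactly supported fields. -/
def compactFields (n : ℕ) (L : Type*) [AddCommGroup L] [Module ℝ L] : Submodule ℝ (Fields n L) :=
  Submodule.span ℝ {A | ∃ (f : SmoothFn n) (l : ExtAlg n) (x : L),
    HasCompactSupport f.fn ∧ A = (f ⊗ₜ[ℝ] l) ⊗ₜ[ℝ] x}

/-- The grading of the compactly supported fields. -/
def compactDeg (n : ℕ) (𝓛 : ℤ → Submodule ℝ L) (d : ℤ) : Submodule ℝ (compactFields n L) :=
  (fieldDeg n 𝓛 d).comap (compactFields n L).subtype

/-- An operator on forms acting on fields. -/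
def onFields (T : Forms n →ₗ[ℝ] Forms n) : Fields n L →ₗ[ℝ] Fields n L :=
  TensorProduct.map T LinearMap.id

end Fields

/-! ### Differential operators -/

section DiffOp

/-- `D` is a differential operator of order at most `r` between modules over the algebra `R`:
all `(r+1)`-fold commutators with elements of `R` vanish. -/
def IsDiffOp (R : Type*) {M N : Type*} [CommRing R] [Algebra ℝ R]
    [AddCommGroup M] [Module ℝ M] [Module R M] [IsScalarTower ℝ R M]
    [AddCommGroup N] [Module ℝ N] [Module R N] [IsScalarTower ℝ R N] :
    ℕ → (M →ₗ[ℝ] N) → Prop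
  | 0, D => ∀ (f : R) (m : M), D (f • m) = f • D m
  | r + 1, D => ∀ f : R, IsDiffOp R r
      (D.comp (Algebra.lsmul ℝ ℝ M f) - (Algebra.lsmul ℝ ℝ N f).comp D)

/-- A multilinear map is a polydifferential operator if it is a differential operator, of bounded
order, in each argument. -/
def IsPolyDiff (R : Type*) {M N : Type*} [CommRing R] [Algebra ℝ R]
    [AddCommGroup M] [Module ℝ M] [Module R M] [IsScalarTower ℝ R M]
    [AddCommGroup N] [Module ℝ N] [Module R N] [IsScalarTower ℝ R N]
    {k : ℕ} (D : MultilinearMap ℝ (fun _ : Fin k => M) N) : Prop :=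
  ∃ r : ℕ, ∀ (e : Fin k → M) (i : Fin k), IsDiffOp R r (D.toLinearMap e i)

end DiffOp

/-! ### Extension of multilinear maps from `L` to `Ω^•(ℝⁿ) ⊗ L` -/

section Extension

theorem tensor_aux {A M P : Type*} [AddCommGroup A] [Module ℝ A] [AddCommGroup M] [Module ℝ M]
    [AddCommGroup P] [Module ℝ P] {k : ℕ}
    {F G : MultilinearMap ℝ (fun _ : Fin (k + 1) => A ⊗[ℝ] M) P}
    (h : ∀ a m, F.curryLeft (a ⊗ₜ[ℝ] m) = G.curryLeft (a ⊗ₜ[ℝ] m)) : F = G := by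
  have h' : F.curryLeft = G.curryLeft := TensorProduct.ext' h
  rw [← F.uncurry_curryLeft, ← G.uncurry_curryLeft, h']

/-- The tensor product of two multilinear maps,
`(aᵢ ⊗ mᵢ)ᵢ ↦ f (a₁, …, a_k) ⊗ g (m₁, …, m_k)`; see `tensorMultilinear_tmul`. -/
def tensorMultilinear (A B M N : Type*) [AddCommGroup A] [Module ℝ A] [AddCommGroup B] [Module ℝ B]
    [AddCommGroup M] [Module ℝ M] [AddCommGroup N] [Module ℝ N] : ∀ k : ℕ,
    MultilinearMap ℝ (fun _ : Fin k => A) B →ₗ[ℝ] MultilinearMap ℝ (fun _ : Fin k => M) N →ₗ[ℝ]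
      MultilinearMap ℝ (fun _ : Fin k => A ⊗[ℝ] M) (B ⊗[ℝ] N)
  | 0 => LinearMap.mk₂ ℝ
      (fun f g => MultilinearMap.constOfIsEmpty ℝ _ (f 0 ⊗ₜ[ℝ] g 0))
      (fun f f' g => by ext; simp [TensorProduct.add_tmul])
      (fun c f g => by ext; simp [TensorProduct.smul_tmul'])
      (fun f g g' => by ext; simp [TensorProduct.tmul_add])
      (fun c f g => by ext; simp)
  | k + 1 => LinearMap.mk₂ ℝ
      (fun f g => LinearMap.uncurryLeft (TensorProduct.lift
        ((tensorMultilinear A B M N k).compl₁₂ f.curryLeft g.curryLeft)))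
      (fun f f' g => tensor_aux fun a m => by
        have h : (f + f').curryLeft a = f.curryLeft a + f'.curryLeft a := rfl
        simp [h]
        rfl)
      (fun c f g => tensor_aux fun a m => by
        have h : (c • f).curryLeft a = c • f.curryLeft a := rfl
        simp [h]
        rfl)
      (fun f g g' => tensor_aux fun a m => by
        have h : (g + g').curryLeft m = g.curryLeft m + g'.curryLeft m := rfl
        simp [h]
        rfl)
      (fun c f g => tensor_aux fun a m => by
        have h : (c • g).curryLeft m = c • g.curryLeft m := rfl
        simp [h]
        rfl)

theorem tensorMultilinear_tmul {A B M N : Type*} [AddCommGroup A] [Module ℝ A] [AddCommGroup B]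
    [Module ℝ B] [AddCommGroup M] [Module ℝ M] [AddCommGroup N] [Module ℝ N] (k : ℕ)
    (f : MultilinearMap ℝ (fun _ : Fin k => A) B) (g : MultilinearMap ℝ (fun _ : Fin k => M) N)
    (a : Fin k → A) (m : Fin k → M) :
    tensorMultilinear A B M N k f g (fun i => a i ⊗ₜ[ℝ] m i) = f a ⊗ₜ[ℝ] g m := by
  induction k with
  | zero =>
    simp only [tensorMultilinear, LinearMap.mk₂_apply, MultilinearMap.constOfIsEmpty_apply]
    rw [Subsingleton.elim a 0, Subsingleton.elim m 0]
    rfl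
  | succ k ih =>
    simp only [tensorMultilinear, LinearMap.mk₂_apply, LinearMap.uncurryLeft_apply,
      TensorProduct.lift.tmul, LinearMap.compl₁₂_apply]
    have := ih (f.curryLeft (a 0)) (g.curryLeft (m 0)) (Fin.tail a) (Fin.tail m)
    simp only [MultilinearMap.curryLeft_apply, Fin.cons_self_tail] at this
    exact this

variable {n : ℕ} {L N : Type*} [AddCommGroup L] [Module ℝ L] [AddCommGroup N] [Module ℝ N]

/-- The extension of a `k`-linear map `f` on `L[1]` to `Ω^•(ℝⁿ) ⊗ L[1]` by the wedge product:
`(αᵢ ⊗ xᵢ)ᵢ ↦ ± (α₁ ∧ ⋯ ∧ α_k) ⊗ f (x₁, …, x_k)`, where the sign is the Koszul sign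
`∏_{i<j} (-1)^(|xᵢ| |αⱼ|)` of moving the forms to the left, with `|xᵢ|` the degree in `L[1]`.
The sum is over the parities of the `xᵢ`. -/
def wedgeExtend (𝓛 : ℤ → Submodule ℝ L) [DirectSum.Decomposition 𝓛] {k : ℕ}
    (f : MultilinearMap ℝ (fun _ : Fin k => L) N) :
    MultilinearMap ℝ (fun _ : Fin k => Fields n L) (Forms n ⊗[ℝ] N) :=
  ∑ p : Fin k → ZMod 2, tensorMultilinear (Forms n) (Forms n) L N k
    ((MultilinearMap.mkPiAlgebraFin ℝ k (Forms n)).compLinearMap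
      (fun j => (formInv n) ^ (∑ i ∈ Finset.univ.filter (fun i => i < j), (p i).val)))
    (f.compLinearMap (fun i => parityProj 𝓛 (p i + 1)))

end Extension

/-! ### The topological AKSZ theory -/

section Theory

variable {n : ℕ} {L : Type*} [AddCommGroup L] [Module ℝ L]
  {𝓛 : ℤ → Submodule ℝ L} [DirectSum.Decomposition 𝓛]

/-- Taylor components of a formal vector field on the space of fields. -/
abbrev VField (n : ℕ) (L : Type*) [AddCommGroup L] [Module ℝ L] : Type _ :=
  ∀ k : ℕ, MultilinearMap ℝ (fun _ : Fin k => Fields n L) (Fields n L)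

/-- The `L∞` structure of `ℰ_L`, as a vector field of degree one on `Ω^•(ℝⁿ) ⊗ L[1]`: the de Rham
differential and the brackets of `L`, extended by the wedge product. The operator `formInv` is the
sign of moving the bracket, of degree one, past the forms. -/
def aksz (C : CyclicLInfty n 𝓛) : VField n L := fun k =>
  (onFields (formInv n)).compMultilinearMap (wedgeExtend 𝓛 (C.q k)) +
    (match k with
      | 1 => MultilinearMap.ofSubsingleton ℝ (Fields n L) (Fields n L) (0 : Fin 1)
          (onFields (extD n))
      | _ => 0)

/-- The pairing `⟨A ∧ B⟩` of fields, a form: `⟨α ⊗ x ∧ β ⊗ y⟩ = (-1)^(|x| |β|) ⟨x, y⟩ α ∧ β`, with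
`|x|` the degree in `L`. -/
def wedgePairing (C : CyclicLInfty n 𝓛) : Fields n L →ₗ[ℝ] Fields n L →ₗ[ℝ] Forms n :=
  ∑ p : ZMod 2, (TensorProduct.map₂
    ((LinearMap.mul ℝ (Forms n)).compl₂ ((formInv n) ^ p.val))
    (C.pairing.comp (parityProj 𝓛 p))).compr₂ (TensorProduct.rid ℝ (Forms n)).toLinearMap

/-- The symplectic form of degree `-1` on `Ω^•(ℝⁿ) ⊗ L[1]` (defined when `A` or `B` is compactly
supported): `2 ∫ (-1)^|A| ⟨A ∧ B⟩`, with `|A|` the degree in `Ω^•(ℝⁿ) ⊗ L`. With the factor `2`, a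
quadratic functional `∫ ⟨A ∧ T A⟩` generates the linear vector field `T`. -/
def sympl (C : CyclicLInfty n 𝓛) (A B : Fields n L) : ℝ :=
  2 * integral (wedgePairing C (TensorProduct.map (formInv n) (parityInv 𝓛) A) B)

/-- Taylor components `F_k` of a functional `F(A) = ∑_k F_k(A, …, A) / k!` of compactly supported
fields. -/
abbrev Functional (n : ℕ) (L : Type*) [AddCommGroup L] [Module ℝ L] : Type _ :=
  ∀ k : ℕ, (Fin k → compactFields n L) → ℝ

/-- Local functionals of degree `m`, without constant term: the Taylor components are graded
symmetric, of degree `m`, and integrals of polydifferential expressions in the fields. -/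
structure IsLocalFunctional (𝓛 : ℤ → Submodule ℝ L) (m : ℤ) (F : Functional n L) : Prop where
  zero : F 0 = 0
  symm : ∀ k, IsGradedSymm (compactDeg n 𝓛) (F k)
  degree : ∀ (k : ℕ) (d : Fin k → ℤ) (e : Fin k → compactFields n L),
    IsHomog (compactDeg n 𝓛) d e → m + ∑ i, d i ≠ 0 → F k e = 0
  isLocal : ∀ k, ∃ D : MultilinearMap ℝ (fun _ : Fin k => Fields n L) (SmoothFn n),
    IsPolyDiff (SmoothFn n) D ∧ ∀ e : Fin k → compactFields n L,
      F k e = ∫ x, (D fun i => (e i : Fields n L)).fn x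

/-- `X` is the (local) Hamiltonian vector field of the functional `F`: the derivative of `F` is the
contraction of the symplectic form with `X`. Such an `X` is unique, and `{F, -}` is the derivation
of functionals along `X`. -/
def IsHamiltonian (C : CyclicLInfty n 𝓛) (F : Functional n L) (X : VField n L) : Prop :=
  (∀ k, IsPolyDiff (SmoothFn n) (X k)) ∧
  ∀ (k : ℕ) (e : Fin k → compactFields n L) (e₀ : compactFields n L),
    F (k + 1) (Fin.snoc (α := fun _ => compactFields n L) e e₀) =
      sympl C (X k fun i => (e i : Fields n L)) e₀

open Classical in
/-- The Hamiltonian vector field of a functional, if there is one. -/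
def hamVF (C : CyclicLInfty n 𝓛) (F : Functional n L) : VField n L :=
  if h : ∃ X, IsHamiltonian C F X then h.choose else 0

/-- The antibracket `{F, G}` of local functionals of degrees `a` and `b`, evaluated on homogeneous
fields `e` of degrees `d`. It is the derivative of `G` along the Hamiltonian vector field of `F`,
or `± (2 ∫ ⟨- ∧ -⟩) (X_F, X_G)`; the signs are the Koszul signs for the vector fields `X_F` and
`X_G`, of degrees `a + 1` and `b + 1`. -/
def antibracket (C : CyclicLInfty n 𝓛) (a b : ℤ) (F G : Functional n L) {k : ℕ}
    (d : Fin k → ℤ) (e : Fin k → compactFields n L) : ℝ :=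
  (-1 : ℝ) ^ a * ∑ U : Finset (Fin k), unshuffleSign U d * (-1 : ℝ) ^ ((b + 1) * degOn d U) *
    sympl C (hamVF C F U.card fun i => (sub e U i : compactFields n L))
      (hamVF C G Uᶜ.card fun i => (sub e Uᶜ i : compactFields n L))

/-- The action functional `S(A) = ∑_k 2/(k+1)! ∫ ⟨A ∧ Q_k(A, …, A)⟩
= ∫ ⟨A ∧ dA⟩ + …`, through its Taylor components. -/
def action (C : CyclicLInfty n 𝓛) : Functional n L
  | 0, _ => 0
  | k + 1, e => sympl C (aksz C k fun i => (Fin.init e i : compactFields n L)) (e (Fin.last k))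

/-! ### The equivariant theory -/

/-- The operator `ι_X̃ + L_X` on fields, for `x = (X̃, X)` in `𝔦𝔰𝔬(n)_dR`. -/
def isoOp (x : DeRham (iso n)) : Fields n L →ₗ[ℝ] Fields n L :=
  onFields (contrField (isoField x.1)) + onFields (lieDer (isoField x.2))

/-- The functional `A ↦ - ∫ (⟨A ∧ ι_X̃ A⟩ + ⟨A ∧ L_X A⟩)`, through its Taylor components. -/
def current (C : CyclicLInfty n 𝓛) (x : DeRham (iso n)) : Functional n L
  | 2, e => - sympl C (isoOp x (e 0)) (e 1)
  | _, _ => 0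

/-- The equivariant action `S_eq(X̃, X)(A) = S(A) - ∫ (⟨A ∧ ι_X̃ A⟩ + ⟨A ∧ L_X A⟩)`, as a
Chevalley–Eilenberg cochain of `𝔦𝔰𝔬(n)_dR` with values in functionals, that is, as a function on
`𝔦𝔰𝔬(n)_dR[1]`. -/
def eqAction (C : CyclicLInfty n 𝓛) : ∀ m : ℕ, (Fin m → DeRham (iso n)) → Functional n L
  | 0, _ => action C
  | 1, c => current C (c 0)
  | _, _ => 0

/-- Cochains of total degree `0` in `C^•(𝔤_dR, 𝒪_loc)`, as functions on `𝔤_dR[1]`. -/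
def IsLocalCochain (𝓛 : ℤ → Submodule ℝ L) {𝔤 : Type*} [LieRing 𝔤] [LieAlgebra ℝ 𝔤]
    (F : ∀ m : ℕ, (Fin m → DeRham 𝔤) → Functional n L) : Prop :=
  ∀ m : ℕ, (∃ φ : MultilinearMap ℝ (fun _ : Fin m => DeRham 𝔤) (Functional n L), ⇑φ = F m) ∧
    IsGradedSymm (shift (drDeg 𝔤)) (F m) ∧
    ∀ (δ : Fin m → ℤ) (c : Fin m → DeRham 𝔤), IsHomog (shift (drDeg 𝔤)) δ c →
      IsLocalFunctional 𝓛 (∑ i, δ i) (F m c)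

/-- The Chevalley–Eilenberg differential of a cochain `F` of total degree `0`, at homogeneous
elements `c` of `𝔤_dR[1]` of degrees `δ`; in low degrees
`(d F)(x) = - F(d x)` and `(d F)(x, y) = - F([x, y])` for `x`, `y` in `𝔤`. -/
def dCE {𝔤 : Type*} [LieRing 𝔤] [LieAlgebra ℝ 𝔤]
    (F : ∀ m : ℕ, (Fin m → DeRham 𝔤) → Functional n L) {m : ℕ} (δ : Fin m → ℤ)
    (c : Fin m → DeRham 𝔤) : Functional n L :=
  - insertion F drQ δ c

/-- The antibracket of two cochains of total degree `0`, evaluated at homogeneous elements `c` of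
`𝔤_dR[1]` of degrees `δ` and homogeneous fields `e` of degrees `d`. -/
def cochainBracket (C : CyclicLInfty n 𝓛) {𝔤 : Type*} [LieRing 𝔤] [LieAlgebra ℝ 𝔤]
    (F G : ∀ m : ℕ, (Fin m → DeRham 𝔤) → Functional n L) {m : ℕ} (δ : Fin m → ℤ)
    (c : Fin m → DeRham 𝔤) {k : ℕ} (d : Fin k → ℤ) (e : Fin k → compactFields n L) : ℝ :=
  ∑ T : Finset (Fin m), unshuffleSign T δ *
    antibracket C (degOn δ T) (degOn δ Tᶜ) (F T.card (sub c T)) (G Tᶜ.card (sub c Tᶜ)) d e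

/-- The equivariant classical master equation `d_CE F + 1/2 {F, F} = 0`. -/
def EquivariantCME (C : CyclicLInfty n 𝓛) {𝔤 : Type*} [LieRing 𝔤] [LieAlgebra ℝ 𝔤]
    (F : ∀ m : ℕ, (Fin m → DeRham 𝔤) → Functional n L) : Prop :=
  ∀ (m : ℕ) (δ : Fin m → ℤ) (c : Fin m → DeRham 𝔤), IsHomog (shift (drDeg 𝔤)) δ c →
    ∀ (k : ℕ) (d : Fin k → ℤ) (e : Fin k → compactFields n L), IsHomog (compactDeg n 𝓛) d e →
      dCE F δ c k e + 1 / 2 * cochainBracket C F F δ c d e = 0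

/-! ### Vector fields -/

/-- Local formal vector fields of degree `m` on `ℰ_L`. -/
structure IsVectorField (𝓛 : ℤ → Submodule ℝ L) (m : ℤ) (X : VField n L) : Prop where
  symm : ∀ k, IsGradedSymm (fieldDeg n 𝓛) (X k)
  degree : ∀ (k : ℕ) (d : Fin k → ℤ) (e : Fin k → Fields n L), IsHomog (fieldDeg n 𝓛) d e →
    X k e ∈ fieldDeg n 𝓛 (∑ i, d i + m)
  isLocal : ∀ k, IsPolyDiff (SmoothFn n) (X k)

/-- `Z` is the Lie bracket of the vector fields `X` and `Y` of degrees `a` and `b`: the graded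
commutator of the corresponding derivations of functions, in Taylor components
`[X, Y] = (-1)^(ab) Y ∘ X - X ∘ Y`. -/
def IsVFBracket (𝓛 : ℤ → Submodule ℝ L) (a b : ℤ) (X Y Z : VField n L) : Prop :=
  ∀ (k : ℕ) (d : Fin k → ℤ) (e : Fin k → Fields n L), IsHomog (fieldDeg n 𝓛) d e →
    Z k e = (-1 : ℝ) ^ (a * b) • insertion (fun k => ⇑(Y k)) (fun k => ⇑(X k)) d e -
      insertion (fun k => ⇑(X k)) (fun k => ⇑(Y k)) d e

/-- `ρ` is a map of dg Lie algebras from `𝔤_dR` to the vector fields, with the Lie bracket and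
the differential `[Q, -]` for a vector field `Q` of degree one with `[Q, Q] = 0`. -/
structure IsDGLieMap (𝓛 : ℤ → Submodule ℝ L) (Q : VField n L) {𝔤 : Type*} [LieRing 𝔤]
    [LieAlgebra ℝ 𝔤] (ρ : DeRham 𝔤 →ₗ[ℝ] VField n L) : Prop where
  isVectorField : IsVectorField 𝓛 1 Q
  square_zero : IsVFBracket 𝓛 1 1 Q Q 0
  degree : ∀ (i : ℤ) (x : DeRham 𝔤), x ∈ drDeg 𝔤 i → IsVectorField 𝓛 i (ρ x)
  bracket : ∀ (i j : ℤ) (x y : DeRham 𝔤), x ∈ drDeg 𝔤 i → y ∈ drDeg 𝔤 j →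
    IsVFBracket 𝓛 i j (ρ x) (ρ y) (ρ (drBracket x y))
  differential : ∀ (i : ℤ) (x : DeRham 𝔤), x ∈ drDeg 𝔤 i →
    IsVFBracket 𝓛 1 i Q (ρ x) (ρ (drDiff x))

end Theory

end AKSZ

end

noncomputable section

namespace AKSZ

/-! ### Signs -/

/-! The proof translates everything into vector fields. The symplectic form is nondegenerate, so a
functional determines its Hamiltonian vector field on compactly supported fields
(`sympl_nondegenerate`, `hamVF_eq`), and the antibracket of two functionals generates, up to a sign,
the bracket of their vector fields (`antibracket_eq`). The action generates `Q`, and the current of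
`x` generates `(-1)^|x| ρ(x)`, where `ρ(X̃, X)` is the linear vector field `ι_X̃ - L_X` (`isoRep`,
`isoVF`). Sorted by the number of arguments from the Lie algebra, the master equation then says:
`[Q, Q] = 0` with no argument, `[Q, ρ(x)] = ρ(dx)` with one, `[ρ(x), ρ(y)] = ρ([x, y])` with two,
and nothing with three or more. Both halves of the theorem therefore rest on `isDGLieMap_isoVF`.

That statement is Cartan calculus. The wedge extension of the brackets of `L` satisfies the same
Jacobi identities, since forms are a graded commutative algebra (`insertion_bracketVF_self`). The
operators `d`, `ι_ξ` and `L_ξ` are derivations of this algebra, so they commute in the graded sense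
with the extended brackets (`insertion_bracketVF_linVF`). Hence `[Q, Q] = 0` reduces to `d² = 0`,
and `[Q, ρ(x)]` reduces to the commutator with `d`, which is given by Cartan's formula (`cartan`).
The brackets among the `ρ(x)` are the commutation rules of `L` and `ι`, carried to the isometry
algebra by `isoField_lie`.

For the functionals to be local cochains, their Taylor components must also be graded symmetric. For
the interaction terms this is the cyclicity of the pairing, extended to forms
(`wedgePairing_bracketVF`). For the quadratic terms it is the skewness of `d`, `ι_ξ` and `L_ξ` under
the symplectic form: each is a derivation and takes compactly supported forms to forms of integral
zero (`sympl_odd`, `sympl_even`).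

Signs are handled as exponents in `ZMod 2`. A field `α ⊗ x` has two degrees, and the identities
`koszulExp_add` and `unshuffleExp_add` split its Koszul signs into those of the forms, those of
`L[1]`, and the cost of moving forms past elements of `L[1]`. Once they are applied, every sign
comparison is an identity of polynomials over `ZMod 2`. -/

/-- The sign `(-1)^z` of a parity `z`. -/
def parSign (z : ZMod 2) : ℝ := (-1) ^ z.val

theorem parSign_zero : parSign 0 = 1 := by simp [parSign]

theorem parSign_one : parSign 1 = -1 := by simp [parSign, ZMod.val_one]

theorem parSign_add (a b : ZMod 2) : parSign (a + b) = parSign a * parSign b := by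
  revert a b
  have h : ∀ z : ZMod 2, z = 0 ∨ z = 1 := by decide
  intro a b
  rcases h a with rfl | rfl <;> rcases h b with rfl | rfl <;>
    simp [parSign_zero, parSign_one, CharTwo.add_self_eq_zero]

theorem parSign_mul_self (a : ZMod 2) : parSign a * parSign a = 1 := by
  rw [← parSign_add, CharTwo.add_self_eq_zero, parSign_zero]

theorem neg_one_zpow (a : ℤ) : (-1 : ℝ) ^ a = parSign a := by
  rcases Int.even_or_odd a with h | h
  · rw [h.neg_one_zpow, (ZMod.intCast_eq_zero_iff_even).2 h, parSign_zero]
  · rw [h.neg_one_zpow, (ZMod.intCast_eq_one_iff_odd).2 h, parSign_one]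

theorem parSign_sum {ι : Type*} (s : Finset ι) (f : ι → ZMod 2) :
    parSign (∑ i ∈ s, f i) = ∏ i ∈ s, parSign (f i) := by
  classical
  induction s using Finset.induction_on with
  | empty => simp [parSign_zero]
  | insert a s ha ih => rw [Finset.sum_insert ha, Finset.prod_insert ha, parSign_add, ih]

/-- The exponent of the Koszul sign of a permutation. -/
def koszulExp {k : ℕ} (σ : Equiv.Perm (Fin k)) (d : Fin k → ZMod 2) : ZMod 2 :=
  ∑ i, ∑ j, if i < j ∧ σ j < σ i then d (σ i) * d (σ j) else 0

/-- The exponent of the Koszul sign of an unshuffle. -/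
def unshuffleExp {k : ℕ} (T : Finset (Fin k)) (d : Fin k → ZMod 2) : ZMod 2 :=
  ∑ i, ∑ j, if i ∈ T ∧ j ∉ T ∧ j < i then d i * d j else 0

/-- The sum of `c i j` over all pairs `i < j`. -/
def pairSum {k : ℕ} (c : Fin k → Fin k → ZMod 2) : ZMod 2 :=
  ∑ i, ∑ j, if i < j then c i j else 0

theorem koszulSign_eq {k : ℕ} (σ : Equiv.Perm (Fin k)) (d : Fin k → ℤ) :
    koszulSign σ d = parSign (koszulExp σ fun i => (d i : ZMod 2)) := by
  simp only [koszulSign, koszulExp, parSign_sum]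
  refine Finset.prod_congr rfl fun i _ => ?_
  rw [Finset.prod_filter]
  refine Finset.prod_congr rfl fun j _ => ?_
  split_ifs
  · rw [neg_one_zpow]; push_cast; rfl
  · rw [parSign_zero]

theorem unshuffleSign_eq {k : ℕ} (T : Finset (Fin k)) (d : Fin k → ℤ) :
    unshuffleSign T d = parSign (unshuffleExp T fun i => (d i : ZMod 2)) := by
  simp only [unshuffleSign, unshuffleExp, parSign_sum]
  rw [← Finset.prod_filter_mul_prod_filter_not Finset.univ (fun i => i ∈ T)]
  have h2 : ∏ x with x ∉ T, ∏ j, parSign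
      (if x ∈ T ∧ j ∉ T ∧ j < x then (d x : ZMod 2) * (d j : ZMod 2) else 0) = 1 := by
    refine Finset.prod_eq_one fun x hx => Finset.prod_eq_one fun j _ => ?_
    rw [if_neg (fun h => (Finset.mem_filter.1 hx).2 h.1), parSign_zero]
  rw [h2, mul_one, Finset.filter_mem_eq_inter, Finset.univ_inter]
  refine Finset.prod_congr rfl fun i hi => ?_
  rw [Finset.prod_filter, ← Finset.prod_subset (Finset.subset_univ Tᶜ)]
  · refine Finset.prod_congr rfl fun j hj => ?_
    have hj' : j ∉ T := by simpa using hj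
    by_cases h : j < i
    · rw [if_pos h, if_pos ⟨hi, hj', h⟩, neg_one_zpow]; push_cast; rfl
    · rw [if_neg h, if_neg (fun h' => h h'.2.2), parSign_zero]
  · intro j _ hj
    have hj' : j ∈ T := by simpa using hj
    rw [if_neg (fun h' => h'.2.1 hj'), parSign_zero]

/-- Reindexing by `σ` permutes the unordered pairs. A pair contributes the same term on both sides
unless `σ` reverses its order; then the two orderings of `c` are exchanged, which modulo 2 amounts
to adding both. -/
theorem pairSum_perm {k : ℕ} (c : Fin k → Fin k → ZMod 2) (σ : Equiv.Perm (Fin k)) :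
    pairSum (fun i j => c (σ i) (σ j)) = pairSum c +
      ∑ i, ∑ j, if i < j ∧ σ j < σ i then c (σ i) (σ j) + c (σ j) (σ i) else 0 := by
  have reindex : ∀ g : Fin k → Fin k → ZMod 2,
      ∑ i, ∑ j, g i j = ∑ u, ∑ w, g (σ.symm u) (σ.symm w) := fun g => by
    rw [← Equiv.sum_comp σ.symm]
    exact Finset.sum_congr rfl fun i _ => (Equiv.sum_comp σ.symm _).symm
  have e1 : ∑ i, ∑ j, (if i < j ∧ σ j < σ i then c (σ i) (σ j) + c (σ j) (σ i) else 0) =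
      (∑ u, ∑ w, if σ.symm u < σ.symm w ∧ w < u then c u w else 0) +
      ∑ u, ∑ w, if σ.symm w < σ.symm u ∧ u < w then c u w else 0 := by
    rw [reindex]
    simp only [Equiv.apply_symm_apply]
    rw [Finset.sum_comm (f := fun u w => if σ.symm w < σ.symm u ∧ u < w then c u w else 0),
      ← Finset.sum_add_distrib]
    refine Finset.sum_congr rfl fun u _ => ?_
    rw [← Finset.sum_add_distrib]
    refine Finset.sum_congr rfl fun w _ => ?_
    split_ifs <;> simp
  rw [e1, pairSum, reindex, pairSum, ← Finset.sum_add_distrib, ← Finset.sum_add_distrib]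
  refine Finset.sum_congr rfl fun u _ => ?_
  rw [← Finset.sum_add_distrib, ← Finset.sum_add_distrib]
  refine Finset.sum_congr rfl fun w _ => ?_
  simp only [Equiv.apply_symm_apply]
  rcases lt_trichotomy u w with h | h | h
  · rcases lt_or_ge (σ.symm u) (σ.symm w) with h' | h'
    · simp [h, h', h.not_gt, h'.not_gt]
    · have h'' : σ.symm w < σ.symm u := lt_of_le_of_ne h' (by simpa using h.ne')
      simp [h, h'', h.not_gt, h''.not_gt, CharTwo.add_self_eq_zero]
  · subst h; simp
  · simp [h, h.not_gt]

/-- The cocycle rule for Koszul signs. Apply `pairSum_perm` for `τ` to the function that records the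
inversions of `σ`: at an inversion of `τ` exactly one of the two orderings of the pair is an
inversion of `σ`, so the correction is the inversion term of `τ`. -/
theorem koszulExp_mul {k : ℕ} (σ τ : Equiv.Perm (Fin k)) (d : Fin k → ZMod 2) :
    koszulExp (σ * τ) d = koszulExp σ d + koszulExp τ (fun i => d (σ i)) := by
  have key := pairSum_perm (fun u w => if σ w < σ u then d (σ u) * d (σ w) else 0) τ
  have h1 : ∀ ρ : Equiv.Perm (Fin k), koszulExp ρ d =
      pairSum (fun u w => if ρ w < ρ u then d (ρ u) * d (ρ w) else 0) := fun ρ => by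
    refine Finset.sum_congr rfl fun i _ => Finset.sum_congr rfl fun j _ => ?_
    split_ifs <;> simp_all
  rw [h1 (σ * τ), h1 σ]
  refine key.trans ?_
  congr 1
  refine Finset.sum_congr rfl fun i _ => Finset.sum_congr rfl fun j _ => ?_
  by_cases h : i < j ∧ τ j < τ i
  · rw [if_pos h, if_pos h]
    have hne : σ (τ i) ≠ σ (τ j) := by simpa using h.1.ne
    rcases lt_or_gt_of_ne hne with h' | h'
    · rw [if_neg h'.not_gt, if_pos h', zero_add, mul_comm]
    · rw [if_pos h', if_neg h'.not_gt, add_zero]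
  · rw [if_neg h, if_neg h]

/-- Expanding the product of total degrees `p + j` gives a form part, an `L[1]` part and mixed
terms. The mixed terms are exactly the change under `σ` of the exponent `pairSum` for moving all
forms to the left. -/
theorem koszulExp_add {k : ℕ} (σ : Equiv.Perm (Fin k)) (j p : Fin k → ZMod 2) :
    pairSum (fun i l => j i * p l) = koszulExp σ (fun i => p i + j i) + koszulExp σ p +
      koszulExp σ j + pairSum (fun i l => j (σ i) * p (σ l)) := by
  have h := pairSum_perm (fun i l => j i * p l) σ
  have h2 : (∑ i, ∑ l, if i < l ∧ σ l < σ i then j (σ i) * p (σ l) + j (σ l) * p (σ i) else 0) =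
      koszulExp σ (fun i => p i + j i) + koszulExp σ p + koszulExp σ j := by
    simp only [koszulExp, ← Finset.sum_add_distrib]
    refine Finset.sum_congr rfl fun i _ => Finset.sum_congr rfl fun l _ => ?_
    split_ifs
    · linear_combination (- (p (σ i) * p (σ l)) - j (σ i) * j (σ l)) * (CharTwo.two_eq_zero (R := ZMod 2))
    · simp
  rw [h, h2]
  linear_combination (-(koszulExp σ (fun i => p i + j i) + koszulExp σ p + koszulExp σ j)) *
    (CharTwo.two_eq_zero (R := ZMod 2))

/-! ### Unshuffles -/

/-- The permutation which lists first the elements of `T` and then those of its complement. -/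
def unshufflePerm {k : ℕ} (T : Finset (Fin k)) : Equiv.Perm (Fin k) :=
  (finCongr (by rw [Finset.card_add_card_compl, Fintype.card_fin] :
    T.card + Tᶜ.card = k)).symm.trans
    (finSumFinEquiv.symm.trans (finSumEquivOfFinset (s := T) rfl rfl))

theorem unshufflePerm_cases {k : ℕ} (T : Finset (Fin k)) (i : Fin k) :
    (∃ a : Fin T.card, i.val = a.val ∧ unshufflePerm T i = T.orderEmbOfFin rfl a) ∨
    (∃ a : Fin Tᶜ.card, i.val = T.card + a.val ∧ unshufflePerm T i = Tᶜ.orderEmbOfFin rfl a) := by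
  have hk : T.card + Tᶜ.card = k := by rw [Finset.card_add_card_compl, Fintype.card_fin]
  obtain ⟨i', rfl⟩ : ∃ i' : Fin (T.card + Tᶜ.card), i = finCongr hk i' := ⟨(finCongr hk).symm i, by simp⟩
  refine Fin.addCases (fun a => Or.inl ⟨a, by simp, ?_⟩) (fun a => Or.inr ⟨a, by simp, ?_⟩) i'
  · simp [unshufflePerm, finSumEquivOfFinset_inl]
  · simp [unshufflePerm, finSumEquivOfFinset_inr]

/-- Tuples indexed by `Fin T.card` and `Fin Tᶜ.card` are compared as lists, because `T.card +
Tᶜ.card` equals `k` only propositionally. -/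
theorem ofFn_unshufflePerm {V : Type*} {k : ℕ} (T : Finset (Fin k)) (v : Fin k → V) :
    List.ofFn (fun i => v (unshufflePerm T i)) = List.ofFn (sub v T) ++ List.ofFn (sub v Tᶜ) := by
  have hk : T.card + Tᶜ.card = k := by rw [Finset.card_add_card_compl, Fintype.card_fin]
  refine List.ext_getElem (by simp only [List.length_ofFn, List.length_append]; exact hk.symm) fun a h1 h2 => ?_
  simp only [List.length_ofFn] at h1
  simp only [List.getElem_ofFn, List.getElem_append, List.length_ofFn]
  rcases unshufflePerm_cases T ⟨a, h1⟩ with ⟨b, hb, e⟩ | ⟨b, hb, e⟩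
  · simp only at hb
    subst hb
    rw [dif_pos b.2, e]
    rfl
  · simp only at hb
    subst hb
    rw [dif_neg (by omega), e]
    simp only [sub]
    congr 2
    exact Fin.ext (by simp)

/-- Both blocks of an unshuffle are listed in increasing order, so an inversion must pair an element
of `T` with a smaller element outside `T`. -/
theorem koszulExp_unshufflePerm {k : ℕ} (T : Finset (Fin k)) (d : Fin k → ZMod 2) :
    koszulExp (unshufflePerm T) d = unshuffleExp T d := by
  have h : ∀ i j, (i < j ∧ unshufflePerm T j < unshufflePerm T i) ↔
      (unshufflePerm T i ∈ T ∧ unshufflePerm T j ∉ T ∧ unshufflePerm T j < unshufflePerm T i) := by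
    intro i j
    rcases unshufflePerm_cases T i with ⟨a, ha, ea⟩ | ⟨a, ha, ea⟩ <;>
    rcases unshufflePerm_cases T j with ⟨b, hb, eb⟩ | ⟨b, hb, eb⟩ <;>
    rw [ea, eb]
    · have h2 := Finset.orderEmbOfFin_mem T rfl b
      have : T.orderEmbOfFin rfl b < T.orderEmbOfFin rfl a ↔ b < a := by simp
      rw [this]
      simp only [h2, not_true, false_and, and_false, iff_false]
      rw [Fin.lt_def, Fin.lt_def, ha, hb]; omega
    · have h1 := Finset.orderEmbOfFin_mem T rfl a
      have h2 := Finset.mem_compl.1 (Finset.orderEmbOfFin_mem Tᶜ rfl b)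
      have : i < j := by rw [Fin.lt_def, ha, hb]; omega
      simp only [h1, h2, this, not_false_eq_true, true_and]
    · have h2 := Finset.orderEmbOfFin_mem T rfl b
      have : ¬ i < j := by rw [Fin.lt_def, ha, hb]; omega
      simp only [h2, this, not_true, false_and, and_false]
    · have h1 := Finset.mem_compl.1 (Finset.orderEmbOfFin_mem Tᶜ rfl a)
      have : Tᶜ.orderEmbOfFin rfl b < Tᶜ.orderEmbOfFin rfl a ↔ b < a := by simp
      rw [this]
      simp only [h1, false_and, iff_false]
      rw [Fin.lt_def, Fin.lt_def, ha, hb]; omega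
  simp only [koszulExp, h, unshuffleExp]
  rw [← Equiv.sum_comp (unshufflePerm T)
    (fun i => ∑ j, if i ∈ T ∧ j ∉ T ∧ j < i then d i * d j else 0)]
  exact Finset.sum_congr rfl fun i _ => Equiv.sum_comp (unshufflePerm T)
    (fun j => if unshufflePerm T i ∈ T ∧ j ∉ T ∧ j < unshufflePerm T i
      then d (unshufflePerm T i) * d j else 0)

theorem koszulSign_unshufflePerm {k : ℕ} (T : Finset (Fin k)) (d : Fin k → ℤ) :
    koszulSign (unshufflePerm T) d = unshuffleSign T d := by
  rw [koszulSign_eq, unshuffleSign_eq, koszulExp_unshufflePerm]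

theorem sum_sub {M : Type*} [AddCommMonoid M] {k : ℕ} (d : Fin k → M) (T : Finset (Fin k)) :
    ∑ a, sub d T a = ∑ i ∈ T, d i := by
  have : T = Finset.univ.map (T.orderEmbOfFin rfl).toEmbedding := by
    rw [Finset.map_eq_image]
    exact (Finset.image_orderEmbOfFin_univ T rfl).symm
  conv_rhs => rw [this]
  rw [Finset.sum_map]
  rfl

/-- Every index of the first block precedes every index of the second, so the pairs across the
blocks contribute a product of two sums. -/
theorem pairSum_append {k m n : ℕ} (h : m + n = k) (j p : Fin k → ZMod 2) (j₁ p₁ : Fin m → ZMod 2)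
    (j₂ p₂ : Fin n → ZMod 2) (hj : List.ofFn j = List.ofFn j₁ ++ List.ofFn j₂)
    (hp : List.ofFn p = List.ofFn p₁ ++ List.ofFn p₂) :
    pairSum (fun i l => j i * p l) = pairSum (fun i l => j₁ i * p₁ l) +
      pairSum (fun i l => j₂ i * p₂ l) + (∑ i, j₁ i) * ∑ i, p₂ i := by
  subst h
  rw [← List.ofFn_fin_append] at hj hp
  rw [List.ofFn_injective hj, List.ofFn_injective hp]
  simp only [pairSum, Fin.sum_univ_add, Fin.append_left, Fin.append_right]
  have e1 : ∀ (a : Fin m) (b : Fin n), Fin.castAdd n a < Fin.natAdd m b := fun a b => by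
    rw [Fin.lt_def]; simp; omega
  have e2 : ∀ (a : Fin m) (b : Fin n), ¬ Fin.natAdd m b < Fin.castAdd n a := fun a b => by
    exact (e1 a b).not_gt
  have e3 : ∀ a b : Fin m, Fin.castAdd n a < Fin.castAdd n b ↔ a < b := fun _ _ => Iff.rfl
  simp only [e1, e2, e3, if_true, if_false, Finset.sum_const_zero, zero_add,
    Fin.natAdd_lt_natAdd_iff, Finset.sum_add_distrib, Finset.sum_mul_sum]
  ring

/-- The case of an unshuffle in `koszulExp_add`. The last product is the cost of moving the forms of
the second block past the `L[1]` parts of the first. -/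
theorem unshuffleExp_add {k : ℕ} (T : Finset (Fin k)) (j p : Fin k → ZMod 2) :
    pairSum (fun i l => j i * p l) = unshuffleExp T (fun i => p i + j i) + unshuffleExp T p +
      unshuffleExp T j + (pairSum (fun i l => sub j T i * sub p T l) +
      pairSum (fun i l => sub j Tᶜ i * sub p Tᶜ l) + (∑ i ∈ T, j i) * ∑ i ∈ Tᶜ, p i) := by
  have hk : T.card + Tᶜ.card = k := by rw [Finset.card_add_card_compl, Fintype.card_fin]
  rw [koszulExp_add (unshufflePerm T) j p, koszulExp_unshufflePerm, koszulExp_unshufflePerm,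
    koszulExp_unshufflePerm, pairSum_append hk _ _ _ _ _ _ (ofFn_unshufflePerm T j)
      (ofFn_unshufflePerm T p), sum_sub, sum_sub]

/-- The two unshuffles differ by moving one whole block past the other: together their inversions
are all pairs with one element in `T` and one outside. -/
theorem unshuffleExp_compl {k : ℕ} (T : Finset (Fin k)) (d : Fin k → ZMod 2) :
    unshuffleExp Tᶜ d = unshuffleExp T d + (∑ i ∈ T, d i) * ∑ i ∈ Tᶜ, d i := by
  have h : (∑ i ∈ T, d i) * ∑ i ∈ Tᶜ, d i = ∑ i, ∑ j, if i ∈ T ∧ j ∉ T then d i * d j else 0 := by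
    rw [Finset.sum_mul_sum, ← Finset.sum_subset (Finset.subset_univ T)]
    · refine Finset.sum_congr rfl fun i hi => ?_
      rw [← Finset.sum_subset (Finset.subset_univ Tᶜ)]
      · exact Finset.sum_congr rfl fun j hj => by rw [if_pos ⟨hi, by simpa using hj⟩]
      · exact fun j _ hj => if_neg fun h => hj (by simpa using h.2)
    · exact fun i _ hi => Finset.sum_eq_zero fun j _ => if_neg fun h => hi h.1
  have h2 : unshuffleExp Tᶜ d = ∑ i, ∑ j, if i ∈ T ∧ j ∉ T ∧ i < j then d i * d j else 0 := by
    rw [unshuffleExp, Finset.sum_comm]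
    refine Finset.sum_congr rfl fun i _ => Finset.sum_congr rfl fun j _ => ?_
    simp only [Finset.mem_compl, not_not, mul_comm]
    congr 1
    exact propext ⟨fun h => ⟨h.2.1, h.1, h.2.2⟩, fun h => ⟨h.2.1, h.1, h.2.2⟩⟩
  rw [h, h2, unshuffleExp, ← Finset.sum_add_distrib]
  refine Finset.sum_congr rfl fun i _ => ?_
  rw [← Finset.sum_add_distrib]
  refine Finset.sum_congr rfl fun j _ => ?_
  by_cases hT : i ∈ T ∧ j ∉ T
  · have hne : i ≠ j := fun h => hT.2 (h ▸ hT.1)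
    rcases lt_or_gt_of_ne hne with h' | h'
    · simp [hT.1, hT.2, h', h'.not_gt]
    · simp [hT.1, hT.2, h', h'.not_gt, CharTwo.add_self_eq_zero]
  · rw [if_neg hT, if_neg (fun h => hT ⟨h.1, h.2.1⟩), if_neg (fun h => hT ⟨h.1, h.2.1⟩), add_zero]

/-! ### Families of maps and lists -/

/-- The value of a family of maps on tuples at a list. -/
def onList {V N : Type*} (X : ∀ k, (Fin k → V) → N) (l : List V) : N := X l.length l.get

/-- Lets values of a family at tuples of provably equal lengths be compared through an equality of
lists, with no casts. -/
theorem onList_ofFn {V N : Type*} (X : ∀ k, (Fin k → V) → N) {k : ℕ} (v : Fin k → V) :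
    onList X (List.ofFn v) = X k v := by
  have : ∀ (m : ℕ) (h : m = k) (w : Fin m → V), (∀ i, w i = v (Fin.cast h i)) → X m w = X k v := by
    rintro m rfl w hw
    exact congrArg _ (funext hw)
  exact this _ (List.length_ofFn) _ fun i => by simp; rfl

/-- Both lists of positions are strictly increasing and have the same elements, hence coincide. -/
theorem ofFn_sub {V : Type*} {k : ℕ} (v : Fin k → V) (T : Finset (Fin k)) :
    List.ofFn (sub v T) = ((List.finRange k).filter (· ∈ T)).map v := by
  have h : List.ofFn (T.orderEmbOfFin rfl) = (List.finRange k).filter (· ∈ T) := by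
    refine List.Perm.eq_of_pairwise' (r := (· < ·)) ?_ ?_ ?_
    · rw [List.pairwise_ofFn]
      intro i j hij
      simpa using hij
    · exact List.Pairwise.filter _ (List.pairwise_lt_finRange k)
    · rw [List.perm_ext_iff_of_nodup]
      · intro a
        rw [List.mem_ofFn']
        simp
      · rw [List.nodup_ofFn]; exact (T.orderEmbOfFin rfl).injective
      · exact (List.nodup_finRange k).filter _
  rw [← h, List.map_ofFn]
  rfl

theorem sub_singleton_apply {V : Type*} {k : ℕ} (v : Fin k → V) (i : Fin k)
    (a : Fin ({i} : Finset (Fin k)).card) : sub v {i} a = v i :=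
  congrArg v (Finset.mem_singleton.1 (Finset.orderEmbOfFin_mem {i} rfl a))

theorem ofFn_sub_singleton {V : Type*} {k : ℕ} (v : Fin k → V) (i : Fin k) :
    List.ofFn (sub v {i}) = [v i] := by
  have h : ∀ (m : ℕ) (_ : m = 1) (f : Fin m → V), (∀ a, f a = v i) → List.ofFn f = [v i] := by
    rintro m rfl f hf
    simp [hf]
  exact h _ (Finset.card_singleton i) _ (sub_singleton_apply v i)

/-! ### The exterior algebra -/

section Exterior

variable {n : ℕ}

/-- The source of graded commutativity: a covector passes any form at the cost of the parity
involution. -/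
theorem ext_ι_mul (a : Module.Dual ℝ (Rn n)) (l : ExtAlg n) :
    ExteriorAlgebra.ι ℝ a * l = CliffordAlgebra.involute l * ExteriorAlgebra.ι ℝ a := by
  induction l using ExteriorAlgebra.induction with
  | algebraMap r => rw [AlgHom.commutes, Algebra.commutes]
  | ι b =>
    have h := ExteriorAlgebra.ι_add_mul_swap (R := ℝ) a b
    have h2 : CliffordAlgebra.involute (ExteriorAlgebra.ι ℝ b) = - ExteriorAlgebra.ι ℝ b :=
      CliffordAlgebra.involute_ι b
    rw [h2, neg_mul]
    exact eq_neg_of_add_eq_zero_left h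
  | mul x y hx hy => rw [map_mul, ← mul_assoc, hx, mul_assoc, hy, mul_assoc]
  | add x y hx hy => rw [map_add, mul_add, add_mul, hx, hy]

theorem involute_of_mem {p : ℕ} {l : ExtAlg n} (hl : l ∈ ⋀[ℝ]^p (Module.Dual ℝ (Rn n))) :
    CliffordAlgebra.involute l = parSign p • l := by
  induction hl using Submodule.pow_induction_on_left' with
  | algebraMap r => rw [AlgHom.commutes, Nat.cast_zero, parSign_zero, one_smul]
  | add x y i _ _ hx hy => rw [map_add, hx, hy, smul_add]
  | mem_mul m hm i x _ hx =>
    obtain ⟨a, rfl⟩ := hm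
    have h2 : CliffordAlgebra.involute (ExteriorAlgebra.ι ℝ a) = - ExteriorAlgebra.ι ℝ a :=
      CliffordAlgebra.involute_ι a
    rw [map_mul, hx, h2]
    push_cast
    rw [parSign_add, parSign_one]
    simp

theorem ext_mul_comm {p q : ℕ} {l m : ExtAlg n} (hl : l ∈ ⋀[ℝ]^p (Module.Dual ℝ (Rn n)))
    (hm : m ∈ ⋀[ℝ]^q (Module.Dual ℝ (Rn n))) :
    l * m = parSign (p * q) • (m * l) := by
  induction hl using Submodule.pow_induction_on_left' with
  | algebraMap r => rw [Nat.cast_zero, zero_mul, parSign_zero, one_smul, Algebra.commutes]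
  | add x y i _ _ hx hy => rw [add_mul, mul_add, smul_add, hx, hy]
  | mem_mul a ha i x _ hx =>
    obtain ⟨a, rfl⟩ := ha
    rw [mul_assoc, hx, mul_smul_comm, ← mul_assoc, ext_ι_mul,
      involute_of_mem hm, smul_mul_assoc, smul_mul_assoc, smul_smul, ← parSign_add, mul_assoc]
    congr 2
    push_cast
    ring

theorem contr_mul (i : Fin n) (l m : ExtAlg n) :
    contr i (l * m) = contr i l * m + CliffordAlgebra.involute l * contr i m := by
  induction l using ExteriorAlgebra.induction generalizing m with
  | algebraMap r =>
    rw [AlgHom.commutes, contr, CliffordAlgebra.contractLeft_algebraMap_mul,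
      CliffordAlgebra.contractLeft_algebraMap, zero_mul, zero_add]
  | ι b =>
    have h2 : CliffordAlgebra.involute (ExteriorAlgebra.ι ℝ b) = - ExteriorAlgebra.ι ℝ b :=
      CliffordAlgebra.involute_ι b
    have h3 := CliffordAlgebra.contractLeft_ι_mul (Q := (0 : QuadraticForm ℝ (Module.Dual ℝ (Rn n))))
      (d := Module.Dual.eval ℝ (Rn n) (stdVec i)) b m
    have h4 := CliffordAlgebra.contractLeft_ι (Q := (0 : QuadraticForm ℝ (Module.Dual ℝ (Rn n))))
      (d := Module.Dual.eval ℝ (Rn n) (stdVec i)) b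
    rw [h2]
    refine h3.trans ?_
    refine Eq.trans ?_ (congrArg (fun z => z * m + _) h4.symm)
    rw [neg_mul, ← sub_eq_add_neg, Algebra.smul_def]
    rfl
  | mul x y hx hy =>
    rw [mul_assoc, hx, hy, hx y, map_mul, mul_add, add_mul, mul_assoc, mul_assoc, mul_assoc,
      add_assoc]
  | add x y hx hy =>
    rw [add_mul, map_add, hx, hy, map_add, map_add, add_mul, add_mul]
    abel

theorem dxBasis_stdVec (i j : Fin n) : dxBasis n i (stdVec j) = if i = j then 1 else 0 := by
  have : (stdVec j : Rn n) = (EuclideanSpace.basisFun (Fin n) ℝ).toBasis j := by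
    simp [stdVec]
  rw [dxBasis, this, Module.Basis.dualBasis_apply_self]
  simp [eq_comm]

theorem contr_dxWedge (i j : Fin n) (l : ExtAlg n) :
    contr i (dxWedge j l) = (if i = j then l else 0) - dxWedge j (contr i l) := by
  have h := CliffordAlgebra.contractLeft_ι_mul (Q := (0 : QuadraticForm ℝ (Module.Dual ℝ (Rn n))))
      (d := Module.Dual.eval ℝ (Rn n) (stdVec i)) (dxBasis n j) l
  refine h.trans ?_
  congr 1
  rw [Module.Dual.eval_apply, dxBasis_stdVec]
  by_cases h : i = j
  · simp [h]
  · simp [h, Ne.symm h]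

theorem contr_contr (i j : Fin n) (l : ExtAlg n) :
    contr i (contr j l) = - contr j (contr i l) :=
  CliffordAlgebra.contractLeft_comm _ _ _

theorem contr_involute (i : Fin n) (l : ExtAlg n) :
    contr i (CliffordAlgebra.involute l) = - CliffordAlgebra.involute (contr i l) := by
  induction l using ExteriorAlgebra.induction with
  | algebraMap r =>
    rw [AlgHom.commutes, contr, CliffordAlgebra.contractLeft_algebraMap, map_zero, neg_zero]
  | ι b =>
    have h2 : CliffordAlgebra.involute (ExteriorAlgebra.ι ℝ b) = - ExteriorAlgebra.ι ℝ b :=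
      CliffordAlgebra.involute_ι b
    have h4 : contr i (ExteriorAlgebra.ι ℝ b) = algebraMap ℝ _ (b (stdVec i)) :=
      CliffordAlgebra.contractLeft_ι (Q := (0 : QuadraticForm ℝ (Module.Dual ℝ (Rn n))))
        (d := Module.Dual.eval ℝ (Rn n) (stdVec i)) b
    rw [h2, map_neg, h4, AlgHom.commutes]
  | mul x y hx hy =>
    rw [map_mul, contr_mul, hx, hy, contr_mul, map_add, map_mul, map_mul, neg_add, neg_mul, mul_neg]
  | add x y hx hy => rw [map_add, map_add, hx, hy, map_add, map_add, neg_add]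

theorem dxWedge_involute (i : Fin n) (l : ExtAlg n) :
    dxWedge i (CliffordAlgebra.involute l) = - CliffordAlgebra.involute (dxWedge i l) := by
  have h2 : CliffordAlgebra.involute (ExteriorAlgebra.ι ℝ (dxBasis n i)) =
      - ExteriorAlgebra.ι ℝ (dxBasis n i) := CliffordAlgebra.involute_ι _
  simp only [dxWedge, LinearMap.mulLeft_apply, map_mul]
  rw [h2, neg_mul, neg_neg]

theorem dxWedge_dxWedge (i j : Fin n) (l : ExtAlg n) :
    dxWedge i (dxWedge j l) = - dxWedge j (dxWedge i l) := by
  have h := ExteriorAlgebra.ι_add_mul_swap (R := ℝ) (dxBasis n i) (dxBasis n j)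
  simp only [dxWedge, LinearMap.mulLeft_apply, ← mul_assoc]
  rw [eq_neg_of_add_eq_zero_left h, neg_mul]

theorem contr_mem {i : Fin n} {p : ℕ} {l : ExtAlg n}
    (hl : l ∈ ⋀[ℝ]^(p + 1) (Module.Dual ℝ (Rn n))) :
    contr i l ∈ ⋀[ℝ]^p (Module.Dual ℝ (Rn n)) := by
  induction p generalizing l with
  | zero =>
    rw [zero_add] at hl
    have hl' : l ∈ LinearMap.range (ExteriorAlgebra.ι ℝ (M := Module.Dual ℝ (Rn n))) := by
      simpa [ExteriorAlgebra.exteriorPower] using hl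
    obtain ⟨b, rfl⟩ := hl'
    have h4 : contr i (ExteriorAlgebra.ι ℝ b) = algebraMap ℝ _ (b (stdVec i)) :=
      CliffordAlgebra.contractLeft_ι (Q := (0 : QuadraticForm ℝ (Module.Dual ℝ (Rn n))))
        (d := Module.Dual.eval ℝ (Rn n) (stdVec i)) b
    rw [h4]
    simp [ExteriorAlgebra.exteriorPower]
  | succ p ih =>
    have hl' := hl
    rw [ExteriorAlgebra.exteriorPower, pow_succ'] at hl'
    refine Submodule.mul_induction_on hl' ?_ ?_
    · rintro _ ⟨b, rfl⟩ m hm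
      have h2 : CliffordAlgebra.involute (ExteriorAlgebra.ι ℝ b) = - ExteriorAlgebra.ι ℝ b :=
        CliffordAlgebra.involute_ι b
      have h4 : contr i (ExteriorAlgebra.ι ℝ b) = algebraMap ℝ _ (b (stdVec i)) :=
        CliffordAlgebra.contractLeft_ι (Q := (0 : QuadraticForm ℝ (Module.Dual ℝ (Rn n))))
          (d := Module.Dual.eval ℝ (Rn n) (stdVec i)) b
      rw [contr_mul, h4, h2, neg_mul, ← Algebra.smul_def]
      refine Submodule.add_mem _ (Submodule.smul_mem _ _ hm) (Submodule.neg_mem _ ?_)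
      rw [ExteriorAlgebra.exteriorPower, pow_succ']
      exact Submodule.mul_mem_mul ⟨b, rfl⟩ (ih hm)
    · intro x y hx hy
      rw [map_add]
      exact Submodule.add_mem _ hx hy

theorem contr_eq_zero {i : Fin n} {l : ExtAlg n}
    (hl : l ∈ ⋀[ℝ]^0 (Module.Dual ℝ (Rn n))) : contr i l = 0 := by
  rw [ExteriorAlgebra.exteriorPower, pow_zero] at hl
  obtain ⟨r, rfl⟩ := Submodule.mem_one.1 hl
  exact CliffordAlgebra.contractLeft_algebraMap _ _ r

theorem dxWedge_mem {i : Fin n} {p : ℕ} {l : ExtAlg n}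
    (hl : l ∈ ⋀[ℝ]^p (Module.Dual ℝ (Rn n))) :
    dxWedge i l ∈ ⋀[ℝ]^(p + 1) (Module.Dual ℝ (Rn n)) := by
  rw [ExteriorAlgebra.exteriorPower, pow_succ']
  exact Submodule.mul_mem_mul ⟨_, rfl⟩ hl

end Exterior

/-! ### Smooth functions -/

section Smooth

variable {n : ℕ}

theorem SmoothFn.differentiableAt (f : SmoothFn n) (x : Rn n) : DifferentiableAt ℝ f.fn x :=
  (f.contDiff.differentiable (by simp)).differentiableAt

theorem partialD_mul (i : Fin n) (f g : SmoothFn n) :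
    partialD i (f * g) = partialD i f * g + f * partialD i g := SmoothFn.ext fun x => by
  have h := congrArg (fun φ => φ (stdVec i)) (fderiv_mul (f.differentiableAt x) (g.differentiableAt x))
  refine Eq.trans h ?_
  change f.fn x • fderiv ℝ g.fn x (stdVec i) + g.fn x • fderiv ℝ f.fn x (stdVec i) =
    fderiv ℝ f.fn x (stdVec i) * g.fn x + f.fn x * fderiv ℝ g.fn x (stdVec i)
  simp only [smul_eq_mul]
  ring

theorem partialD_partialD (i j : Fin n) (f : SmoothFn n) :
    partialD i (partialD j f) = partialD j (partialD i f) := SmoothFn.ext fun x => by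
  have hs : IsSymmSndFDerivAt ℝ f.fn x :=
    (f.contDiff.contDiffAt).isSymmSndFDerivAt (by
      rw [minSmoothness_of_isRCLikeNormedField]; exact WithTop.coe_le_coe.2 le_top)
  have hd : DifferentiableAt ℝ (fderiv ℝ f.fn) x :=
    ((f.contDiff.fderiv_right (m := ∞) le_rfl).differentiable (by simp)).differentiableAt
  have key : ∀ v w : Rn n, fderiv ℝ (fun y => fderiv ℝ f.fn y v) x w =
      fderiv ℝ (fderiv ℝ f.fn) x w v := fun v w => by
    rw [fderiv_clm_apply hd (differentiableAt_const v)]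
    simp
  exact ((key _ _).trans (hs.eq _ _)).trans (key _ _).symm

end Smooth

/-! ### Differential forms -/

section Forms

variable {n : ℕ}

theorem extD_tmul (f : SmoothFn n) (l : ExtAlg n) :
    extD n (f ⊗ₜ l) = ∑ i, partialD i f ⊗ₜ[ℝ] dxWedge i l := by
  simp [extD, LinearMap.sum_apply]

theorem contrField_tmul (ξ : Fin n → SmoothFn n) (f : SmoothFn n) (l : ExtAlg n) :
    contrField ξ (f ⊗ₜ l) = ∑ i, (ξ i * f) ⊗ₜ[ℝ] contr i l := by
  simp [contrField, LinearMap.sum_apply]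

theorem lieDer_tmul (ξ : Fin n → SmoothFn n) (f : SmoothFn n) (l : ExtAlg n) :
    lieDer ξ (f ⊗ₜ l) = ∑ i, (ξ i * partialD i f) ⊗ₜ[ℝ] l +
      ∑ i, ∑ j, (partialD i (ξ j) * f) ⊗ₜ[ℝ] dxWedge i (contr j l) := by
  simp [lieDer, LinearMap.sum_apply]

theorem formInv_tmul (f : SmoothFn n) (l : ExtAlg n) :
    formInv n (f ⊗ₜ l) = f ⊗ₜ[ℝ] CliffordAlgebra.involute l := rfl

theorem formInv_formInv (α : Forms n) : formInv n (formInv n α) = α := by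
  induction α using TensorProduct.induction_on with
  | zero => simp
  | add x y hx hy => rw [map_add, map_add, hx, hy]
  | tmul f l => rw [formInv_tmul, formInv_tmul, CliffordAlgebra.involute_involute]

theorem extD_formInv (α : Forms n) : extD n (formInv n α) = - formInv n (extD n α) := by
  induction α using TensorProduct.induction_on with
  | zero => simp
  | add x y hx hy => rw [map_add, map_add, hx, hy, map_add, map_add, neg_add]
  | tmul f l =>
    simp only [formInv_tmul, extD_tmul, map_sum, dxWedge_involute, TensorProduct.tmul_neg,
      Finset.sum_neg_distrib]

theorem contrField_formInv (ξ : Fin n → SmoothFn n) (α : Forms n) :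
    contrField ξ (formInv n α) = - formInv n (contrField ξ α) := by
  induction α using TensorProduct.induction_on with
  | zero => simp
  | add x y hx hy => rw [map_add, map_add, hx, hy, map_add, map_add, neg_add]
  | tmul f l =>
    simp only [formInv_tmul, contrField_tmul, map_sum, contr_involute, TensorProduct.tmul_neg,
      Finset.sum_neg_distrib]

theorem extD_mul (α β : Forms n) :
    extD n (α * β) = extD n α * β + formInv n α * extD n β := by
  induction α using TensorProduct.induction_on with
  | zero => simp
  | add x y hx hy => rw [add_mul, map_add, hx, hy, map_add, map_add, add_mul, add_mul]; abel
  | tmul f l =>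
    induction β using TensorProduct.induction_on with
    | zero => simp
    | add x y hx hy => rw [mul_add, map_add, hx, hy, map_add, mul_add, mul_add]; abel
    | tmul g m =>
      simp only [formInv_tmul, extD_tmul, Algebra.TensorProduct.tmul_mul_tmul, Finset.sum_mul,
        Finset.mul_sum, ← Finset.sum_add_distrib]
      refine Finset.sum_congr rfl fun i _ => ?_
      have h : CliffordAlgebra.involute l * dxWedge i m = dxWedge i (l * m) := by
        simp only [dxWedge, LinearMap.mulLeft_apply]
        rw [← mul_assoc, ← ext_ι_mul, mul_assoc]
      rw [h, partialD_mul, TensorProduct.add_tmul]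
      simp only [dxWedge, LinearMap.mulLeft_apply, mul_assoc]

theorem contrField_mul (ξ : Fin n → SmoothFn n) (α β : Forms n) :
    contrField ξ (α * β) = contrField ξ α * β + formInv n α * contrField ξ β := by
  induction α using TensorProduct.induction_on with
  | zero => simp
  | add x y hx hy => rw [add_mul, map_add, hx, hy, map_add, map_add, add_mul, add_mul]; abel
  | tmul f l =>
    induction β using TensorProduct.induction_on with
    | zero => simp
    | add x y hx hy => rw [mul_add, map_add, hx, hy, map_add, mul_add, mul_add]; abel
    | tmul g m =>
      simp only [formInv_tmul, contrField_tmul, Algebra.TensorProduct.tmul_mul_tmul, Finset.sum_mul,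
        Finset.mul_sum, ← Finset.sum_add_distrib]
      refine Finset.sum_congr rfl fun i _ => ?_
      rw [contr_mul, TensorProduct.tmul_add, mul_assoc, mul_left_comm f]

/-- Second partial derivatives are symmetric while the factors `dxᵢ` anticommute, so the double sum
equals its own negative. -/
theorem extD_extD (α : Forms n) : extD n (extD n α) = 0 := by
  induction α using TensorProduct.induction_on with
  | zero => simp
  | add x y hx hy => rw [map_add, map_add, hx, hy, add_zero]
  | tmul f l =>
    simp only [extD_tmul, map_sum]
    set S := ∑ i, ∑ j, partialD j (partialD i f) ⊗ₜ[ℝ] dxWedge j (dxWedge i l) with hS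
    have h : S = - S := by
      conv_lhs => rw [hS, Finset.sum_comm]
      rw [hS]
      simp only [← Finset.sum_neg_distrib, ← TensorProduct.tmul_neg]
      refine Finset.sum_congr rfl fun i _ => Finset.sum_congr rfl fun j _ => ?_
      rw [partialD_partialD, dxWedge_dxWedge]
    have h2 : (2 : ℝ) • S = 0 := by rw [two_smul]; nth_rewrite 1 [h]; exact neg_add_cancel S
    simpa using h2

/-- Contracting `dxᵢ ∧ l` produces a Kronecker delta, which gives the transport term of the
coordinate formula; the derivative of `ξʲ` gives the other term, and the rest cancels. The later
properties of `lieDer` are mostly derived from this identity instead of from coordinates. -/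
theorem cartan (ξ : Fin n → SmoothFn n) (α : Forms n) :
    contrField ξ (extD n α) + extD n (contrField ξ α) = lieDer ξ α := by
  induction α using TensorProduct.induction_on with
  | zero => simp
  | add x y hx hy => simp only [map_add]; rw [← hx, ← hy]; abel
  | tmul f l =>
    simp only [extD_tmul, contrField_tmul, lieDer_tmul, map_sum]
    rw [Finset.sum_comm (γ := Fin n) (f := fun j i =>
      partialD i (ξ j * f) ⊗ₜ[ℝ] dxWedge i (contr j l)), ← Finset.sum_add_distrib,
      ← Finset.sum_add_distrib]
    refine Finset.sum_congr rfl fun i _ => ?_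
    have h : (ξ i * partialD i f) ⊗ₜ[ℝ] l =
        ∑ j, (ξ j * partialD i f) ⊗ₜ[ℝ] (if j = i then l else 0) := by
      rw [Finset.sum_eq_single i]
      · simp
      · intro j _ hj; simp [hj]
      · simp
    rw [h, ← Finset.sum_add_distrib, ← Finset.sum_add_distrib]
    refine Finset.sum_congr rfl fun j _ => ?_
    rw [contr_dxWedge, partialD_mul, TensorProduct.add_tmul, TensorProduct.tmul_sub]
    abel

/-- The graded commutator of two odd derivations is an even derivation; the mixed terms cancel
because `d` and `ι_ξ` anticommute with the parity involution. -/
theorem lieDer_mul (ξ : Fin n → SmoothFn n) (α β : Forms n) :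
    lieDer ξ (α * β) = lieDer ξ α * β + α * lieDer ξ β := by
  simp only [← cartan, extD_mul, contrField_mul, map_add, extD_formInv, contrField_formInv,
    formInv_formInv, add_mul, mul_add, neg_mul]
  abel

theorem lieDer_formInv (ξ : Fin n → SmoothFn n) (α : Forms n) :
    lieDer ξ (formInv n α) = formInv n (lieDer ξ α) := by
  simp only [← cartan, extD_formInv, contrField_formInv, map_neg, map_add, neg_neg]

theorem lieDer_extD (ξ : Fin n → SmoothFn n) (α : Forms n) :
    lieDer ξ (extD n α) = extD n (lieDer ξ α) := by
  simp only [← cartan, extD_extD, map_add, map_zero, zero_add, add_zero]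

theorem contrField_contrField (ξ η : Fin n → SmoothFn n) (α : Forms n) :
    contrField ξ (contrField η α) = - contrField η (contrField ξ α) := by
  induction α using TensorProduct.induction_on with
  | zero => simp
  | add x y hx hy => simp only [map_add]; rw [hx, hy]; abel
  | tmul f l =>
    simp only [contrField_tmul, map_sum]
    rw [Finset.sum_comm]
    simp only [← Finset.sum_neg_distrib, ← TensorProduct.tmul_neg]
    refine Finset.sum_congr rfl fun i _ => Finset.sum_congr rfl fun j _ => ?_
    rw [contr_contr, mul_left_comm]

/-- The Lie bracket of vector fields. -/
def fieldBracket (ξ η : Fin n → SmoothFn n) (j : Fin n) : SmoothFn n :=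
  ∑ i, (ξ i * partialD i (η j) - η i * partialD i (ξ j))

/-- Done in coordinates. The terms that differentiate the coefficient `f` cancel, as do the terms
with two contractions; what is left are the two halves of the bracket of vector fields. -/
theorem lieDer_contrField (ξ η : Fin n → SmoothFn n) (α : Forms n) :
    lieDer ξ (contrField η α) - contrField η (lieDer ξ α) = contrField (fieldBracket ξ η) α := by
  induction α using TensorProduct.induction_on with
  | zero => simp
  | add x y hx hy => simp only [map_add]; rw [← hx, ← hy]; abel
  | tmul f l =>
    have e1 : lieDer ξ (contrField η (f ⊗ₜ l)) =
        ∑ a, ∑ i, (ξ i * partialD i (η a) * f) ⊗ₜ[ℝ] contr a l +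
        (∑ a, ∑ i, (ξ i * η a * partialD i f) ⊗ₜ[ℝ] contr a l +
        ∑ a, ∑ i, ∑ j, (partialD i (ξ j) * η a * f) ⊗ₜ[ℝ] dxWedge i (contr j (contr a l))) := by
      simp only [contrField_tmul, map_sum, lieDer_tmul, partialD_mul, ← Finset.sum_add_distrib]
      refine Finset.sum_congr rfl fun a _ => Finset.sum_congr rfl fun i _ => ?_
      rw [← add_assoc, ← TensorProduct.add_tmul]
      congr 1
      · congr 1
        ring
      · refine Finset.sum_congr rfl fun j _ => ?_
        rw [mul_assoc]
    have e2 : contrField η (lieDer ξ (f ⊗ₜ l)) =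
        ∑ a, ∑ i, (ξ i * η a * partialD i f) ⊗ₜ[ℝ] contr a l +
        ∑ a, ∑ i, ∑ j, (partialD i (ξ j) * η a * f) ⊗ₜ[ℝ] contr a (dxWedge i (contr j l)) := by
      simp only [contrField_tmul, map_add, map_sum, lieDer_tmul]
      congr 1
      · rw [Finset.sum_comm]
        refine Finset.sum_congr rfl fun a _ => Finset.sum_congr rfl fun i _ => ?_
        congr 1
        ring
      · conv_rhs => rw [Finset.sum_comm]
        refine Finset.sum_congr rfl fun i _ => ?_
        conv_rhs => rw [Finset.sum_comm]
        refine Finset.sum_congr rfl fun j _ => Finset.sum_congr rfl fun a _ => ?_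
        congr 1
        ring
    -- Moving `contr a` past `dxᵢ` leaves a delta `a = i`, which produces the half `η(ξʲ)` of the
    -- bracket.
    have e3 : ∑ a, ∑ i, ∑ j, (partialD i (ξ j) * η a * f) ⊗ₜ[ℝ] contr a (dxWedge i (contr j l)) =
        ∑ j, ∑ i, (η i * partialD i (ξ j) * f) ⊗ₜ[ℝ] contr j l +
        ∑ a, ∑ i, ∑ j, (partialD i (ξ j) * η a * f) ⊗ₜ[ℝ] dxWedge i (contr j (contr a l)) := by
      have h : ∑ j, ∑ i, (η i * partialD i (ξ j) * f) ⊗ₜ[ℝ] contr j l =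
          ∑ a, ∑ i, ∑ j, (partialD i (ξ j) * η a * f) ⊗ₜ[ℝ] (if a = i then contr j l else 0) := by
        conv_lhs => rw [Finset.sum_comm]
        refine Finset.sum_congr rfl fun a _ => ?_
        conv_rhs => rw [Finset.sum_eq_single a (fun i _ hi => by simp [hi.symm]) (by simp)]
        · refine Finset.sum_congr rfl fun j _ => ?_
          rw [if_pos rfl]
          congr 1
          ring
      rw [h]
      simp only [← Finset.sum_add_distrib]
      refine Finset.sum_congr rfl fun a _ => Finset.sum_congr rfl fun i _ =>
        Finset.sum_congr rfl fun j _ => ?_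
      rw [contr_dxWedge, contr_contr a j, map_neg, sub_neg_eq_add, TensorProduct.tmul_add]
    rw [e1, e2, e3, contrField_tmul]
    have e4 : ∑ j, (fieldBracket ξ η j * f) ⊗ₜ[ℝ] contr j l =
        ∑ a, ∑ i, (ξ i * partialD i (η a) * f) ⊗ₜ[ℝ] contr a l -
        ∑ j, ∑ i, (η i * partialD i (ξ j) * f) ⊗ₜ[ℝ] contr j l := by
      rw [← Finset.sum_sub_distrib]
      refine Finset.sum_congr rfl fun j _ => ?_
      simp only [fieldBracket, Finset.sum_mul, TensorProduct.sum_tmul, sub_mul,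
        TensorProduct.sub_tmul, Finset.sum_sub_distrib]
    rw [e4]
    abel

/-- Formal from Cartan's formula: `L_ξ` commutes with `d`, and its commutator with `ι_η` is already
known. -/
theorem lieDer_lieDer (ξ η : Fin n → SmoothFn n) (α : Forms n) :
    lieDer ξ (lieDer η α) - lieDer η (lieDer ξ α) = lieDer (fieldBracket ξ η) α := by
  rw [← cartan η α, ← cartan (fieldBracket ξ η) α, ← lieDer_contrField, ← lieDer_contrField,
    ← cartan η (lieDer ξ α)]
  simp only [map_add, map_sub, lieDer_extD]
  abel

end Forms

/-! ### Degrees of differential forms. -/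

section FormDegree

variable {n : ℕ}

/-- No closure of `P` under scalars is asked for, because a scalar can be absorbed in the
coefficient function of a generator. -/
theorem formDeg_induction {p : ℕ} {P : Forms n → Prop} (h0 : P 0)
    (hadd : ∀ α β, P α → P β → P (α + β))
    (ht : ∀ (f : SmoothFn n) (l : ExtAlg n), l ∈ ⋀[ℝ]^p (Module.Dual ℝ (Rn n)) → P (f ⊗ₜ l))
    {α : Forms n} (hα : α ∈ formDeg n p) : P α := by
  have key : α ∈ formDeg n p ∧ P α := by
    refine Submodule.closure_induction (p := fun x _ => x ∈ formDeg n p ∧ P x) ?_ ?_ ?_ hα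
    · exact ⟨zero_mem _, h0⟩
    · rintro x y _ _ ⟨hx, hx'⟩ ⟨hy, hy'⟩
      exact ⟨add_mem hx hy, hadd _ _ hx' hy'⟩
    · rintro c x ⟨f, l, hl, rfl⟩
      rw [TensorProduct.smul_tmul']
      exact ⟨Submodule.subset_span ⟨_, l, hl, rfl⟩, ht _ l hl⟩
  exact key.2

theorem tmul_mem_formDeg {p : ℕ} (f : SmoothFn n) {l : ExtAlg n}
    (hl : l ∈ ⋀[ℝ]^p (Module.Dual ℝ (Rn n))) : f ⊗ₜ[ℝ] l ∈ formDeg n p :=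
  Submodule.subset_span ⟨f, l, hl, rfl⟩

theorem forms_induction {P : Forms n → Prop}
    (hadd : ∀ α β, P α → P β → P (α + β))
    (ht : ∀ (p : ℕ) (f : SmoothFn n) (l : ExtAlg n), l ∈ ⋀[ℝ]^p (Module.Dual ℝ (Rn n)) →
      P (f ⊗ₜ l)) (α : Forms n) : P α := by
  have h0 : P 0 := by
    have := ht 0 0 0 (zero_mem _)
    rwa [TensorProduct.zero_tmul] at this
  induction α using TensorProduct.induction_on with
  | zero => exact h0
  | add x y hx hy => exact hadd _ _ hx hy
  | tmul f l =>
    induction l using DirectSum.Decomposition.inductionOn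
      (fun i => ⋀[ℝ]^i (Module.Dual ℝ (Rn n))) with
    | zero => rwa [TensorProduct.tmul_zero]
    | homogeneous m => exact ht _ f m m.2
    | add x y hx hy => rw [TensorProduct.tmul_add]; exact hadd _ _ hx hy

theorem formInv_of_mem {p : ℕ} {α : Forms n} (hα : α ∈ formDeg n p) :
    formInv n α = parSign p • α := by
  refine formDeg_induction (P := fun α => formInv n α = parSign p • α) (by simp) ?_ ?_ hα
  · intro α β h1 h2
    rw [map_add, h1, h2, smul_add]
  · intro f l hl
    rw [formInv_tmul, involute_of_mem hl, TensorProduct.tmul_smul]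

theorem formInv_pow_of_mem {p : ℕ} {α : Forms n} (hα : α ∈ formDeg n p) (m : ℕ) :
    (formInv n ^ m) α = parSign (m * p) • α := by
  induction m with
  | zero => simp [parSign_zero]
  | succ m ih =>
    rw [pow_succ, Module.End.mul_apply, formInv_of_mem hα, map_smul, ih, smul_smul, ← parSign_add]
    congr 2
    push_cast
    ring

theorem formDeg_mul {p q : ℕ} {α β : Forms n} (hα : α ∈ formDeg n p) (hβ : β ∈ formDeg n q) :
    α * β ∈ formDeg n (p + q) := by
  refine formDeg_induction (P := fun α => α * β ∈ formDeg n (p + q)) (by simp) ?_ ?_ hα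
  · intro x y hx hy
    rw [add_mul]; exact add_mem hx hy
  · intro f l hl
    refine formDeg_induction (P := fun β => f ⊗ₜ l * β ∈ formDeg n (p + q)) (by simp) ?_ ?_ hβ
    · intro x y hx hy
      rw [mul_add]; exact add_mem hx hy
    · intro g m hm
      rw [Algebra.TensorProduct.tmul_mul_tmul]
      refine tmul_mem_formDeg _ ?_
      rw [ExteriorAlgebra.exteriorPower, pow_add]
      exact Submodule.mul_mem_mul hl hm

theorem formDeg_mul_comm {p q : ℕ} {α β : Forms n} (hα : α ∈ formDeg n p) (hβ : β ∈ formDeg n q) :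
    α * β = parSign (p * q) • (β * α) := by
  refine formDeg_induction (P := fun α => α * β = parSign (p * q) • (β * α)) (by simp) ?_ ?_ hα
  · intro x y hx hy
    rw [add_mul, mul_add, smul_add, hx, hy]
  · intro f l hl
    refine formDeg_induction
      (P := fun β => f ⊗ₜ l * β = parSign (p * q) • (β * f ⊗ₜ l)) (by simp) ?_ ?_ hβ
    · intro x y hx hy
      rw [mul_add, add_mul, smul_add, hx, hy]
    · intro g m hm
      rw [Algebra.TensorProduct.tmul_mul_tmul, Algebra.TensorProduct.tmul_mul_tmul,
        ext_mul_comm hl hm, mul_comm f g, TensorProduct.tmul_smul]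

theorem one_mem_formDeg : (1 : Forms n) ∈ formDeg n 0 := by
  rw [Algebra.TensorProduct.one_def]
  refine tmul_mem_formDeg _ ?_
  rw [ExteriorAlgebra.exteriorPower, pow_zero]
  exact Submodule.mem_one.2 ⟨1, map_one _⟩

theorem extD_mem {p : ℕ} {α : Forms n} (hα : α ∈ formDeg n p) : extD n α ∈ formDeg n (p + 1) := by
  refine formDeg_induction (P := fun α => extD n α ∈ formDeg n (p + 1)) (by simp) ?_ ?_ hα
  · intro x y hx hy
    rw [map_add]; exact add_mem hx hy
  · intro f l hl
    rw [extD_tmul]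
    exact Submodule.sum_mem _ fun i _ => tmul_mem_formDeg _ (dxWedge_mem hl)

theorem contrField_mem (ξ : Fin n → SmoothFn n) {p : ℕ} {α : Forms n}
    (hα : α ∈ formDeg n (p + 1)) : contrField ξ α ∈ formDeg n p := by
  refine formDeg_induction (P := fun α => contrField ξ α ∈ formDeg n p) (by simp) ?_ ?_ hα
  · intro x y hx hy
    rw [map_add]; exact add_mem hx hy
  · intro f l hl
    rw [contrField_tmul]
    exact Submodule.sum_mem _ fun i _ => tmul_mem_formDeg _ (contr_mem hl)

theorem contrField_eq_zero (ξ : Fin n → SmoothFn n) {α : Forms n}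
    (hα : α ∈ formDeg n 0) : contrField ξ α = 0 := by
  refine formDeg_induction (P := fun α => contrField ξ α = 0) (by simp) ?_ ?_ hα
  · intro x y hx hy
    rw [map_add, hx, hy, add_zero]
  · intro f l hl
    rw [contrField_tmul]
    exact Finset.sum_eq_zero fun i _ => by rw [contr_eq_zero hl, TensorProduct.tmul_zero]

theorem lieDer_mem (ξ : Fin n → SmoothFn n) {p : ℕ} {α : Forms n}
    (hα : α ∈ formDeg n p) : lieDer ξ α ∈ formDeg n p := by
  rw [← cartan]
  refine add_mem (contrField_mem ξ (extD_mem hα)) ?_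
  cases p with
  | zero => rw [contrField_eq_zero ξ hα, map_zero]; exact zero_mem _
  | succ p => exact extD_mem (contrField_mem ξ hα)

/-! ### Linearity over the smooth functions -/

theorem smooth_smul_tmul (g f : SmoothFn n) (l : ExtAlg n) :
    g • (f ⊗ₜ[ℝ] l : Forms n) = (g * f) ⊗ₜ l := rfl

theorem smul_forms_mul (g : SmoothFn n) (α β : Forms n) : (g • α) * β = g • (α * β) :=
  smul_mul_assoc g α β

theorem forms_mul_smul (g : SmoothFn n) (α β : Forms n) : α * (g • β) = g • (α * β) :=
  mul_smul_comm g α β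

theorem formInv_smul (g : SmoothFn n) (α : Forms n) : formInv n (g • α) = g • formInv n α := by
  induction α using TensorProduct.induction_on with
  | zero => simp
  | add x y hx hy => rw [smul_add, map_add, hx, hy, map_add, smul_add]
  | tmul f l => rfl

theorem contrField_smul (ξ : Fin n → SmoothFn n) (g : SmoothFn n) (α : Forms n) :
    contrField ξ (g • α) = g • contrField ξ α := by
  induction α using TensorProduct.induction_on with
  | zero => simp
  | add x y hx hy => rw [smul_add, map_add, hx, hy, map_add, smul_add]
  | tmul f l =>
    simp only [smooth_smul_tmul, contrField_tmul, Finset.smul_sum]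
    exact Finset.sum_congr rfl fun i _ => by rw [mul_left_comm]

/-- The commutator of `d` with multiplication by `g` is multiplication by the form `dg`, which is
the symbol that makes `d` a first order operator. -/
theorem extD_smul (g : SmoothFn n) (α : Forms n) :
    extD n (g • α) = extD n (g ⊗ₜ 1) * α + g • extD n α := by
  have h : g • α = (g ⊗ₜ[ℝ] (1 : ExtAlg n)) * α := by
    rw [← mul_one g, ← smul_eq_mul, ← TensorProduct.smul_tmul', smul_forms_mul,
      ← Algebra.TensorProduct.one_def, one_mul, smul_eq_mul, mul_one]
  have h2 : g • extD n α = (g ⊗ₜ[ℝ] (1 : ExtAlg n)) * extD n α := by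
    rw [← mul_one g, ← smul_eq_mul, ← TensorProduct.smul_tmul', smul_forms_mul,
      ← Algebra.TensorProduct.one_def, one_mul, smul_eq_mul, mul_one]
  rw [h, extD_mul, h2, formInv_tmul, map_one]

theorem lieDer_smul (ξ : Fin n → SmoothFn n) (g : SmoothFn n) (α : Forms n) :
    lieDer ξ (g • α) = contrField ξ (extD n (g ⊗ₜ 1)) * α + g • lieDer ξ α := by
  have h0 : extD n (g ⊗ₜ[ℝ] (1 : ExtAlg n)) ∈ formDeg n 1 := by
    refine extD_mem (tmul_mem_formDeg _ ?_)
    rw [ExteriorAlgebra.exteriorPower, pow_zero]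
    exact Submodule.mem_one.2 ⟨1, map_one _⟩
  have h1 : formInv n (extD n (g ⊗ₜ[ℝ] (1 : ExtAlg n))) = - extD n (g ⊗ₜ[ℝ] (1 : ExtAlg n)) := by
    rw [formInv_of_mem h0]
    simp [parSign_one]
  rw [← cartan, ← cartan, extD_smul, contrField_smul, extD_smul, map_add, contrField_mul,
    contrField_smul, h1, neg_mul, smul_add]
  abel

end FormDegree

/-! ### The top degree coefficient -/

section Top

variable {n : ℕ}

/-- The coefficient of `dx₁ ∧ ⋯ ∧ dxₙ` in the exterior algebra. -/
def topExt (n : ℕ) : ExtAlg n →ₗ[ℝ] ℝ :=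
  ExteriorAlgebra.liftAlternating (R := ℝ) (Pi.single n (dxBasis n).det)

theorem topCoeff_tmul (f : SmoothFn n) (l : ExtAlg n) :
    topCoeff n (f ⊗ₜ l) = topExt n l • f := by
  simp [topCoeff, topExt]

theorem topCoeff_smul (g : SmoothFn n) (α : Forms n) : topCoeff n (g • α) = g * topCoeff n α := by
  induction α using TensorProduct.induction_on with
  | zero => simp
  | add x y hx hy => rw [smul_add, map_add, hx, hy, map_add, mul_add]
  | tmul f l => rw [smooth_smul_tmul, topCoeff_tmul, topCoeff_tmul, mul_smul_comm]

theorem topExt_of_mem {p : ℕ} (hp : p ≠ n) {l : ExtAlg n}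
    (hl : l ∈ ⋀[ℝ]^p (Module.Dual ℝ (Rn n))) : topExt n l = 0 := by
  rw [← ExteriorAlgebra.ιMulti_span_fixedDegree] at hl
  refine Submodule.span_induction ?_ (map_zero _) ?_ ?_ hl
  · rintro _ ⟨v, rfl⟩
    rw [topExt, ExteriorAlgebra.liftAlternating_apply_ιMulti, Pi.single_eq_of_ne hp]
    rfl
  · intro x y _ _ hx hy
    rw [map_add, hx, hy, add_zero]
  · intro c x _ hx
    rw [map_smul, hx, smul_zero]

theorem exteriorPower_eq_zero {p : ℕ} (hp : n < p) {l : ExtAlg n}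
    (hl : l ∈ ⋀[ℝ]^p (Module.Dual ℝ (Rn n))) : l = 0 := by
  rw [← ExteriorAlgebra.ιMulti_span_fixedDegree] at hl
  refine Submodule.span_induction ?_ rfl ?_ ?_ hl
  · rintro _ ⟨v, rfl⟩
    refine AlternatingMap.map_linearDependent _ v fun hv => ?_
    have := hv.fintype_card_le_finrank
    rw [Subspace.dual_finrank_eq, finrank_euclideanSpace] at this
    simp at this
    omega
  · rintro x y _ _ rfl rfl
    rw [add_zero]
  · rintro c x _ rfl
    rw [smul_zero]

theorem topCoeff_of_mem {p : ℕ} (hp : p ≠ n) {α : Forms n} (hα : α ∈ formDeg n p) :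
    topCoeff n α = 0 := by
  refine formDeg_induction (P := fun α => topCoeff n α = 0) (by simp) ?_ ?_ hα
  · intro x y hx hy
    rw [map_add, hx, hy, add_zero]
  · intro f l hl
    rw [topCoeff_tmul, topExt_of_mem hp hl, zero_smul]

/-- Contraction lowers the degree by one, so a form of degree `n` could only come from degree `n +
1`, where the exterior power is zero. -/
theorem topCoeff_contrField (ξ : Fin n → SmoothFn n) (α : Forms n) :
    topCoeff n (contrField ξ α) = 0 := by
  refine forms_induction (P := fun α => topCoeff n (contrField ξ α) = 0) ?_ ?_ α
  · intro x y hx hy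
    rw [map_add, map_add, hx, hy, add_zero]
  · intro p f l hl
    rw [contrField_tmul, map_sum]
    refine Finset.sum_eq_zero fun i _ => ?_
    rw [topCoeff_tmul]
    cases p with
    | zero => rw [contr_eq_zero hl, map_zero, zero_smul]
    | succ p =>
      by_cases hp : p = n
      · rw [exteriorPower_eq_zero (by omega) hl, map_zero, map_zero, zero_smul]
      · rw [topExt_of_mem hp (contr_mem hl), zero_smul]

theorem dxBasis_exterior_mem (S : Finset (Fin n)) :
    (dxBasis n).ExteriorAlgebra S ∈ ⋀[ℝ]^S.card (Module.Dual ℝ (Rn n)) := by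
  rw [ExteriorAlgebra.basis_apply_ofCard (dxBasis n) rfl]
  exact ExteriorAlgebra.ιMulti_range ℝ _ ⟨_, rfl⟩

theorem topExt_univ : topExt n ((dxBasis n).ExteriorAlgebra Finset.univ) = 1 := by
  rw [ExteriorAlgebra.basis_apply_ofCard (dxBasis n) (n := n) (by simp),
    ExteriorAlgebra.ιMulti_family, topExt, ExteriorAlgebra.liftAlternating_apply_ιMulti,
    Pi.single_eq_same]
  -- The only order embedding of `Fin n` into itself is the identity, so the basis element of the
  -- full set is `dx₁ ∧ ⋯ ∧ dxₙ` without sign.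
  have h : ∀ e : Fin n ↪o Fin n, ∀ i, e i = i := fun e i => by
    have := (Finset.univ : Finset (Fin n)).orderEmbOfFin_unique' (k := n) (h := by simp)
      (f := e) (by simp)
    have h2 := (Finset.univ : Finset (Fin n)).orderEmbOfFin_unique' (k := n) (h := by simp)
      (f := RelEmbedding.refl _) (by simp)
    rw [this, ← h2]
    rfl
  have h3 : (dxBasis n : Fin n → Module.Dual ℝ (Rn n)) ∘
      (Set.powersetCard.ofFinEmbEquiv.symm (Set.powersetCard.ofCard (s := (Finset.univ : Finset (Fin n))) (n := n) (by simp))) = dxBasis n :=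
    funext fun i => congrArg (dxBasis n) (h _ i)
  rw [h3, Module.Basis.det_self]

/-- Together with the next lemma: basis forms of complementary index sets are dual to each other up
to sign. If `S'` meets `Sᶜ` the product vanishes; otherwise `S'` is a proper subset of `S` and the
product has degree below `n`. -/
theorem topExt_basis_mul {S S' : Finset (Fin n)} (h : S' ≠ S) :
    topExt n ((dxBasis n).ExteriorAlgebra S' * (dxBasis n).ExteriorAlgebra Sᶜ) = 0 := by
  by_cases hd : Disjoint S' Sᶜ
  · have hsub : S' ⊂ S := Finset.ssubset_iff_subset_ne.2
      ⟨by simpa using Finset.subset_compl_iff_disjoint_right.2 hd, h⟩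
    have hc := Finset.card_lt_card hsub
    refine topExt_of_mem (p := S'.card + Sᶜ.card) ?_ ?_
    · have := Finset.card_add_card_compl S
      rw [Fintype.card_fin] at this
      omega
    · rw [ExteriorAlgebra.exteriorPower, pow_add]
      exact Submodule.mul_mem_mul (dxBasis_exterior_mem S') (dxBasis_exterior_mem Sᶜ)
  · have h0 := ExteriorAlgebra.basis_mul_of_not_disjoint (dxBasis n)
      (Set.powersetCard.ofCard (s := S') rfl) (Set.powersetCard.ofCard (s := Sᶜ) rfl) hd
    exact (congrArg (topExt n) h0).trans (map_zero _)

theorem topExt_basis_mul_self (S : Finset (Fin n)) :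
    topExt n ((dxBasis n).ExteriorAlgebra S * (dxBasis n).ExteriorAlgebra Sᶜ) ≠ 0 := by
  have hd : Disjoint S Sᶜ := disjoint_compl_right
  have h := ExteriorAlgebra.basis_mul_of_disjoint (dxBasis n)
      (Set.powersetCard.ofCard (s := S) rfl) (Set.powersetCard.ofCard (s := Sᶜ) rfl) hd
  have h2 : ((Set.powersetCard.disjUnion (s := Set.powersetCard.ofCard (s := S) rfl)
      (t := Set.powersetCard.ofCard (s := Sᶜ) rfl) hd :
      Set.powersetCard (Fin n) _) : Finset (Fin n)) = Finset.univ := by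
    exact (Finset.disjUnion_eq_union S Sᶜ hd).trans (Finset.union_compl S)
  rw [h2] at h
  have h' : (dxBasis n).ExteriorAlgebra S * (dxBasis n).ExteriorAlgebra Sᶜ = _ := h
  rw [h', Units.smul_def, map_zsmul, topExt_univ]
  simp

end Top

/-! ### Integration -/

section Integration

variable {n : ℕ}

/-- The compactly supported smooth functions. -/
def compactFn (n : ℕ) : Submodule ℝ (SmoothFn n) where
  carrier := {f | HasCompactSupport f.fn}
  add_mem' := fun {f g} (hf : HasCompactSupport f.fn) (hg : HasCompactSupport g.fn) => hf.add hg
  zero_mem' := (HasCompactSupport.zero : HasCompactSupport (0 : Rn n → ℝ))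
  smul_mem' := fun c f (hf : HasCompactSupport f.fn) =>
    (hf.smul_left (f := fun _ => c) : HasCompactSupport fun x => c • f.fn x)

theorem mem_compactFn {f : SmoothFn n} : f ∈ compactFn n ↔ HasCompactSupport f.fn := Iff.rfl

theorem mul_mem_compactFn (g : SmoothFn n) {f : SmoothFn n} (hf : f ∈ compactFn n) :
    g * f ∈ compactFn n :=
  (HasCompactSupport.mul_left hf : HasCompactSupport fun x => g.fn x * f.fn x)

theorem integrable_of_mem_compactFn {f : SmoothFn n} (hf : f ∈ compactFn n) :
    Integrable f.fn :=
  f.contDiff.continuous.integrable_of_hasCompactSupport hf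

theorem partialD_mem_compactFn (i : Fin n) {f : SmoothFn n} (hf : f ∈ compactFn n) :
    partialD i f ∈ compactFn n :=
  HasCompactSupport.fderiv_apply ℝ hf (stdVec i)

theorem integral_partialD (i : Fin n) {f : SmoothFn n} (hf : f ∈ compactFn n) :
    ∫ x, (partialD i f).fn x = 0 := by
  -- Integration by parts against the constant function 1.
  have h := integral_bilinear_hasFDerivAt_right_eq_neg_left_of_integrable
    (μ := (volume : Measure (Rn n))) (f := fun _ => (1 : ℝ)) (f' := fun _ => 0) (g := f.fn)
    (g' := fderiv ℝ f.fn) (v := stdVec i) (B := ContinuousLinearMap.mul ℝ ℝ)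
    (by simp) (by simp only [ContinuousLinearMap.mul_apply', one_mul]; exact integrable_of_mem_compactFn (partialD_mem_compactFn i hf))
    (by simpa using integrable_of_mem_compactFn hf)
    (fun x _ => hasFDerivAt_const 1 x) (fun x _ => (f.differentiableAt x).hasFDerivAt)
  simp only [ContinuousLinearMap.mul_apply', one_mul, _root_.zero_apply, zero_mul,
    integral_zero, neg_zero] at h
  exact h

/-- Integration of compactly supported functions. -/
def integralFn (n : ℕ) : compactFn n →ₗ[ℝ] ℝ where
  toFun f := ∫ x, f.1.fn x
  map_add' f g := integral_add (integrable_of_mem_compactFn f.2) (integrable_of_mem_compactFn g.2)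
  map_smul' c f := integral_const_mul c f.1.fn

/-- The compactly supported forms. -/
def compactForms (n : ℕ) : Submodule ℝ (Forms n) :=
  Submodule.span ℝ {α | ∃ (f : SmoothFn n) (l : ExtAlg n), HasCompactSupport f.fn ∧ α = f ⊗ₜ[ℝ] l}

theorem compactForms_induction {P : Forms n → Prop} (h0 : P 0)
    (hadd : ∀ α β, α ∈ compactForms n → β ∈ compactForms n → P α → P β → P (α + β))
    (ht : ∀ (f : SmoothFn n) (l : ExtAlg n), f ∈ compactFn n → P (f ⊗ₜ l))
    {α : Forms n} (hα : α ∈ compactForms n) : P α := by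
  have key : α ∈ compactForms n ∧ P α := by
    refine Submodule.closure_induction (p := fun x _ => x ∈ compactForms n ∧ P x) ?_ ?_ ?_ hα
    · exact ⟨zero_mem _, h0⟩
    · rintro x y _ _ ⟨hx, hx'⟩ ⟨hy, hy'⟩
      exact ⟨add_mem hx hy, hadd _ _ hx hy hx' hy'⟩
    · rintro c x ⟨f, l, hl, rfl⟩
      rw [TensorProduct.smul_tmul']
      have := (compactFn n).smul_mem c (mem_compactFn.2 hl)
      exact ⟨Submodule.subset_span ⟨_, l, this, rfl⟩, ht _ l this⟩
  exact key.2

theorem tmul_mem_compactForms {f : SmoothFn n} (hf : f ∈ compactFn n) (l : ExtAlg n) :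
    f ⊗ₜ[ℝ] l ∈ compactForms n :=
  Submodule.subset_span ⟨f, l, hf, rfl⟩

theorem smul_mem_compactForms {f : SmoothFn n} (hf : f ∈ compactFn n) (α : Forms n) :
    f • α ∈ compactForms n := by
  induction α using TensorProduct.induction_on with
  | zero => simp
  | add x y hx hy => rw [smul_add]; exact add_mem hx hy
  | tmul g l =>
    rw [smooth_smul_tmul, mul_comm]
    exact tmul_mem_compactForms (mul_mem_compactFn g hf) l

theorem topCoeff_mem_compactFn {α : Forms n} (hα : α ∈ compactForms n) :
    topCoeff n α ∈ compactFn n := by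
  refine compactForms_induction (P := fun α => topCoeff n α ∈ compactFn n) (by simp) ?_ ?_ hα
  · intro x y _ _ hx hy
    rw [map_add]; exact add_mem hx hy
  · intro f l hf
    rw [topCoeff_tmul]; exact (compactFn n).smul_mem _ hf

/-- Integration of compactly supported forms. -/
def integralForms (n : ℕ) : compactForms n →ₗ[ℝ] ℝ :=
  (integralFn n).comp (((topCoeff n).domRestrict _).codRestrict (compactFn n)
    fun α => topCoeff_mem_compactFn α.2)

theorem integral_eq {α : Forms n} (hα : α ∈ compactForms n) :
    integral α = integralForms n ⟨α, hα⟩ := rfl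

theorem integral_add' {α β : Forms n} (hα : α ∈ compactForms n) (hβ : β ∈ compactForms n) :
    integral (α + β) = integral α + integral β :=
  (integralForms n).map_add ⟨α, hα⟩ ⟨β, hβ⟩

/-- Valid without compact support, since scalars leave the Bochner integral even when the integrand
is not integrable. -/
theorem integral_smul' (c : ℝ) (α : Forms n) : integral (c • α) = c * integral α := by
  rw [integral, map_smul]
  exact integral_const_mul c _

theorem integral_zero' : integral (0 : Forms n) = 0 := by
  simpa using integral_smul' (n := n) 0 0

theorem extD_mem_compactForms {α : Forms n} (hα : α ∈ compactForms n) :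
    extD n α ∈ compactForms n := by
  refine compactForms_induction (P := fun α => extD n α ∈ compactForms n) (by simp) ?_ ?_ hα
  · intro x y _ _ hx hy
    rw [map_add]; exact add_mem hx hy
  · intro f l hf
    rw [extD_tmul]
    exact Submodule.sum_mem _ fun i _ => tmul_mem_compactForms (partialD_mem_compactFn i hf) _

theorem contrField_mem_compactForms (ξ : Fin n → SmoothFn n) {α : Forms n}
    (hα : α ∈ compactForms n) : contrField ξ α ∈ compactForms n := by
  refine compactForms_induction (P := fun α => contrField ξ α ∈ compactForms n) (by simp) ?_ ?_ hα
  · intro x y _ _ hx hy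
    rw [map_add]; exact add_mem hx hy
  · intro f l hf
    rw [contrField_tmul]
    exact Submodule.sum_mem _ fun i _ => tmul_mem_compactForms (mul_mem_compactFn _ hf) _

theorem lieDer_mem_compactForms (ξ : Fin n → SmoothFn n) {α : Forms n}
    (hα : α ∈ compactForms n) : lieDer ξ α ∈ compactForms n := by
  rw [← cartan]
  exact add_mem (contrField_mem_compactForms ξ (extD_mem_compactForms hα))
    (extD_mem_compactForms (contrField_mem_compactForms ξ hα))

/-- Stokes' theorem: each summand of `dα` has as top coefficient a constant multiple of a partial
derivative of a compactly supported function. -/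
theorem integral_extD {α : Forms n} (hα : α ∈ compactForms n) : integral (extD n α) = 0 := by
  refine compactForms_induction (P := fun α => integral (extD n α) = 0) ?_ ?_ ?_ hα
  · rw [map_zero, integral_zero']
  · intro x y hx hy h1 h2
    rw [map_add, integral_add' (extD_mem_compactForms hx) (extD_mem_compactForms hy), h1, h2,
      add_zero]
  · intro f l hf
    have h : ∀ i, partialD i f ⊗ₜ[ℝ] dxWedge i l ∈ compactForms n := fun i =>
      tmul_mem_compactForms (partialD_mem_compactFn i hf) _
    have h2 : (∑ i, partialD i f ⊗ₜ[ℝ] dxWedge i l) =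
        ((∑ i, ⟨_, h i⟩ : compactForms n) : Forms n) := by simp
    rw [extD_tmul, h2, integral_eq (Subtype.property _), Subtype.coe_eta, map_sum]
    refine Finset.sum_eq_zero fun i _ => ?_
    rw [← integral_eq, integral, topCoeff_tmul]
    refine (integral_const_mul _ _).trans ?_
    exact (congrArg (fun z => topExt n (dxWedge i l) * z) (integral_partialD i hf)).trans
      (mul_zero _)

theorem integral_contrField (ξ : Fin n → SmoothFn n) (α : Forms n) :
    integral (contrField ξ α) = 0 := by
  rw [integral, topCoeff_contrField]
  exact integral_zero _ _

theorem integral_lieDer (ξ : Fin n → SmoothFn n) {α : Forms n} (hα : α ∈ compactForms n) :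
    integral (lieDer ξ α) = 0 := by
  rw [← cartan, integral_add' (contrField_mem_compactForms ξ (extD_mem_compactForms hα))
    (extD_mem_compactForms (contrField_mem_compactForms ξ hα)), integral_contrField,
    integral_extD (contrField_mem_compactForms ξ hα), add_zero]

/-- The fundamental lemma of the calculus of variations; continuity upgrades almost everywhere to
everywhere. -/
theorem eq_zero_of_integral_mul {h : SmoothFn n}
    (hh : ∀ g ∈ compactFn n, ∫ x, (g * h).fn x = 0) : h = 0 := by
  have hae := ae_eq_zero_of_integral_contDiff_smul_eq_zero (μ := (volume : Measure (Rn n)))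
    (h.contDiff.continuous.locallyIntegrable)
    (fun g hg hgs => hh (SmoothFn.of g hg) hgs)
  have := (Continuous.ae_eq_iff_eq volume h.contDiff.continuous
    (continuous_const (y := (0 : ℝ)))).1 hae
  exact SmoothFn.ext fun x => congrFun this x

end Integration

/-! ### Multilinear maps on spans -/

section Span

variable {V N : Type*} [AddCommGroup V] [Module ℝ V] [AddCommGroup N] [Module ℝ N]

theorem multilinear_eq_zero_of_span {k : ℕ} (φ : MultilinearMap ℝ (fun _ : Fin k => V) N)
    (s : Fin k → Set V) (h : ∀ v, (∀ i, v i ∈ s i) → φ v = 0) (v : Fin k → V)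
    (hv : ∀ i, v i ∈ Submodule.span ℝ (s i)) : φ v = 0 := by
  -- The entries are relaxed from generators to span elements one position at a time; `S` is the set
  -- of positions already relaxed.
  have key : ∀ (S : Finset (Fin k)) (v : Fin k → V), (∀ i ∈ S, v i ∈ Submodule.span ℝ (s i)) →
      (∀ i ∉ S, v i ∈ s i) → φ v = 0 := by
    intro S
    induction S using Finset.induction_on with
    | empty => exact fun v _ h2 => h v fun i => h2 i (Finset.notMem_empty i)
    | insert a S ha ih =>
      intro v h1 h2
      rw [← Function.update_eq_self a v]
      refine Submodule.span_induction (p := fun x _ => φ (Function.update v a x) = 0)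
        ?_ ?_ ?_ ?_ (h1 a (Finset.mem_insert_self a S))
      · intro x hx
        refine ih _ (fun i hi => ?_) (fun i hi => ?_)
        · rw [Function.update_of_ne (ne_of_mem_of_not_mem hi ha)]
          exact h1 i (Finset.mem_insert_of_mem hi)
        · by_cases hia : i = a
          · subst hia; rwa [Function.update_self]
          · rw [Function.update_of_ne hia]
            exact h2 i fun h => (Finset.mem_insert.1 h).elim hia hi
      · exact φ.map_coord_zero a (Function.update_self ..)
      · intro x y _ _ hx hy
        rw [φ.map_update_add, hx, hy, add_zero]
      · intro c x _ hx
        rw [φ.map_update_smul, hx, smul_zero]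
  exact key Finset.univ v (fun i _ => hv i) fun i hi => absurd (Finset.mem_univ i) hi

end Span

/-! ### Parity operators on homogeneous elements. -/

section Parity

variable {L : Type*} [AddCommGroup L] [Module ℝ L]
  {𝓛 : ℤ → Submodule ℝ L} [DirectSum.Decomposition 𝓛]

theorem parityProj_of_mem (p : ZMod 2) {i : ℤ} {x : L} (hx : x ∈ 𝓛 i) :
    parityProj 𝓛 p x = if (i : ZMod 2) = p then x else 0 := by
  rw [parityProj, LinearMap.comp_apply, LinearEquiv.coe_coe, DirectSum.decomposeLinearEquiv_apply,
    DirectSum.decompose_of_mem 𝓛 hx, ← DirectSum.lof_eq_of ℝ, DirectSum.toModule_lof]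
  split_ifs <;> simp

theorem parityInv_of_mem {i : ℤ} {x : L} (hx : x ∈ 𝓛 i) :
    parityInv 𝓛 x = parSign i • x := by
  rw [parityInv, LinearMap.sub_apply, parityProj_of_mem _ hx, parityProj_of_mem _ hx]
  have h : ∀ z : ZMod 2, z = 0 ∨ z = 1 := by decide
  rcases h (i : ZMod 2) with h | h <;> rw [h] <;> simp [parSign_zero, parSign_one]

end Parity

/-! ### Products of homogeneous forms -/

section ListProd

variable {n : ℕ}

theorem ofFn_prod_mem {k : ℕ} (p : Fin k → ℕ) (α : Fin k → Forms n)
    (hα : ∀ i, α i ∈ formDeg n (p i)) : (List.ofFn α).prod ∈ formDeg n (∑ i, p i) := by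
  induction k with
  | zero => simpa using one_mem_formDeg
  | succ k ih =>
    rw [List.ofFn_succ, List.prod_cons, Fin.sum_univ_succ]
    exact formDeg_mul (hα 0) (ih _ _ fun i => hα i.succ)

theorem koszulExp_swap {k : ℕ} (i : Fin k) (d : Fin (k + 1) → ZMod 2) :
    koszulExp (Equiv.swap i.castSucc i.succ) d = d i.castSucc * d i.succ := by
  rw [koszulExp, Finset.sum_eq_single i.castSucc, Finset.sum_eq_single i.succ]
  · rw [Equiv.swap_apply_left, Equiv.swap_apply_right,
      if_pos ⟨Fin.castSucc_lt_succ, Fin.castSucc_lt_succ⟩, mul_comm]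
  · intro j _ hj
    refine if_neg fun h => ?_
    rw [Equiv.swap_apply_left] at h
    have h1 := h.1
    rw [Equiv.swap_apply_of_ne_of_ne h.1.ne' hj] at h
    have h2 := h.2
    rw [Fin.lt_def] at h1 h2
    simp at h1 h2
    omega
  · simp
  · intro a _ ha
    refine Finset.sum_eq_zero fun b _ => if_neg fun h => ?_
    have h1 := h.1
    by_cases ha' : a = i.succ
    · subst ha'
      have hb1 : b ≠ i.castSucc := fun hb => by
        subst hb; exact absurd h1 (Fin.castSucc_lt_succ).not_gt
      rw [Equiv.swap_apply_right, Equiv.swap_apply_of_ne_of_ne hb1 h1.ne'] at h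
      have h2 := h.2
      rw [Fin.lt_def] at h1 h2
      simp at h1 h2
      omega
    · rw [Equiv.swap_apply_of_ne_of_ne ha ha'] at h
      by_cases hb : b = i.castSucc
      · subst hb
        rw [Equiv.swap_apply_left] at h
        have h2 := h.2
        rw [Fin.lt_def] at h1 h2
        simp at h1 h2
        omega
      · by_cases hb' : b = i.succ
        · subst hb'
          rw [Equiv.swap_apply_right] at h
          have h2 := h.2
          have h3 : a.val ≠ i.val := fun h => ha (Fin.ext h)
          rw [Fin.lt_def] at h1 h2
          simp at h1 h2
          omega
        · rw [Equiv.swap_apply_of_ne_of_ne hb hb'] at h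
          exact absurd h1 h.2.not_gt
  · simp

theorem ofFn_prod_swap {k : ℕ} (p : Fin (k + 1) → ℕ) (α : Fin (k + 1) → Forms n)
    (hα : ∀ i, α i ∈ formDeg n (p i)) (i : Fin k) :
    (List.ofFn α).prod = parSign ((p i.castSucc : ZMod 2) * p i.succ) •
      (List.ofFn fun a => α (Equiv.swap i.castSucc i.succ a)).prod := by
  induction k with
  | zero => exact i.elim0
  | succ k ih =>
    refine Fin.cases ?_ (fun i => ?_) i
    · have h : ∀ a : Fin k, Equiv.swap (Fin.castSucc (0 : Fin (k + 1))) (Fin.succ 0) a.succ.succ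
          = a.succ.succ := fun a => Equiv.swap_apply_of_ne_of_ne
            (by simp [Fin.ext_iff]) (by simp [Fin.ext_iff])
      simp only [List.ofFn_succ, List.prod_cons, h]
      have e0 : Equiv.swap (Fin.castSucc (0 : Fin (k + 1))) (Fin.succ 0) 0 = Fin.succ 0 :=
        Equiv.swap_apply_left _ _
      have e1 : Equiv.swap (Fin.castSucc (0 : Fin (k + 1))) (Fin.succ 0) (Fin.succ 0) = 0 :=
        Equiv.swap_apply_right _ _
      rw [e0, e1, ← mul_assoc, formDeg_mul_comm (hα 0) (hα (Fin.succ 0)), smul_mul_assoc, mul_assoc]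
      rfl
    · have hs := ih (fun a => p a.succ) (fun a => α a.succ) (fun a => hα a.succ) i
      rw [List.ofFn_succ, List.prod_cons, hs, List.ofFn_succ (f := fun a =>
        α (Equiv.swap (Fin.castSucc i.succ) (Fin.succ i.succ) a)), List.prod_cons, mul_smul_comm]
      have e0 : Equiv.swap (Fin.castSucc i.succ) (Fin.succ i.succ) 0 = 0 :=
        Equiv.swap_apply_of_ne_of_ne (by simp [Fin.ext_iff]) (by simp [Fin.ext_iff])
      have e1 : ∀ a : Fin (k + 1), Equiv.swap (Fin.castSucc i.succ) (Fin.succ i.succ) a.succ =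
          (Equiv.swap i.castSucc i.succ a).succ := fun a => by
        rw [← Fin.succ_castSucc]
        by_cases h1 : a = i.castSucc
        · subst h1; rw [Equiv.swap_apply_left, Equiv.swap_apply_left]
        · by_cases h2 : a = i.succ
          · subst h2; rw [Equiv.swap_apply_right, Equiv.swap_apply_right]
          · rw [Equiv.swap_apply_of_ne_of_ne h1 h2, Equiv.swap_apply_of_ne_of_ne]
            · simpa using h1
            · simpa using h2
      rw [e0]
      simp only [e1]
      rfl

/-- Adjacent transpositions generate the symmetric group, graded commutativity settles one
transposition, and both sides are compatible with composition by `koszulExp_mul`. -/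
theorem ofFn_prod_perm {k : ℕ} (p : Fin k → ℕ) (α : Fin k → Forms n)
    (hα : ∀ i, α i ∈ formDeg n (p i)) (σ : Equiv.Perm (Fin k)) :
    (List.ofFn α).prod = parSign (koszulExp σ fun i => (p i : ZMod 2)) •
      (List.ofFn fun a => α (σ a)).prod := by
  cases k with
  | zero => simp [koszulExp, parSign_zero]
  | succ k =>
    have hσ : σ ∈ Submonoid.closure
        (Set.range fun i : Fin k => Equiv.swap i.castSucc i.succ) := by
      rw [Equiv.Perm.mclosure_swap_castSucc_succ]; trivial
    induction hσ using Submonoid.closure_induction generalizing p α with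
    | mem σ hσ =>
      obtain ⟨i, rfl⟩ := hσ
      simp only
      rw [koszulExp_swap]
      exact ofFn_prod_swap p α hα i
    | one =>
      have : koszulExp (1 : Equiv.Perm (Fin (k + 1))) (fun i => (p i : ZMod 2)) = 0 :=
        Finset.sum_eq_zero fun i _ => Finset.sum_eq_zero fun j _ => if_neg fun h =>
          absurd h.1 h.2.not_gt
      rw [this, parSign_zero, one_smul]
      rfl
    | mul σ τ _ _ h1 h2 =>
      rw [koszulExp_mul, parSign_add, mul_smul, h1 p α hα,
        h2 (fun i => p (σ i)) (fun i => α (σ i)) (fun i => hα (σ i))]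
      rfl

theorem ofFn_prod_unshuffle {k : ℕ} (p : Fin k → ℕ) (α : Fin k → Forms n)
    (hα : ∀ i, α i ∈ formDeg n (p i)) (T : Finset (Fin k)) :
    (List.ofFn (sub α T)).prod * (List.ofFn (sub α Tᶜ)).prod =
      parSign (unshuffleExp T fun i => (p i : ZMod 2)) • (List.ofFn α).prod := by
  rw [ofFn_prod_perm p α hα (unshufflePerm T), ofFn_unshufflePerm, List.prod_append,
    koszulExp_unshufflePerm, smul_smul, parSign_mul_self, one_smul]

end ListProd

/-! ### Homogeneous fields -/

section Fields

variable {n : ℕ} {L N : Type*} [AddCommGroup L] [Module ℝ L] [AddCommGroup N] [Module ℝ N]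
  {𝓛 : ℤ → Submodule ℝ L}

theorem tmul_mem_fieldDeg {p : ℕ} {j d : ℤ} {α : Forms n} {x : L} (hα : α ∈ formDeg n p)
    (hx : x ∈ shift 𝓛 j) (hd : (p : ℤ) + j = d) : α ⊗ₜ[ℝ] x ∈ fieldDeg n 𝓛 d :=
  Submodule.subset_span ⟨p, j, α, x, hα, hx, hd, rfl⟩

/-- Multilinear maps which agree on homogeneous pure tensors agree on homogeneous fields. -/
theorem multilinear_ext_homog {k : ℕ} {φ ψ : MultilinearMap ℝ (fun _ : Fin k => Fields n L) N}
    {d : Fin k → ℤ}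
    (h : ∀ (p : Fin k → ℕ) (j : Fin k → ℤ) (α : Fin k → Forms n) (x : Fin k → L),
      (∀ i, α i ∈ formDeg n (p i)) → IsHomog (shift 𝓛) j x → (∀ i, (p i : ℤ) + j i = d i) →
      φ (fun i => α i ⊗ₜ x i) = ψ (fun i => α i ⊗ₜ x i))
    {v : Fin k → Fields n L} (hv : IsHomog (fieldDeg n 𝓛) d v) : φ v = ψ v := by
  have := multilinear_eq_zero_of_span (φ - ψ) (fun i => {A | ∃ (p : ℕ) (j : ℤ) (α : Forms n) (x : L),
    α ∈ formDeg n p ∧ x ∈ shift 𝓛 j ∧ (p : ℤ) + j = d i ∧ A = α ⊗ₜ[ℝ] x}) (fun v hv => ?_) v hv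
  · rwa [_root_.sub_apply, sub_eq_zero] at this
  · choose p j α x hα hx hd hv using hv
    rw [_root_.sub_apply, sub_eq_zero]
    have e : v = fun i => α i ⊗ₜ x i := funext hv
    rw [e]
    exact h p j α x hα hx hd

variable [DirectSum.Decomposition 𝓛]

theorem fields_induction {P : Fields n L → Prop}
    (hadd : ∀ A B, P A → P B → P (A + B))
    (ht : ∀ (p : ℕ) (j : ℤ) (α : Forms n) (x : L), α ∈ formDeg n p → x ∈ shift 𝓛 j →
      P (α ⊗ₜ x)) (A : Fields n L) : P A := by
  have h0 : P 0 := by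
    have := ht 0 0 0 0 (zero_mem _) (zero_mem _)
    rwa [TensorProduct.zero_tmul] at this
  induction A using TensorProduct.induction_on with
  | zero => exact h0
  | add x y hx hy => exact hadd _ _ hx hy
  | tmul α x =>
    refine forms_induction (P := fun α => P (α ⊗ₜ x)) ?_ ?_ α
    · intro α β h1 h2
      rw [TensorProduct.add_tmul]; exact hadd _ _ h1 h2
    · intro p f l hl
      induction x using DirectSum.Decomposition.inductionOn 𝓛 with
      | zero => rwa [TensorProduct.tmul_zero]
      | @homogeneous i m =>
        refine ht p (i - 1) _ m (tmul_mem_formDeg f hl) ?_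
        rw [shift, sub_add_cancel]; exact m.2
      | add x y hx hy => rw [TensorProduct.tmul_add]; exact hadd _ _ hx hy

/-- Of the sum over parities only the summand of the actual parities of the `xᵢ` survives, as a
projection kills each other one. The powers of `formInv` then give the sign for moving each form
past the preceding `xᵢ`. -/
theorem wedgeExtend_tmul {k : ℕ} (f : MultilinearMap ℝ (fun _ : Fin k => L) N) (p : Fin k → ℕ)
    (j : Fin k → ℤ) (α : Fin k → Forms n) (x : Fin k → L) (hα : ∀ i, α i ∈ formDeg n (p i))
    (hx : IsHomog (shift 𝓛) j x) :
    wedgeExtend 𝓛 f (fun i => α i ⊗ₜ x i) =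
      parSign (pairSum fun i l => (j i : ZMod 2) * p l) • ((List.ofFn α).prod ⊗ₜ[ℝ] f x) := by
  have hproj : ∀ (P : ZMod 2) (i : Fin k),
      parityProj 𝓛 (P + 1) (x i) = if (j i : ZMod 2) = P then x i else 0 := fun P i => by
    rw [parityProj_of_mem (𝓛 := 𝓛) (P + 1) (i := j i + 1) (hx i)]
    push_cast
    simp
  rw [wedgeExtend, _root_.sum_apply, Finset.sum_eq_single (fun i => (j i : ZMod 2))]
  · rw [tensorMultilinear_tmul]
    simp only [MultilinearMap.compLinearMap_apply, hproj, if_true]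
    rw [TensorProduct.smul_tmul']
    congr 1
    simp only [fun l => formInv_pow_of_mem (hα l)]
    rw [MultilinearMap.map_smul_univ, MultilinearMap.mkPiAlgebraFin_apply, ← parSign_sum]
    congr 2
    rw [pairSum, Finset.sum_comm]
    refine Finset.sum_congr rfl fun l _ => ?_
    push_cast
    rw [Finset.sum_mul, Finset.sum_filter]
    refine Finset.sum_congr rfl fun i _ => ?_
    split_ifs
    · rw [ZMod.natCast_zmod_val]
    · rfl
  · intro P _ hP
    obtain ⟨i, hi⟩ := Function.ne_iff.1 hP
    rw [tensorMultilinear_tmul]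
    simp only [MultilinearMap.compLinearMap_apply, hproj]
    rw [f.map_coord_zero i (if_neg (Ne.symm hi)), TensorProduct.tmul_zero]
  · simp

/-- The forms contribute their own Koszul sign, `f` contributes that of `L[1]`, and `koszulExp_add`
combines the two with the reordering signs into the Koszul sign of the total degrees. -/
theorem wedgeExtend_symm {k : ℕ} {f : MultilinearMap ℝ (fun _ : Fin k => L) N}
    (hf : IsGradedSymm (shift 𝓛) f) :
    IsGradedSymm (fieldDeg n 𝓛) (wedgeExtend (n := n) 𝓛 f) := by
  intro d v hv σ
  have key := multilinear_ext_homog (φ := wedgeExtend (n := n) 𝓛 f)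
    (ψ := koszulSign σ d • (wedgeExtend (n := n) 𝓛 f).domDomCongr σ) ?_ hv
  · exact key
  · intro p j α x hα hx hd
    rw [_root_.smul_apply, MultilinearMap.domDomCongr_apply,
      wedgeExtend_tmul f p j α x hα hx,
      wedgeExtend_tmul f (fun i => p (σ i)) (fun i => j (σ i)) (fun i => α (σ i)) (fun i => x (σ i))
        (fun i => hα (σ i)) (fun i => hx (σ i)), ofFn_prod_perm p α hα σ, hf j x hx σ,
      koszulSign_eq, koszulSign_eq, TensorProduct.tmul_smul, ← TensorProduct.smul_tmul', smul_smul,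
      smul_smul, smul_smul]
    simp only [← parSign_add]
    congr 2
    have hd' : (fun i => ((d i : ℤ) : ZMod 2)) = fun i => (p i : ZMod 2) + (j i : ZMod 2) :=
      funext fun i => by rw [← hd i]; push_cast; rfl
    rw [hd', koszulExp_add σ (fun i => (j i : ZMod 2)) (fun i => (p i : ZMod 2))]
    ring_nf
    simp only [CharTwo.two_eq_zero, mul_zero, add_zero]

theorem wedgeExtend_mem {k : ℕ} {f : MultilinearMap ℝ (fun _ : Fin k => L) L} {m : ℤ}
    (hf : ∀ (d : Fin k → ℤ) (x : Fin k → L), IsHomog (shift 𝓛) d x →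
      f x ∈ shift 𝓛 (∑ i, d i + m)) {d : Fin k → ℤ} {v : Fin k → Fields n L}
    (hv : IsHomog (fieldDeg n 𝓛) d v) :
    wedgeExtend 𝓛 f v ∈ fieldDeg n 𝓛 (∑ i, d i + m) := by
  have key := multilinear_ext_homog (φ := (fieldDeg n 𝓛 (∑ i, d i + m)).mkQ.compMultilinearMap
    (wedgeExtend (n := n) 𝓛 f)) (ψ := 0) ?_ hv
  · simpa using key
  · intro p j α x hα hx hd
    rw [LinearMap.compMultilinearMap_apply, wedgeExtend_tmul f p j α x hα hx]
    simp only [_root_.zero_apply, Submodule.mkQ_apply, Submodule.Quotient.mk_eq_zero]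
    refine Submodule.smul_mem _ _ (tmul_mem_fieldDeg (ofFn_prod_mem p α hα) (hf j x hx) ?_)
    simp only [← hd, Finset.sum_add_distrib]
    push_cast
    ring

end Fields

section Pairing

variable {n : ℕ} {L : Type*} [AddCommGroup L] [Module ℝ L]
  {𝓛 : ℤ → Submodule ℝ L}

/-! ### Compactly supported fields -/

theorem tmul_mem_compactFields {α : Forms n} (hα : α ∈ compactForms n) (x : L) :
    α ⊗ₜ[ℝ] x ∈ compactFields n L := by
  refine compactForms_induction (P := fun α => α ⊗ₜ[ℝ] x ∈ compactFields n L) (by simp) ?_ ?_ hα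
  · intro α β _ _ h1 h2
    rw [TensorProduct.add_tmul]; exact add_mem h1 h2
  · intro f l hf
    exact Submodule.subset_span ⟨f, l, x, hf, rfl⟩

theorem compactFields_induction {P : Fields n L → Prop} (h0 : P 0)
    (hadd : ∀ A B, A ∈ compactFields n L → B ∈ compactFields n L → P A → P B → P (A + B))
    (ht : ∀ (α : Forms n) (x : L), α ∈ compactForms n → P (α ⊗ₜ x))
    {A : Fields n L} (hA : A ∈ compactFields n L) : P A := by
  have key : A ∈ compactFields n L ∧ P A := by
    refine Submodule.closure_induction (p := fun x _ => x ∈ compactFields n L ∧ P x) ?_ ?_ ?_ hA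
    · exact ⟨zero_mem _, h0⟩
    · rintro x y _ _ ⟨hx, hx'⟩ ⟨hy, hy'⟩
      exact ⟨add_mem hx hy, hadd _ _ hx hy hx' hy'⟩
    · rintro c _ ⟨f, l, x, hf, rfl⟩
      have : c • f ⊗ₜ[ℝ] l ∈ compactForms n :=
        Submodule.smul_mem _ _ (tmul_mem_compactForms (mem_compactFn.2 hf) l)
      rw [TensorProduct.smul_tmul']
      exact ⟨tmul_mem_compactFields this x, ht _ x this⟩
  exact key.2

theorem onFields_tmul (T : Forms n →ₗ[ℝ] Forms n) (α : Forms n) (x : L) :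
    onFields T (α ⊗ₜ x) = T α ⊗ₜ[ℝ] x := rfl

theorem onFields_mem_compactFields {T : Forms n →ₗ[ℝ] Forms n}
    (hT : ∀ α ∈ compactForms n, T α ∈ compactForms n) {A : Fields n L}
    (hA : A ∈ compactFields n L) : onFields T A ∈ compactFields n L := by
  refine compactFields_induction (P := fun A => onFields T A ∈ compactFields n L) (by simp) ?_ ?_ hA
  · intro A B _ _ h1 h2
    rw [map_add]; exact add_mem h1 h2
  · intro α x hα
    exact tmul_mem_compactFields (hT α hα) x

theorem fields_smul_tmul {N : Type*} [AddCommGroup N] [Module ℝ N]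
    (g : SmoothFn n) (α : Forms n) (x : N) :
    g • (α ⊗ₜ[ℝ] x : Forms n ⊗[ℝ] N) = (g • α) ⊗ₜ x := rfl

theorem smul_mem_compactFields {g : SmoothFn n} (hg : g ∈ compactFn n) (A : Fields n L) :
    g • A ∈ compactFields n L := by
  induction A using TensorProduct.induction_on with
  | zero => simp
  | add x y hx hy => rw [smul_add]; exact add_mem hx hy
  | tmul α x => exact tmul_mem_compactFields (smul_mem_compactForms hg α) x

theorem onFields_smul {T : Forms n →ₗ[ℝ] Forms n}
    (hT : ∀ (g : SmoothFn n) (α : Forms n), T (g • α) = g • T α) (g : SmoothFn n)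
    (A : Fields n L) : onFields T (g • A) = g • onFields T A := by
  induction A using TensorProduct.induction_on with
  | zero => simp
  | add x y hx hy => rw [smul_add, map_add, hx, hy, map_add, smul_add]
  | tmul α x => rw [fields_smul_tmul, onFields_tmul, onFields_tmul, hT, fields_smul_tmul]

theorem onFields_mem_fieldDeg {T : Forms n →ₗ[ℝ] Forms n} {t : ℤ}
    (hT : ∀ (p : ℕ) (α : Forms n), α ∈ formDeg n p → T α = 0 ∨
      ∃ q : ℕ, (q : ℤ) = p + t ∧ T α ∈ formDeg n q) {a : ℤ} {A : Fields n L}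
    (hA : A ∈ fieldDeg n 𝓛 a) : onFields T A ∈ fieldDeg n 𝓛 (a + t) := by
  refine Submodule.span_induction ?_ (by simp) ?_ ?_ hA
  · rintro _ ⟨p, j, α, x, hα, hx, hd, rfl⟩
    rw [onFields_tmul]
    rcases hT p α hα with h | ⟨q, hq, h⟩
    · rw [h, TensorProduct.zero_tmul]; exact zero_mem _
    · exact tmul_mem_fieldDeg h hx (by rw [hq, ← hd]; ring)
  · intro x y _ _ hx hy
    rw [map_add]; exact add_mem hx hy
  · intro c x _ hx
    rw [map_smul]; exact Submodule.smul_mem _ _ hx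

variable [DirectSum.Decomposition 𝓛]

/-- The parity involution of `Ω^•(ℝⁿ) ⊗ L`. -/
def fieldInv (n : ℕ) (𝓛 : ℤ → Submodule ℝ L) [DirectSum.Decomposition 𝓛] :
    Fields n L →ₗ[ℝ] Fields n L :=
  TensorProduct.map (formInv n) (parityInv 𝓛)

theorem fieldInv_tmul (α : Forms n) (x : L) :
    fieldInv n 𝓛 (α ⊗ₜ x) = formInv n α ⊗ₜ[ℝ] parityInv 𝓛 x := rfl

theorem fieldInv_tmul_of_mem {p : ℕ} {j : ℤ} {α : Forms n} {x : L} (hα : α ∈ formDeg n p)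
    (hx : x ∈ shift 𝓛 j) : fieldInv n 𝓛 (α ⊗ₜ x) = parSign (p + j + 1) • α ⊗ₜ[ℝ] x := by
  rw [fieldInv_tmul, formInv_of_mem hα, parityInv_of_mem (𝓛 := 𝓛) (i := j + 1) hx,
    TensorProduct.tmul_smul, TensorProduct.smul_tmul', smul_smul, ← parSign_add,
    TensorProduct.smul_tmul']
  congr 3
  push_cast
  ring

theorem fieldInv_of_mem {a : ℤ} {A : Fields n L} (hA : A ∈ fieldDeg n 𝓛 a) :
    fieldInv n 𝓛 A = parSign (a + 1) • A := by
  refine Submodule.span_induction ?_ (by simp) ?_ ?_ hA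
  · rintro _ ⟨p, j, α, x, hα, hx, rfl, rfl⟩
    rw [fieldInv_tmul_of_mem hα hx]
    push_cast
    rfl
  · intro x y _ _ hx hy
    rw [map_add, hx, hy, smul_add]
  · intro c x _ hx
    rw [map_smul, hx, smul_comm]

theorem fieldInv_smul (g : SmoothFn n) (A : Fields n L) :
    fieldInv n 𝓛 (g • A) = g • fieldInv n 𝓛 A := by
  induction A using TensorProduct.induction_on with
  | zero => simp
  | add x y hx hy => rw [smul_add, map_add, hx, hy, map_add, smul_add]
  | tmul α x => rw [fields_smul_tmul, fieldInv_tmul, formInv_smul, fieldInv_tmul, fields_smul_tmul]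

theorem onFields_fieldInv_odd {T : Forms n →ₗ[ℝ] Forms n}
    (hT : ∀ α, T (formInv n α) = - formInv n (T α)) (A : Fields n L) :
    fieldInv n 𝓛 (onFields T A) = - onFields T (fieldInv n 𝓛 A) := by
  induction A using TensorProduct.induction_on with
  | zero => simp
  | add x y hx hy => rw [map_add, map_add, hx, hy, map_add, map_add, neg_add]
  | tmul α x =>
    rw [onFields_tmul, fieldInv_tmul, fieldInv_tmul, onFields_tmul, hT, TensorProduct.neg_tmul,
      neg_neg]

theorem onFields_fieldInv_even {T : Forms n →ₗ[ℝ] Forms n}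
    (hT : ∀ α, T (formInv n α) = formInv n (T α)) (A : Fields n L) :
    fieldInv n 𝓛 (onFields T A) = onFields T (fieldInv n 𝓛 A) := by
  induction A using TensorProduct.induction_on with
  | zero => simp
  | add x y hx hy => rw [map_add, map_add, hx, hy, map_add, map_add]
  | tmul α x => rw [onFields_tmul, fieldInv_tmul, fieldInv_tmul, onFields_tmul, hT]

/-! ### The pairing of fields -/

variable (C : CyclicLInfty n 𝓛)

theorem wedgePairing_tmul (α β : Forms n) (x y : L) :
    wedgePairing C (α ⊗ₜ x) (β ⊗ₜ y) =
      ∑ p : ZMod 2, C.pairing (parityProj 𝓛 p x) y • (α * (formInv n ^ p.val) β) := by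
  simp [wedgePairing, LinearMap.sum_apply]

theorem wedgePairing_tmul_of_mem {i : ℤ} {q : ℕ} (α : Forms n) {β : Forms n} {x : L} (y : L)
    (hx : x ∈ 𝓛 i) (hβ : β ∈ formDeg n q) :
    wedgePairing C (α ⊗ₜ x) (β ⊗ₜ y) = (parSign (i * q) * C.pairing x y) • (α * β) := by
  rw [wedgePairing_tmul, Finset.sum_eq_single (i : ZMod 2)]
  · rw [parityProj_of_mem _ hx, if_pos rfl, formInv_pow_of_mem hβ, mul_smul_comm, smul_smul,
      mul_comm, ZMod.natCast_zmod_val]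
  · intro p _ hp
    rw [parityProj_of_mem _ hx, if_neg (Ne.symm hp), map_zero, LinearMap.zero_apply, zero_smul]
  · simp

theorem wedgePairing_smul_left (g : SmoothFn n) (A B : Fields n L) :
    wedgePairing C (g • A) B = g • wedgePairing C A B := by
  induction A using TensorProduct.induction_on with
  | zero => simp
  | add x y hx hy =>
    rw [smul_add, map_add, LinearMap.add_apply, hx, hy, map_add, LinearMap.add_apply, smul_add]
  | tmul α x =>
    induction B using TensorProduct.induction_on with
    | zero => simp
    | add x y hx hy => rw [map_add, hx, hy, map_add, smul_add]
    | tmul β y =>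
      rw [fields_smul_tmul, wedgePairing_tmul, wedgePairing_tmul, Finset.smul_sum]
      refine Finset.sum_congr rfl fun p _ => ?_
      rw [smul_forms_mul, smul_comm]

theorem formInv_pow_smul (m : ℕ) (g : SmoothFn n) (α : Forms n) :
    (formInv n ^ m) (g • α) = g • (formInv n ^ m) α := by
  induction m with
  | zero => simp
  | succ m ih => rw [pow_succ', Module.End.mul_apply, ih, formInv_smul, Module.End.mul_apply]

theorem wedgePairing_smul_right (g : SmoothFn n) (A B : Fields n L) :
    wedgePairing C A (g • B) = g • wedgePairing C A B := by
  induction A using TensorProduct.induction_on with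
  | zero => simp
  | add x y hx hy =>
    rw [map_add, LinearMap.add_apply, hx, hy, LinearMap.add_apply, smul_add]
  | tmul α x =>
    induction B using TensorProduct.induction_on with
    | zero => simp
    | add x y hx hy => rw [smul_add, map_add, hx, hy, map_add, smul_add]
    | tmul β y =>
      rw [fields_smul_tmul, wedgePairing_tmul, wedgePairing_tmul, Finset.smul_sum]
      refine Finset.sum_congr rfl fun p _ => ?_
      rw [formInv_pow_smul, forms_mul_smul, smul_comm]

theorem eq_smul_of_generator (f : SmoothFn n) (l : ExtAlg n) (x : L) :
    ((f ⊗ₜ[ℝ] l) ⊗ₜ[ℝ] x : Fields n L) = f • (((1 : SmoothFn n) ⊗ₜ[ℝ] l) ⊗ₜ[ℝ] x) := by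
  rw [fields_smul_tmul, smooth_smul_tmul, mul_one]

/-- An additive map which is linear over the smooth functions sends compactly supported fields to
compactly supported objects. -/
theorem compactFields_map {M : Type*} [AddCommGroup M] [Module ℝ M] [Module (SmoothFn n) M]
    {K : Submodule ℝ M} (hK : ∀ (f : SmoothFn n) (m : M), f ∈ compactFn n → f • m ∈ K)
    {φ : Fields n L →ₗ[ℝ] M} (hφ : ∀ (g : SmoothFn n) (A : Fields n L), φ (g • A) = g • φ A)
    {A : Fields n L} (hA : A ∈ compactFields n L) : φ A ∈ K := by
  refine Submodule.span_induction ?_ (by simp) ?_ ?_ hA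
  · rintro _ ⟨f, l, x, hf, rfl⟩
    rw [eq_smul_of_generator, hφ]
    exact hK _ _ hf
  · intro x y _ _ hx hy
    rw [map_add]; exact add_mem hx hy
  · intro c x _ hx
    rw [map_smul]; exact Submodule.smul_mem _ _ hx

theorem wedgePairing_mem_right (A : Fields n L) {B : Fields n L} (hB : B ∈ compactFields n L) :
    wedgePairing C A B ∈ compactForms n :=
  compactFields_map (K := compactForms n) (φ := wedgePairing C A)
    (fun _ α hf => smul_mem_compactForms hf α) (fun g B => wedgePairing_smul_right C g A B) hB

/-! ### The symplectic form -/

theorem sympl_eq (A B : Fields n L) :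
    sympl C A B = 2 * integral (wedgePairing C (fieldInv n 𝓛 A) B) := rfl

theorem sympl_add_left (A A' : Fields n L) {B : Fields n L} (hB : B ∈ compactFields n L) :
    sympl C (A + A') B = sympl C A B + sympl C A' B := by
  rw [sympl_eq, map_add, map_add, LinearMap.add_apply, integral_add'
    (wedgePairing_mem_right C _ hB) (wedgePairing_mem_right C _ hB), mul_add]
  rfl

theorem sympl_smul_left (c : ℝ) (A B : Fields n L) :
    sympl C (c • A) B = c * sympl C A B := by
  rw [sympl_eq, map_smul, map_smul, LinearMap.smul_apply, integral_smul', mul_left_comm]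
  rfl

theorem sympl_smul_right (c : ℝ) (A B : Fields n L) :
    sympl C A (c • B) = c * sympl C A B := by
  rw [sympl_eq, map_smul, integral_smul', mul_left_comm]
  rfl

theorem sympl_zero_left (B : Fields n L) : sympl C 0 B = 0 := by
  simpa using sympl_smul_left C 0 0 B

theorem sympl_zero_right (A : Fields n L) : sympl C A 0 = 0 := by
  simpa using sympl_smul_right C 0 A 0

/-- The symplectic form as a linear map in its first argument. -/
def symplLin (B : Fields n L) (hB : B ∈ compactFields n L) : Fields n L →ₗ[ℝ] ℝ where
  toFun A := sympl C A B
  map_add' A A' := sympl_add_left C A A' hB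
  map_smul' c A := sympl_smul_left C c A B

/-- The antisymmetry already holds for the integrand. A contribution needs form degrees adding up to
`n` and degrees in `L` adding up to `3 - n`, so the total parity is odd; this turns the graded
symmetry of the pairing, twisted by `(-1)^|A|`, into plain antisymmetry. -/
theorem topCoeff_pairing_antisymm (A B : Fields n L) :
    topCoeff n (wedgePairing C (fieldInv n 𝓛 A) B) =
      - topCoeff n (wedgePairing C (fieldInv n 𝓛 B) A) := by
  refine fields_induction (𝓛 := 𝓛) (P := fun A => topCoeff n (wedgePairing C (fieldInv n 𝓛 A) B) =
      - topCoeff n (wedgePairing C (fieldInv n 𝓛 B) A)) ?_ ?_ A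
  · intro A A' h1 h2
    rw [map_add, map_add, LinearMap.add_apply, map_add, h1, h2, map_add, map_add, neg_add]
  · intro p j α x hα hx
    refine fields_induction (𝓛 := 𝓛)
      (P := fun B => topCoeff n (wedgePairing C (fieldInv n 𝓛 (α ⊗ₜ x)) B) =
      - topCoeff n (wedgePairing C (fieldInv n 𝓛 B) (α ⊗ₜ x))) ?_ ?_ B
    · intro A A' h1 h2
      rw [map_add, map_add, h1, h2, map_add, map_add, LinearMap.add_apply, map_add, neg_add]
    · intro q j' β y hβ hy
      rw [fieldInv_tmul_of_mem hα hx, fieldInv_tmul_of_mem hβ hy, map_smul, map_smul,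
        LinearMap.smul_apply, LinearMap.smul_apply, wedgePairing_tmul_of_mem C _ _ hx hβ,
        wedgePairing_tmul_of_mem C _ _ hy hα]
      simp only [map_smul]
      by_cases hpq : p + q = n
      · by_cases hj : (j + 1) + (j' + 1) = 3 - (n : ℤ)
        · rw [formDeg_mul_comm hβ hα, map_smul, C.pairing_symm _ _ _ _ hy hx, neg_one_zpow]
          simp only [smul_smul, ← neg_smul]
          congr 1
          -- The two degree conditions add up to total degree 3 in `Ω ⊗ L`; the two shifts in `L[1]`
          -- do not change the parity.
          have e : (j : ZMod 2) + j' + p + q = 1 := by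
            have h1 : ((j + 1) + (j' + 1) + (p + q : ℕ) : ℤ) = 3 := by rw [hj, hpq]; ring
            have h2 := congrArg (Int.cast : ℤ → ZMod 2) h1
            push_cast at h2
            have h3 : (3 : ZMod 2) = 1 := by decide
            have h4 : (1 : ZMod 2) + 1 = 0 := by decide
            linear_combination h2 + h3 - h4
          have e2 : ∀ p q j j' : ZMod 2, j + j' + p + q = 1 →
              p + j + 1 + (j + 1) * q =
                1 + (q + j' + 1 + (j' + 1) * p + (j' + 1) * (j + 1) + q * p) := by decide
          have e3 := congrArg parSign (e2 p q j j' e)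
          simp only [parSign_add (1 : ZMod 2), parSign_add _ ((_ : ZMod 2) * _), parSign_one] at e3
          push_cast
          rw [← mul_assoc, e3]
          ring
        · rw [C.pairing_degree _ _ _ _ hx hy hj, C.pairing_degree _ _ _ _ hy hx
            (by rwa [add_comm])]
          simp
      · rw [topCoeff_of_mem hpq (formDeg_mul hα hβ),
          topCoeff_of_mem (by rwa [add_comm]) (formDeg_mul hβ hα)]
        simp

theorem sympl_antisymm (A B : Fields n L) : sympl C A B = - sympl C B A := by
  rw [sympl_eq, sympl_eq, integral, integral, topCoeff_pairing_antisymm, ← mul_neg]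
  congr 1
  exact integral_neg _

/-- Degree count: `n` from the integral and `3 - n` from the pairing, less 2 for the two shifts. -/
theorem sympl_eq_zero {a b : ℤ} (hab : a + b ≠ 1) {A B : Fields n L} (hA : A ∈ fieldDeg n 𝓛 a)
    (hB : B ∈ fieldDeg n 𝓛 b) : sympl C A B = 0 := by
  have key : topCoeff n (wedgePairing C (fieldInv n 𝓛 A) B) = 0 := by
    rw [fieldInv_of_mem hA, map_smul, LinearMap.smul_apply, map_smul]
    suffices h : topCoeff n (wedgePairing C A B) = 0 by rw [h, smul_zero]
    refine Submodule.span_induction ?_ (by simp) ?_ ?_ hA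
    · rintro _ ⟨p, j, α, x, hα, hx, hd, rfl⟩
      refine Submodule.span_induction ?_ (by simp) ?_ ?_ hB
      · rintro _ ⟨q, j', β, y, hβ, hy, hd', rfl⟩
        rw [wedgePairing_tmul_of_mem C _ _ hx hβ, map_smul]
        by_cases hpq : p + q = n
        · rw [C.pairing_degree _ _ _ _ hx hy, mul_zero, zero_smul]
          intro h
          apply hab
          omega
        · rw [topCoeff_of_mem hpq (formDeg_mul hα hβ), smul_zero]
      · intro x y _ _ hx hy
        rw [map_add, map_add, hx, hy, add_zero]
      · intro c x _ hx
        rw [map_smul, map_smul, hx, smul_zero]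
    · intro x y _ _ hx hy
      rw [map_add, LinearMap.add_apply, map_add, hx, hy, add_zero]
    · intro c x _ hx
      rw [map_smul, LinearMap.smul_apply, map_smul, hx, smul_zero]
  rw [sympl_eq, integral, key]
  refine mul_eq_zero_of_right _ ?_
  exact integral_zero _ _

theorem wedgePairing_odd {T : Forms n →ₗ[ℝ] Forms n}
    (hT : ∀ α β, T (α * β) = T α * β + formInv n α * T β)
    (hTd : ∀ (p : ℕ) (α : Forms n), α ∈ formDeg n p → T α = 0 ∨
      ∃ q : ℕ, ((q : ℕ) : ZMod 2) = p + 1 ∧ T α ∈ formDeg n q) (A B : Fields n L) :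
    T (wedgePairing C A B) = wedgePairing C (onFields T A) B +
      wedgePairing C (fieldInv n 𝓛 A) (onFields T B) := by
  refine fields_induction (𝓛 := 𝓛) (P := fun A => T (wedgePairing C A B) =
    wedgePairing C (onFields T A) B + wedgePairing C (fieldInv n 𝓛 A) (onFields T B)) ?_ ?_ A
  · intro A A' h1 h2
    simp only [map_add, LinearMap.add_apply, h1, h2]
    abel
  · intro p j α x hα hx
    refine fields_induction (𝓛 := 𝓛) (P := fun B => T (wedgePairing C (α ⊗ₜ x) B) =
      wedgePairing C (onFields T (α ⊗ₜ x)) B +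
        wedgePairing C (fieldInv n 𝓛 (α ⊗ₜ x)) (onFields T B)) ?_ ?_ B
    · intro A A' h1 h2
      simp only [map_add, h1, h2]
      abel
    · intro q j' β y hβ hy
      rw [wedgePairing_tmul_of_mem C _ _ hx hβ, map_smul, hT, onFields_tmul, onFields_tmul,
        wedgePairing_tmul_of_mem C _ _ hx hβ, fieldInv_tmul_of_mem hα hx, map_smul,
        LinearMap.smul_apply, smul_add]
      congr 1
      rcases hTd q β hβ with h | ⟨r, hr, h⟩
      · rw [h]; simp
      · rw [wedgePairing_tmul_of_mem C _ _ hx h, hr, formInv_of_mem hα, smul_mul_assoc, smul_smul,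
          smul_smul]
        congr 1
        have e2 : ∀ p q j : ZMod 2, (j + 1) * q + p = p + j + 1 + (j + 1) * (q + 1) := by decide
        have e3 := congrArg parSign (e2 p q j)
        rw [parSign_add, parSign_add _ ((_ : ZMod 2) * _)] at e3
        push_cast
        rw [mul_right_comm, e3]
        ring

theorem wedgePairing_even {T : Forms n →ₗ[ℝ] Forms n}
    (hT : ∀ α β, T (α * β) = T α * β + α * T β)
    (hTd : ∀ (p : ℕ) (α : Forms n), α ∈ formDeg n p → T α ∈ formDeg n p) (A B : Fields n L) :
    T (wedgePairing C A B) = wedgePairing C (onFields T A) B + wedgePairing C A (onFields T B) := by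
  refine fields_induction (𝓛 := 𝓛) (P := fun A => T (wedgePairing C A B) =
    wedgePairing C (onFields T A) B + wedgePairing C A (onFields T B)) ?_ ?_ A
  · intro A A' h1 h2
    simp only [map_add, LinearMap.add_apply, h1, h2]
    abel
  · intro p j α x hα hx
    refine fields_induction (𝓛 := 𝓛) (P := fun B => T (wedgePairing C (α ⊗ₜ x) B) =
      wedgePairing C (onFields T (α ⊗ₜ x)) B +
        wedgePairing C (α ⊗ₜ x) (onFields T B)) ?_ ?_ B
    · intro A A' h1 h2
      simp only [map_add, h1, h2]
      abel
    · intro q j' β y hβ hy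
      rw [wedgePairing_tmul_of_mem C _ _ hx hβ, map_smul, hT, onFields_tmul, onFields_tmul,
        wedgePairing_tmul_of_mem C _ _ hx hβ, wedgePairing_tmul_of_mem C _ _ hx (hTd q β hβ),
        smul_add]

theorem extD_degree (p : ℕ) (α : Forms n) (hα : α ∈ formDeg n p) : extD n α = 0 ∨
    ∃ q : ℕ, (q : ℤ) = p + 1 ∧ extD n α ∈ formDeg n q :=
  Or.inr ⟨p + 1, by push_cast; rfl, extD_mem hα⟩

theorem contrField_degree (ξ : Fin n → SmoothFn n) (p : ℕ) (α : Forms n) (hα : α ∈ formDeg n p) :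
    contrField ξ α = 0 ∨ ∃ q : ℕ, (q : ℤ) = p + -1 ∧ contrField ξ α ∈ formDeg n q := by
  cases p with
  | zero => exact Or.inl (contrField_eq_zero ξ hα)
  | succ p => exact Or.inr ⟨p, by push_cast; ring, contrField_mem ξ hα⟩

theorem lieDer_degree (ξ : Fin n → SmoothFn n) (p : ℕ) (α : Forms n) (hα : α ∈ formDeg n p) :
    lieDer ξ α = 0 ∨ ∃ q : ℕ, (q : ℤ) = p + 0 ∧ lieDer ξ α ∈ formDeg n q :=
  Or.inr ⟨p, by ring, lieDer_mem ξ hα⟩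

/-- Integration by parts: the integral of `T ⟨A ∧ B⟩` vanishes, and the Leibniz rule expresses it
through the two terms to be compared. It serves both `d` and contractions. -/
theorem sympl_odd {T : Forms n →ₗ[ℝ] Forms n}
    (hT : ∀ α β, T (α * β) = T α * β + formInv n α * T β)
    (hTd : ∀ (p : ℕ) (α : Forms n), α ∈ formDeg n p → T α = 0 ∨
      ∃ q : ℕ, ((q : ℕ) : ZMod 2) = p + 1 ∧ T α ∈ formDeg n q)
    (hTi : ∀ α, T (formInv n α) = - formInv n (T α))
    (hTc : ∀ α ∈ compactForms n, T α ∈ compactForms n)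
    (hT0 : ∀ α ∈ compactForms n, integral (T α) = 0)
    {a : ℤ} {A B : Fields n L} (hA : A ∈ fieldDeg n 𝓛 a) (hB : B ∈ compactFields n L) :
    sympl C (onFields T A) B = - (parSign a * sympl C A (onFields T B)) := by
  have h := wedgePairing_odd C hT hTd (fieldInv n 𝓛 A) B
  have h0 := hT0 _ (wedgePairing_mem_right C (fieldInv n 𝓛 A) hB)
  rw [h, integral_add' (wedgePairing_mem_right C _ hB)
    (wedgePairing_mem_right C _ (onFields_mem_compactFields hTc hB))] at h0
  rw [sympl_eq, onFields_fieldInv_odd hTi, map_neg, LinearMap.neg_apply]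
  have h1 : ∀ α : Forms n, integral (-α) = - integral α := fun α => by
    simpa using integral_smul' (-1) α
  rw [h1, eq_neg_of_add_eq_zero_left h0, fieldInv_of_mem hA, map_smul, fieldInv_of_mem hA,
    smul_smul, sympl_eq, fieldInv_of_mem hA, map_smul, map_smul, LinearMap.smul_apply,
    LinearMap.smul_apply, integral_smul', integral_smul']
  rw [parSign_add, parSign_one]
  ring

theorem sympl_even {T : Forms n →ₗ[ℝ] Forms n}
    (hT : ∀ α β, T (α * β) = T α * β + α * T β)
    (hTd : ∀ (p : ℕ) (α : Forms n), α ∈ formDeg n p → T α ∈ formDeg n p)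
    (hTi : ∀ α, T (formInv n α) = formInv n (T α))
    (hTc : ∀ α ∈ compactForms n, T α ∈ compactForms n)
    (hT0 : ∀ α ∈ compactForms n, integral (T α) = 0)
    {A B : Fields n L} (hB : B ∈ compactFields n L) :
    sympl C (onFields T A) B = - sympl C A (onFields T B) := by
  have h := wedgePairing_even C hT hTd (fieldInv n 𝓛 A) B
  have h0 := hT0 _ (wedgePairing_mem_right C (fieldInv n 𝓛 A) hB)
  rw [h, integral_add' (wedgePairing_mem_right C _ hB)
    (wedgePairing_mem_right C _ (onFields_mem_compactFields hTc hB))] at h0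
  rw [sympl_eq, onFields_fieldInv_even hTi, eq_neg_of_add_eq_zero_left h0, sympl_eq, mul_neg]

end Pairing

/-! ### Nondegeneracy of the symplectic form -/

section Nondegenerate

variable {n : ℕ} {L : Type*} [AddCommGroup L] [Module ℝ L]
  {𝓛 : ℤ → Submodule ℝ L} [DirectSum.Decomposition 𝓛]

/-- Evaluation of smooth functions at a point. -/
def evalAt (x : Rn n) : SmoothFn n →ₗ[ℝ] ℝ where
  toFun f := f.fn x
  map_add' _ _ := rfl
  map_smul' _ _ := rfl

/-- The coefficient of the `S`-th basis form at a point. -/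
def formCoeff (S : Finset (Fin n)) (pt : Rn n) : Forms n →ₗ[ℝ] ℝ :=
  (LinearMap.mul' ℝ ℝ).comp (TensorProduct.map (evalAt pt) ((dxBasis n).ExteriorAlgebra.coord S))

theorem formCoeff_tmul (S : Finset (Fin n)) (pt : Rn n) (f : SmoothFn n) (l : ExtAlg n) :
    formCoeff S pt (f ⊗ₜ l) = f.fn pt * (dxBasis n).ExteriorAlgebra.coord S l := rfl

/-- The coefficient in `L` of the `S`-th basis form at a point. -/
def fieldCoeff (S : Finset (Fin n)) (pt : Rn n) : Fields n L →ₗ[ℝ] L :=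
  (TensorProduct.lid ℝ L).toLinearMap.comp (TensorProduct.map (formCoeff S pt) LinearMap.id)

theorem fieldCoeff_tmul (S : Finset (Fin n)) (pt : Rn n) (α : Forms n) (x : L) :
    fieldCoeff S pt (α ⊗ₜ x) = formCoeff S pt α • x := by
  simp [fieldCoeff]

theorem forms_eq_zero {α : Forms n} (h : ∀ S pt, formCoeff S pt α = 0) : α = 0 := by
  have key : ∀ (β : Forms n) S pt, formCoeff S pt β =
      ((TensorProduct.equivFinsuppOfBasisRight (dxBasis n).ExteriorAlgebra β) S).fn pt := by
    intro β S pt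
    induction β using TensorProduct.induction_on with
    | zero => simp; rfl
    | add x y hx hy => rw [map_add, hx, hy, map_add]; rfl
    | tmul f l =>
      rw [formCoeff_tmul, TensorProduct.equivFinsuppOfBasisRight_apply_tmul_apply]
      exact mul_comm _ _
  apply (TensorProduct.equivFinsuppOfBasisRight (dxBasis n).ExteriorAlgebra).injective
  rw [map_zero]
  ext S : 1
  refine SmoothFn.ext fun pt => ?_
  rw [← key, h]
  rfl

/-- A basis of `L` as a vector space reduces this to forms; no finiteness of `L` is needed. -/
theorem fields_eq_zero {A : Fields n L} (h : ∀ S pt, fieldCoeff S pt A = 0) : A = 0 := by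
  classical
  let b := Module.Basis.ofVectorSpace ℝ L
  have key : ∀ (B : Fields n L) S pt i, b.coord i (fieldCoeff S pt B) =
      formCoeff S pt (TensorProduct.equivFinsuppOfBasisRight b B i) := by
    intro B S pt i
    induction B using TensorProduct.induction_on with
    | zero => simp
    | add x y hx hy => rw [map_add, map_add, hx, hy, map_add, Finsupp.add_apply, map_add]
    | tmul α x =>
      rw [fieldCoeff_tmul, TensorProduct.equivFinsuppOfBasisRight_apply_tmul_apply, map_smul,
        map_smul, smul_eq_mul, smul_eq_mul, mul_comm]
      rfl
  apply (TensorProduct.equivFinsuppOfBasisRight b).injective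
  rw [map_zero]
  ext i : 1
  refine forms_eq_zero fun S pt => ?_
  rw [← key, h, map_zero]

theorem topExt_involute_mul (S : Finset (Fin n)) (l : ExtAlg n) :
    topExt n (CliffordAlgebra.involute l * (dxBasis n).ExteriorAlgebra Sᶜ) =
      (dxBasis n).ExteriorAlgebra.coord S l * (parSign S.card *
        topExt n ((dxBasis n).ExteriorAlgebra S * (dxBasis n).ExteriorAlgebra Sᶜ)) := by
  have h : (topExt n).comp ((LinearMap.mulRight ℝ ((dxBasis n).ExteriorAlgebra Sᶜ)).comp
      CliffordAlgebra.involute.toLinearMap) =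
      (LinearMap.mulRight ℝ (parSign S.card *
        topExt n ((dxBasis n).ExteriorAlgebra S * (dxBasis n).ExteriorAlgebra Sᶜ))).comp
        ((dxBasis n).ExteriorAlgebra.coord S) := by
    refine (dxBasis n).ExteriorAlgebra.ext fun S' => ?_
    simp only [LinearMap.comp_apply, LinearMap.mulRight_apply, AlgHom.toLinearMap_apply,
      involute_of_mem (dxBasis_exterior_mem S'), map_smul, smul_eq_mul]
    by_cases hS : S' = S
    · subst hS
      simp
    · rw [topExt_basis_mul hS]
      simp [hS]
  exact LinearMap.congr_fun h l

/-- The involution `x ↦ (-1)^(|x| (q + 1)) x`. -/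
def twistedInv (𝓛 : ℤ → Submodule ℝ L) [DirectSum.Decomposition 𝓛] (q : ℕ) : L →ₗ[ℝ] L :=
  ∑ p : ZMod 2, parSign (p * q) • (parityProj 𝓛 p).comp (parityInv 𝓛)

theorem twistedInv_twistedInv (q : ℕ) (x : L) : twistedInv 𝓛 q (twistedInv 𝓛 q x) = x := by
  induction x using DirectSum.Decomposition.inductionOn 𝓛 with
  | zero => simp
  | add x y hx hy => rw [map_add, map_add, hx, hy]
  | @homogeneous i x =>
    have h : twistedInv 𝓛 q x = (parSign (i * q) * parSign i) • (x : L) := by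
      rw [twistedInv, LinearMap.sum_apply, Finset.sum_eq_single (i : ZMod 2)]
      · rw [LinearMap.smul_apply, LinearMap.comp_apply, parityInv_of_mem x.2, map_smul,
          parityProj_of_mem _ x.2, if_pos rfl, smul_smul]
      · intro p _ hp
        rw [LinearMap.smul_apply, LinearMap.comp_apply, parityInv_of_mem x.2, map_smul,
          parityProj_of_mem _ x.2, if_neg (Ne.symm hp), smul_zero, smul_zero]
      · simp
    rw [h, map_smul, h, smul_smul, ← parSign_add, parSign_mul_self, one_smul]

/-- Pairing with the constant field `dx_{Sᶜ} ⊗ y` isolates the coefficient of `dx_S` in `A`, up to a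
nonzero constant and an involution of `L` that collects the signs. -/
theorem topCoeff_pairing_basis (C : CyclicLInfty n 𝓛) (A : Fields n L) (S : Finset (Fin n))
    (y : L) (pt : Rn n) :
    (topCoeff n (wedgePairing C (fieldInv n 𝓛 A)
      (((1 : SmoothFn n) ⊗ₜ[ℝ] (dxBasis n).ExteriorAlgebra Sᶜ) ⊗ₜ[ℝ] y))).fn pt =
      (parSign S.card * topExt n ((dxBasis n).ExteriorAlgebra S * (dxBasis n).ExteriorAlgebra Sᶜ)) *
        C.pairing (twistedInv 𝓛 Sᶜ.card (fieldCoeff S pt A)) y := by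
  induction A using TensorProduct.induction_on with
  | zero => simp; rfl
  | add A A' h1 h2 =>
    simp only [map_add, LinearMap.add_apply]
    rw [mul_add, ← h1, ← h2]
    rfl
  | tmul α x =>
    induction α using TensorProduct.induction_on with
    | zero => simp; rfl
    | add A A' h1 h2 =>
      simp only [TensorProduct.add_tmul, map_add, LinearMap.add_apply]
      rw [mul_add, ← h1, ← h2]
      rfl
    | tmul f l =>
      have hm : (1 : SmoothFn n) ⊗ₜ[ℝ] (dxBasis n).ExteriorAlgebra Sᶜ ∈ formDeg n Sᶜ.card :=
        tmul_mem_formDeg _ (dxBasis_exterior_mem Sᶜ)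
      rw [fieldInv_tmul, wedgePairing_tmul, formInv_tmul, fieldCoeff_tmul, formCoeff_tmul]
      simp only [formInv_pow_of_mem hm, mul_smul_comm, Algebra.TensorProduct.tmul_mul_tmul, mul_one,
        map_sum, map_smul, topCoeff_tmul, topExt_involute_mul]
      rw [twistedInv, LinearMap.sum_apply, map_sum, LinearMap.smul_apply, LinearMap.sum_apply]
      simp only [ZMod.natCast_zmod_val, smul_smul]
      rw [← Finset.sum_smul]
      simp only [LinearMap.smul_apply, LinearMap.comp_apply, map_smul, smul_eq_mul]
      change _ * f.fn pt = _
      rw [Finset.sum_mul, Finset.mul_sum, Finset.mul_sum]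
      refine Finset.sum_congr rfl fun p _ => ?_
      ring

/-- The test fields are `g • (dx_{Sᶜ} ⊗ y)` with `g` compactly supported. Varying `g` makes the
integrand vanish pointwise, varying `y` kills the twisted coefficient of `dx_S` by nondegeneracy on
`L`, and the twist is invertible. -/
theorem sympl_nondegenerate (C : CyclicLInfty n 𝓛) {A : Fields n L}
    (h : ∀ B ∈ compactFields n L, sympl C A B = 0) : A = 0 := by
  refine fields_eq_zero fun S pt => ?_
  have h1 : ∀ y, C.pairing (twistedInv 𝓛 Sᶜ.card (fieldCoeff S pt A)) y = 0 := by
    intro y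
    have h0 : topCoeff n (wedgePairing C (fieldInv n 𝓛 A)
        (((1 : SmoothFn n) ⊗ₜ[ℝ] (dxBasis n).ExteriorAlgebra Sᶜ) ⊗ₜ[ℝ] y)) = 0 := by
      refine eq_zero_of_integral_mul fun g hg => ?_
      have := h _ (smul_mem_compactFields hg
        (((1 : SmoothFn n) ⊗ₜ[ℝ] (dxBasis n).ExteriorAlgebra Sᶜ) ⊗ₜ[ℝ] y))
      rw [sympl_eq, wedgePairing_smul_right, integral, topCoeff_smul] at this
      exact (mul_eq_zero.1 this).resolve_left two_ne_zero
    have h2 := topCoeff_pairing_basis C A S y pt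
    rw [h0] at h2
    have hne : parSign S.card *
        topExt n ((dxBasis n).ExteriorAlgebra S * (dxBasis n).ExteriorAlgebra Sᶜ) ≠ 0 :=
      mul_ne_zero (fun h => by simpa [h] using parSign_mul_self S.card) (topExt_basis_mul_self S)
    exact (mul_eq_zero.1 h2.symm).resolve_left hne
  have h2 := C.pairing_nondegenerate _ h1
  rw [← twistedInv_twistedInv (𝓛 := 𝓛) Sᶜ.card (fieldCoeff S pt A), h2, map_zero]

/-- The antibracket uses a vector field obtained by choice. Nondegeneracy makes it agree on
compactly supported arguments with any known Hamiltonian vector field. -/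
theorem hamVF_eq (C : CyclicLInfty n 𝓛) {F : Functional n L} {X : VField n L}
    (hX : IsHamiltonian C F X) {k : ℕ} (e : Fin k → compactFields n L) :
    hamVF C F k (fun i => (e i : Fields n L)) = X k fun i => (e i : Fields n L) := by
  have hex : ∃ X, IsHamiltonian C F X := ⟨X, hX⟩
  have h : IsHamiltonian C F (hamVF C F) := by
    rw [hamVF, dif_pos hex]; exact hex.choose_spec
  rw [← sub_eq_zero]
  refine sympl_nondegenerate C fun B hB => ?_
  rw [sub_eq_add_neg, sympl_add_left C _ _ hB, ← neg_one_smul ℝ (X k _), sympl_smul_left]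
  have h1 := h.2 k e ⟨B, hB⟩
  have h2 := hX.2 k e ⟨B, hB⟩
  rw [← h1, ← h2]
  ring

end Nondegenerate

/-! ### Insertions -/

section Insertion

variable {V N : Type*} [AddCommGroup V] [Module ℝ V] [AddCommGroup N] [Module ℝ N]

/-- One term of the insertion of `Y` into `X`, as a multilinear map. -/
def insertionTerm (X : ∀ k, MultilinearMap ℝ (fun _ : Fin k => V) N)
    (Y : ∀ k, MultilinearMap ℝ (fun _ : Fin k => V) V) {k : ℕ} (T : Finset (Fin k)) :
    MultilinearMap ℝ (fun _ : Fin k => V) N :=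
  (MultilinearMap.curryFinFinset ℝ N V (s := T) rfl rfl).symm
    ((X (Tᶜ.card + 1)).curryLeft.compMultilinearMap (Y T.card))

theorem insertionTerm_apply (X : ∀ k, MultilinearMap ℝ (fun _ : Fin k => V) N)
    (Y : ∀ k, MultilinearMap ℝ (fun _ : Fin k => V) V) {k : ℕ} (T : Finset (Fin k))
    (v : Fin k → V) :
    insertionTerm X Y T v =
      X (Tᶜ.card + 1) (Fin.cons (Y T.card (sub v T)) (sub v Tᶜ)) := by
  rw [insertionTerm, MultilinearMap.curryFinFinset_symm_apply]
  rfl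

/-- For fixed degrees the insertion is multilinear in `v`, so identities between insertions need
checking only on homogeneous pure tensors. -/
theorem insertion_eq (X : ∀ k, MultilinearMap ℝ (fun _ : Fin k => V) N)
    (Y : ∀ k, MultilinearMap ℝ (fun _ : Fin k => V) V) {k : ℕ} (d : Fin k → ℤ) (v : Fin k → V) :
    insertion (fun k => ⇑(X k)) (fun k => ⇑(Y k)) d v =
      (∑ T, unshuffleSign T d • insertionTerm X Y T) v := by
  rw [_root_.sum_apply]
  refine Finset.sum_congr rfl fun T _ => ?_
  rw [_root_.smul_apply, insertionTerm_apply]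

theorem insertion_add_left (X X' : ∀ k, MultilinearMap ℝ (fun _ : Fin k => V) N)
    (Y : ∀ k, MultilinearMap ℝ (fun _ : Fin k => V) V) {k : ℕ} (d : Fin k → ℤ) (v : Fin k → V) :
    insertion (fun k => ⇑((X + X') k)) (fun k => ⇑(Y k)) d v =
      insertion (fun k => ⇑(X k)) (fun k => ⇑(Y k)) d v +
      insertion (fun k => ⇑(X' k)) (fun k => ⇑(Y k)) d v := by
  simp only [insertion, ← Finset.sum_add_distrib, ← smul_add]
  rfl

theorem insertion_add_right (X : ∀ k, MultilinearMap ℝ (fun _ : Fin k => V) N)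
    (Y Y' : ∀ k, MultilinearMap ℝ (fun _ : Fin k => V) V) {k : ℕ} (d : Fin k → ℤ) (v : Fin k → V) :
    insertion (fun k => ⇑(X k)) (fun k => ⇑((Y + Y') k)) d v =
      insertion (fun k => ⇑(X k)) (fun k => ⇑(Y k)) d v +
      insertion (fun k => ⇑(X k)) (fun k => ⇑(Y' k)) d v := by
  simp only [insertion, ← Finset.sum_add_distrib, ← smul_add]
  refine Finset.sum_congr rfl fun T _ => ?_
  rw [← MultilinearMap.cons_add]
  rfl

/-- A linear map as a vector field. -/
def linVF (T : V →ₗ[ℝ] V) : ∀ k, MultilinearMap ℝ (fun _ : Fin k => V) V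
  | 1 => MultilinearMap.ofSubsingleton ℝ V V (0 : Fin 1) T
  | _ => 0

theorem linVF_one (T : V →ₗ[ℝ] V) (v : Fin 1 → V) : linVF T 1 v = T (v 0) := rfl

theorem linVF_of_ne (T : V →ₗ[ℝ] V) {k : ℕ} (hk : k ≠ 1) : linVF T k = 0 := by
  match k, hk with
  | 0, _ => rfl
  | k + 2, _ => rfl

theorem linVF_of_card (T : V →ₗ[ℝ] V) {k : ℕ} (hk : k = 1) (v : Fin k → V) :
    linVF T k v = T (v ⟨0, by omega⟩) := by
  subst hk; rfl

/-- A linear outer map has room for the inserted value only, so `T` must take all positions. -/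
theorem insertion_linVF_left (T : V →ₗ[ℝ] V) (Y : ∀ k, (Fin k → V) → V) {k : ℕ} (d : Fin k → ℤ)
    (v : Fin k → V) : insertion (fun k => ⇑(linVF T k)) Y d v = T (Y k v) := by
  rw [insertion, Finset.sum_eq_single Finset.univ]
  · have h1 : unshuffleSign (Finset.univ : Finset (Fin k)) d = 1 := by
      rw [unshuffleSign_eq, unshuffleExp]
      simp [parSign_zero]
    have h2 : Y (Finset.univ : Finset (Fin k)).card (sub v Finset.univ) = Y k v := by
      rw [← onList_ofFn Y, ofFn_sub]
      simp only [Finset.mem_univ, decide_true, List.filter_true]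
      rw [← onList_ofFn Y v, List.ofFn_eq_map]
    rw [h1, one_smul, linVF_of_card T (by simp)]
    exact congrArg T h2
  · intro S _ hS
    rw [linVF_of_ne, _root_.zero_apply, smul_zero]
    have : Sᶜ.Nonempty := by
      rw [Finset.nonempty_iff_ne_empty]
      exact fun h => hS (by simpa using h)
    have := this.card_pos
    omega
  · simp

theorem insertion_linVF_right (X : ∀ k, MultilinearMap ℝ (fun _ : Fin k => V) N) (T : V →ₗ[ℝ] V)
    {k : ℕ} (d : Fin k → ℤ) (v : Fin k → V) :
    insertion (fun k => ⇑(X k)) (fun k => ⇑(linVF T k)) d v =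
      ∑ i, unshuffleSign {i} d • X (({i} : Finset (Fin k))ᶜ.card + 1)
        (Fin.cons (T (v i)) (sub v {i}ᶜ)) := by
  rw [insertion, ← Finset.sum_subset (Finset.subset_univ (Finset.univ.image
    (fun i : Fin k => ({i} : Finset (Fin k)))))]
  · rw [Finset.sum_image (fun i _ j _ h => Finset.singleton_injective h)]
    refine Finset.sum_congr rfl fun i _ => ?_
    congr 2
    rw [linVF_of_card T (Finset.card_singleton i)]
    congr 2
    exact sub_singleton_apply v i _
  · intro S _ hS
    have h1 : S.card ≠ 1 := fun h => by
      obtain ⟨i, rfl⟩ := Finset.card_eq_one.1 h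
      exact hS (Finset.mem_image_of_mem _ (Finset.mem_univ i))
    rw [linVF_of_ne T h1, _root_.zero_apply]
    rw [(X _).map_coord_zero (0 : Fin (Sᶜ.card + 1)) (Fin.cons_zero _ _), smul_zero]

/-- The unshuffle of a singleton moves one entry to the front; graded symmetry undoes the move. -/
theorem isGradedSymm_singleton {𝒱 : ℤ → Submodule ℝ V} {X : ∀ k, (Fin k → V) → N}
    (hX : ∀ k, IsGradedSymm 𝒱 (X k)) {k : ℕ} {d : Fin k → ℤ} {v : Fin k → V}
    (hv : IsHomog 𝒱 d v) (i : Fin k) :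
    X (({i} : Finset (Fin k))ᶜ.card + 1) (Fin.cons (v i) (sub v {i}ᶜ)) =
      unshuffleSign {i} d • X k v := by
  rw [hX k d v hv (unshufflePerm {i}), koszulSign_unshufflePerm, smul_smul, unshuffleSign_eq,
    parSign_mul_self, one_smul, ← onList_ofFn X (fun a => v (unshufflePerm {i} a)),
    ofFn_unshufflePerm, ← onList_ofFn X, List.ofFn_succ]
  rw [ofFn_sub_singleton]
  rfl

theorem isHomog_sub {𝒱 : ℤ → Submodule ℝ V} {k : ℕ} {d : Fin k → ℤ} {v : Fin k → V}
    (hv : IsHomog 𝒱 d v) (T : Finset (Fin k)) : IsHomog 𝒱 (sub d T) (sub v T) := fun _ => hv _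

theorem isHomog_cons {𝒱 : ℤ → Submodule ℝ V} {k : ℕ} {d : Fin k → ℤ} {v : Fin k → V} {a : ℤ} {y : V}
    (hy : y ∈ 𝒱 a) (hv : IsHomog 𝒱 d v) :
    IsHomog 𝒱 (Fin.cons a d : Fin (k + 1) → ℤ) (Fin.cons y v : Fin (k + 1) → V) := fun i =>
  Fin.cases hy (fun i => hv i) i

theorem isGradedSymm_of_subsingleton {𝒱 : ℤ → Submodule ℝ V} {k : ℕ} (hk : k ≤ 1)
    (f : (Fin k → V) → N) : IsGradedSymm 𝒱 f := by
  intro d v _ σ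
  have : Subsingleton (Fin k) := Fin.subsingleton_iff_le_one.2 hk
  have h1 : σ = 1 := Subsingleton.elim _ _
  subst h1
  have h2 : koszulExp (1 : Equiv.Perm (Fin k)) (fun i => (d i : ZMod 2)) = 0 :=
    Finset.sum_eq_zero fun i _ => Finset.sum_eq_zero fun j _ => if_neg fun h =>
      absurd h.1 h.2.not_gt
  rw [koszulSign_eq, h2, parSign_zero, one_smul]
  rfl

theorem isGradedSymm_zero {𝒱 : ℤ → Submodule ℝ V} {k : ℕ} :
    IsGradedSymm 𝒱 (fun _ : Fin k → V => (0 : N)) := by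
  intro d v _ σ
  rw [smul_zero]

end Insertion

theorem unshuffleExp_singleton {k : ℕ} (i : Fin k) (d : Fin k → ZMod 2) :
    unshuffleExp {i} d = d i * ∑ l, if l < i then d l else 0 := by
  rw [unshuffleExp, Finset.sum_eq_single i, Finset.mul_sum]
  · refine Finset.sum_congr rfl fun l _ => ?_
    by_cases h : l < i
    · rw [if_pos h, if_pos ⟨Finset.mem_singleton_self i, by simpa using h.ne, h⟩]
    · rw [if_neg h, if_neg fun h' => h h'.2.2, mul_zero]
  · intro b _ hb
    exact Finset.sum_eq_zero fun j _ => if_neg fun h => hb (by simpa using h.1)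
  · simp

theorem pairSum_cons {k : ℕ} (a b : ZMod 2) (j p : Fin k → ZMod 2) :
    pairSum (fun i l => (Fin.cons a j : Fin (k + 1) → ZMod 2) i *
      (Fin.cons b p : Fin (k + 1) → ZMod 2) l) = a * ∑ i, p i + pairSum fun i l => j i * p l := by
  simp only [pairSum, Fin.sum_univ_succ, Fin.cons_zero, Fin.cons_succ, if_false,
    Fin.succ_pos, if_true, Fin.not_lt_zero, Fin.succ_lt_succ_iff, zero_add, Finset.mul_sum]

/-! ### The Leibniz rule -/

section Leibniz

variable {n : ℕ}

/-- `τ` is a derivation of the algebra of forms of parity `t`. -/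
structure IsFormDerivation (τ : Forms n →ₗ[ℝ] Forms n) (t : ZMod 2) : Prop where
  leibniz : ∀ (p : ℕ) (α β : Forms n), α ∈ formDeg n p →
    τ (α * β) = τ α * β + parSign (t * p) • (α * τ β)
  degree : ∀ (p : ℕ) (α : Forms n), α ∈ formDeg n p → τ α = 0 ∨
    ∃ q : ℕ, (q : ZMod 2) = p + t ∧ τ α ∈ formDeg n q

theorem IsFormDerivation.map_one {τ : Forms n →ₗ[ℝ] Forms n} {t : ZMod 2}
    (h : IsFormDerivation τ t) : τ 1 = 0 := by
  have := h.leibniz 0 1 1 one_mem_formDeg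
  simpa [parSign_zero] using this

theorem IsFormDerivation.map_prod {τ : Forms n →ₗ[ℝ] Forms n} {t : ZMod 2}
    (h : IsFormDerivation τ t) {k : ℕ} (p : Fin k → ℕ) (α : Fin k → Forms n)
    (hα : ∀ i, α i ∈ formDeg n (p i)) :
    τ (List.ofFn α).prod = ∑ i, parSign (t * ∑ l, if l < i then (p l : ZMod 2) else 0) •
      (List.ofFn (Function.update α i (τ (α i)))).prod := by
  induction k with
  | zero => simp [h.map_one]
  | succ k ih =>
    rw [List.ofFn_succ, List.prod_cons, h.leibniz _ _ _ (hα 0), ih _ _ (fun i => hα i.succ),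
      Fin.sum_univ_succ]
    congr 1
    · simp only [Fin.not_lt_zero, if_false, Finset.sum_const_zero, mul_zero, parSign_zero, one_smul]
      rw [List.ofFn_succ, List.prod_cons, Function.update_self]
      congr 3
    · rw [Finset.mul_sum, Finset.smul_sum]
      refine Finset.sum_congr rfl fun i _ => ?_
      rw [mul_smul_comm, smul_smul, ← parSign_add, ← mul_add, Fin.sum_univ_succ,
        if_pos (Fin.succ_pos i)]
      simp only [Fin.succ_lt_succ_iff]
      rw [List.ofFn_succ (f := Function.update α i.succ _), List.prod_cons,
        Function.update_of_ne (Fin.succ_ne_zero i).symm]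
      congr 4
      funext a
      by_cases ha : a = i
      · subst ha; simp
      · rw [Function.update_of_ne ha, Function.update_of_ne (by simpa using ha)]

/-- The Leibniz rule with the differentiated factor brought to the front, which is the shape in
which insertions of linear vector fields appear. The parity of `τ` drops out of the sign: passing
`τ` over the earlier factors costs what is later saved by `αᵢ` having its own degree instead of that
of `τ αᵢ`. -/
theorem IsFormDerivation.map_prod_unshuffle {τ : Forms n →ₗ[ℝ] Forms n} {t : ZMod 2}
    (h : IsFormDerivation τ t) {k : ℕ} (p : Fin k → ℕ) (α : Fin k → Forms n)
    (hα : ∀ i, α i ∈ formDeg n (p i)) :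
    τ (List.ofFn α).prod = ∑ i, parSign (unshuffleExp {i} fun l => (p l : ZMod 2)) •
      (τ (α i) * (List.ofFn (sub α {i}ᶜ)).prod) := by
  rw [h.map_prod p α hα]
  refine Finset.sum_congr rfl fun i _ => ?_
  -- The contraction of a function would have degree `-1`, which is not a form degree; it is zero
  -- and both sides vanish.
  rcases h.degree _ _ (hα i) with h0 | ⟨q, hq, hτ⟩
  · rw [h0, zero_mul, smul_zero]
    have : (0 : Forms n) ∈ List.ofFn (Function.update α i 0) :=
      (List.mem_ofFn' _ _).2 ⟨i, Function.update_self ..⟩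
    rw [List.prod_eq_zero this, smul_zero]
  · have hu := ofFn_prod_unshuffle (Function.update p i q) (Function.update α i (τ (α i)))
      (fun l => by
        by_cases hl : l = i
        · subst hl; simpa using hτ
        · simpa [Function.update_of_ne hl] using hα l) {i}
    have e1 : (List.ofFn (sub (Function.update α i (τ (α i))) {i})).prod = τ (α i) := by
      rw [ofFn_sub_singleton]
      simp
    have e2 : sub (Function.update α i (τ (α i))) {i}ᶜ = sub α {i}ᶜ := by
      funext a
      refine Function.update_of_ne ?_ _ _
      exact Finset.notMem_singleton.1
        (Finset.mem_compl.1 (Finset.orderEmbOfFin_mem ({i}ᶜ : Finset (Fin k)) rfl a))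
    rw [e1, e2] at hu
    rw [hu, smul_smul, ← parSign_add]
    congr 2
    rw [unshuffleExp_singleton, unshuffleExp_singleton, Function.update_self, hq]
    have e3 : (∑ l, if l < i then ((Function.update p i q l : ℕ) : ZMod 2) else 0) =
        ∑ l, if l < i then (p l : ZMod 2) else 0 := by
      refine Finset.sum_congr rfl fun l _ => ?_
      split_ifs with hl
      · rw [Function.update_of_ne hl.ne]
      · rfl
    rw [e3]
    have e4 : ∀ t r s : ZMod 2, t * s = r * s + (r + t) * s := by decide
    exact e4 _ _ _

theorem isFormDerivation_extD : IsFormDerivation (extD n) 1 where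
  leibniz p α β hα := by
    rw [extD_mul, formInv_of_mem hα, one_mul, smul_mul_assoc]
  degree p α hα := Or.inr ⟨p + 1, by push_cast; rfl, extD_mem hα⟩

theorem isFormDerivation_contrField (ξ : Fin n → SmoothFn n) :
    IsFormDerivation (contrField ξ) 1 where
  leibniz p α β hα := by
    rw [contrField_mul, formInv_of_mem hα, one_mul, smul_mul_assoc]
  degree p α hα := by
    cases p with
    | zero => exact Or.inl (contrField_eq_zero ξ hα)
    | succ p =>
      refine Or.inr ⟨p, ?_, contrField_mem ξ hα⟩
      push_cast
      rw [add_assoc, CharTwo.add_self_eq_zero, add_zero]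

theorem isFormDerivation_lieDer (ξ : Fin n → SmoothFn n) :
    IsFormDerivation (lieDer ξ) 0 where
  leibniz p α β hα := by
    rw [lieDer_mul, zero_mul, parSign_zero, one_smul]
  degree p α hα := Or.inr ⟨p, by rw [add_zero], lieDer_mem ξ hα⟩

end Leibniz

/-! ### Linear vector fields on the space of fields. -/

section LinearVectorFields

variable {n : ℕ} {L : Type*} [AddCommGroup L] [Module ℝ L] {𝓛 : ℤ → Submodule ℝ L}

theorem linVF_degree {T : Fields n L →ₗ[ℝ] Fields n L} {t : ℤ}
    (hT : ∀ (a : ℤ) (A : Fields n L), A ∈ fieldDeg n 𝓛 a → T A ∈ fieldDeg n 𝓛 (a + t))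
    (k : ℕ) (d : Fin k → ℤ) (e : Fin k → Fields n L) (he : IsHomog (fieldDeg n 𝓛) d e) :
    linVF T k e ∈ fieldDeg n 𝓛 (∑ i, d i + t) := by
  by_cases hk : k = 1
  · subst hk
    rw [linVF_one, Fin.sum_univ_one]
    exact hT _ _ (he 0)
  · rw [linVF_of_ne T hk]
    exact zero_mem _

theorem linVF_symm (T : Fields n L →ₗ[ℝ] Fields n L) (k : ℕ) :
    IsGradedSymm (fieldDeg n 𝓛) (linVF T k) := by
  by_cases hk : k ≤ 1
  · exact isGradedSymm_of_subsingleton hk _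
  · rw [linVF_of_ne T (by omega)]
    exact isGradedSymm_zero

end LinearVectorFields

/-! ### The extended brackets: Jacobi identities and commutation with derivations of forms. -/

section Brackets

variable {n : ℕ} {L : Type*} [AddCommGroup L] [Module ℝ L]
  {𝓛 : ℤ → Submodule ℝ L} [DirectSum.Decomposition 𝓛] (C : CyclicLInfty n 𝓛)

/-- The brackets of `L` extended to the fields. -/
def bracketVF : VField n L := fun k =>
  (onFields (formInv n)).compMultilinearMap (wedgeExtend 𝓛 (C.q k))

theorem aksz_eq : aksz C = bracketVF C + linVF (onFields (extD n)) := by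
  funext k
  match k with
  | 0 => rfl
  | 1 => rfl
  | k + 2 => rfl

theorem bracketVF_tmul {k : ℕ} (p : Fin k → ℕ) (j : Fin k → ℤ) (α : Fin k → Forms n) (x : Fin k → L)
    (hα : ∀ i, α i ∈ formDeg n (p i)) (hx : IsHomog (shift 𝓛) j x) :
    bracketVF C k (fun i => α i ⊗ₜ x i) =
      parSign (∑ i, (p i : ZMod 2) + pairSum fun i l => (j i : ZMod 2) * p l) •
        ((List.ofFn α).prod ⊗ₜ[ℝ] C.q k x) := by
  rw [bracketVF, LinearMap.compMultilinearMap_apply, wedgeExtend_tmul (C.q k) p j α x hα hx,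
    map_smul, onFields_tmul, formInv_of_mem (ofFn_prod_mem p α hα), ← TensorProduct.smul_tmul',
    smul_smul, ← parSign_add, add_comm]
  push_cast
  rfl

/-- Separates the first argument, because in an insertion that slot holds the inner value, whose
form factor is itself a product. -/
theorem bracketVF_cons {k : ℕ} {r : ℕ} {m : ℤ} {β : Forms n} {y : L} (hβ : β ∈ formDeg n r)
    (hy : y ∈ shift 𝓛 m) (p : Fin k → ℕ) (j : Fin k → ℤ) (α : Fin k → Forms n) (x : Fin k → L)
    (hα : ∀ i, α i ∈ formDeg n (p i)) (hx : IsHomog (shift 𝓛) j x) :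
    bracketVF C (k + 1) (Fin.cons (β ⊗ₜ y) (fun i => α i ⊗ₜ x i)) =
      parSign (r + ∑ i, (p i : ZMod 2) + m * ∑ i, (p i : ZMod 2) +
        pairSum fun i l => (j i : ZMod 2) * p l) •
        ((β * (List.ofFn α).prod) ⊗ₜ[ℝ] C.q (k + 1) (Fin.cons y x)) := by
  have h := bracketVF_tmul C (Fin.cons r p : Fin (k + 1) → ℕ) (Fin.cons m j : Fin (k + 1) → ℤ)
    (Fin.cons β α : Fin (k + 1) → Forms n) (Fin.cons y x : Fin (k + 1) → L)
    (fun i => Fin.cases hβ (fun i => hα i) i) (isHomog_cons hy hx)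
  have e1 : (Fin.cons (β ⊗ₜ[ℝ] y) (fun i => α i ⊗ₜ[ℝ] x i) : Fin (k + 1) → Fields n L) =
      fun i => (Fin.cons β α : Fin (k + 1) → Forms n) i ⊗ₜ[ℝ] (Fin.cons y x : Fin (k + 1) → L) i := by
    funext i
    refine Fin.cases ?_ (fun i => ?_) i <;> simp
  have e2 : (fun i => (((Fin.cons m j : Fin (k + 1) → ℤ) i : ℤ) : ZMod 2)) =
      Fin.cons (m : ZMod 2) (fun i => (j i : ZMod 2)) := by
    funext i
    refine Fin.cases ?_ (fun i => ?_) i <;> simp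
  have e3 : (fun i => (((Fin.cons r p : Fin (k + 1) → ℕ) i : ℕ) : ZMod 2)) =
      Fin.cons (r : ZMod 2) (fun i => (p i : ZMod 2)) := by
    funext i
    refine Fin.cases ?_ (fun i => ?_) i <;> simp
  have e4 := pairSum_cons (m : ZMod 2) (r : ZMod 2) (fun i => (j i : ZMod 2))
    (fun i => (p i : ZMod 2))
  rw [← e2, ← e3] at e4
  rw [e1, h, e4, Fin.sum_univ_succ, List.ofFn_succ, List.prod_cons]
  simp only [Fin.cons_zero, Fin.cons_succ]
  congr 2
  ring

theorem bracketVF_symm (k : ℕ) : IsGradedSymm (fieldDeg n 𝓛) (bracketVF C k) := by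
  intro d v hv σ
  have h := wedgeExtend_symm (n := n) (C.q_symm k) d v hv σ
  rw [bracketVF, LinearMap.compMultilinearMap_apply, h, map_smul]
  rfl

theorem formInv_mem {p : ℕ} {α : Forms n} (hα : α ∈ formDeg n p) : formInv n α ∈ formDeg n p := by
  rw [formInv_of_mem hα]; exact Submodule.smul_mem _ _ hα

theorem bracketVF_degree (k : ℕ) (d : Fin k → ℤ) (e : Fin k → Fields n L)
    (he : IsHomog (fieldDeg n 𝓛) d e) : bracketVF C k e ∈ fieldDeg n 𝓛 (∑ i, d i + 1) := by
  have h := wedgeExtend_mem (n := n) (C.q_degree k) he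
  have h2 := onFields_mem_fieldDeg (T := formInv n) (t := 0)
    (fun p α hα => Or.inr ⟨p, by ring, formInv_mem hα⟩) h
  rwa [add_zero] at h2

theorem sub_tmul {k : ℕ} (α : Fin k → Forms n) (x : Fin k → L) (T : Finset (Fin k)) :
    sub (fun i => α i ⊗ₜ[ℝ] x i) T = fun a => sub α T a ⊗ₜ[ℝ] sub x T a := rfl

theorem cast_sum_sub {k : ℕ} (j : Fin k → ℤ) (T : Finset (Fin k)) :
    ((∑ i, sub j T i : ℤ) : ZMod 2) = ∑ i ∈ T, (j i : ZMod 2) := by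
  rw [sum_sub, Int.cast_sum]

theorem sum_cast_sub {k : ℕ} (p : Fin k → ℕ) (T : Finset (Fin k)) :
    ∑ i, ((sub p T i : ℕ) : ZMod 2) = ∑ i ∈ T, (p i : ZMod 2) :=
  sum_sub (fun i => (p i : ZMod 2)) T

/-- On pure tensors each unshuffle yields the same form, the product of all `αᵢ`, with a sign
independent of the unshuffle, tensored with the corresponding term of the Jacobi identity of `L`. -/
theorem insertion_bracketVF_self {k : ℕ} {d : Fin k → ℤ} {v : Fin k → Fields n L}
    (hv : IsHomog (fieldDeg n 𝓛) d v) :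
    insertion (fun k => ⇑(bracketVF C k)) (fun k => ⇑(bracketVF C k)) d v = 0 := by
  rw [insertion_eq]
  refine multilinear_ext_homog (ψ := 0) ?_ hv
  intro p j α x hα hx hd
  rw [← insertion_eq, _root_.zero_apply]
  have hd' : (fun i => ((d i : ℤ) : ZMod 2)) = fun i => (p i : ZMod 2) + (j i : ZMod 2) :=
    funext fun i => by rw [← hd i]; push_cast; rfl
  have key : ∀ T : Finset (Fin k), unshuffleSign T d • bracketVF C (Tᶜ.card + 1)
      (Fin.cons (bracketVF C T.card (sub (fun i => α i ⊗ₜ[ℝ] x i) T))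
        (sub (fun i => α i ⊗ₜ[ℝ] x i) Tᶜ)) =
      parSign (pairSum fun i l => (j i : ZMod 2) * p l) • ((List.ofFn α).prod ⊗ₜ[ℝ]
        (unshuffleSign T j • C.q (Tᶜ.card + 1) (Fin.cons (C.q T.card (sub x T)) (sub x Tᶜ)))) := by
    intro T
    have hβ := ofFn_prod_mem (sub p T) (sub α T) (fun i => hα _)
    have hy := C.q_degree T.card (sub j T) (sub x T) (isHomog_sub hx T)
    rw [sub_tmul, sub_tmul, bracketVF_tmul C (sub p T) (sub j T) (sub α T) (sub x T)
      (fun i => hα _) (isHomog_sub hx T), TensorProduct.smul_tmul',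
      bracketVF_cons C (Submodule.smul_mem _ _ hβ) hy (sub p Tᶜ) (sub j Tᶜ)
      (sub α Tᶜ) (sub x Tᶜ) (fun i => hα _) (isHomog_sub hx Tᶜ), smul_mul_assoc,
      ofFn_prod_unshuffle p α hα T, unshuffleSign_eq, unshuffleSign_eq, TensorProduct.tmul_smul,
      hd']
    simp only [← TensorProduct.smul_tmul', smul_smul]
    congr 1
    simp only [← parSign_add]
    congr 1
    rw [unshuffleExp_add T (fun i => (j i : ZMod 2)) (fun i => (p i : ZMod 2))]
    push_cast
    have e1 := cast_sum_sub j T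
    push_cast at e1
    rw [sum_cast_sub, sum_cast_sub, e1]
    have e2 : (pairSum fun i l => sub (fun i => (j i : ZMod 2)) T i * sub (fun i => (p i : ZMod 2)) T l) =
      pairSum fun i l => ((sub j T i : ℤ) : ZMod 2) * ((sub p T l : ℕ) : ZMod 2) := rfl
    have e3 : (pairSum fun i l => sub (fun i => (j i : ZMod 2)) Tᶜ i * sub (fun i => (p i : ZMod 2)) Tᶜ l) =
      pairSum fun i l => ((sub j Tᶜ i : ℤ) : ZMod 2) * ((sub p Tᶜ l : ℕ) : ZMod 2) := rfl
    rw [e2, e3]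
    ring_nf
    simp only [CharTwo.two_eq_zero, mul_zero, add_zero]
  rw [insertion]
  simp only [key]
  rw [← Finset.smul_sum, ← TensorProduct.tmul_sum]
  have hj := C.q_jacobi k j x hx
  rw [insertion] at hj
  rw [hj, TensorProduct.tmul_zero, smul_zero]

/-- A derivation of the forms acts as a derivation of the extended brackets: the sum over the
position hit by `τ` is its Leibniz rule on the product of forms, and the prefactor is the sign of
moving `τ` past a bracket of degree one. -/
theorem insertion_bracketVF_linVF {τ : Forms n →ₗ[ℝ] Forms n} {t : ZMod 2}
    (hτ : IsFormDerivation τ t) {k : ℕ} {d : Fin k → ℤ} {v : Fin k → Fields n L}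
    (hv : IsHomog (fieldDeg n 𝓛) d v) :
    insertion (fun k => ⇑(bracketVF C k)) (fun k => ⇑(linVF (onFields (L := L) τ) k)) d v =
      parSign t • onFields τ (bracketVF C k v) := by
  rw [insertion_eq]
  refine multilinear_ext_homog
    (ψ := (parSign t • onFields (L := L) τ).compMultilinearMap (bracketVF C k)) ?_ hv
  intro p j α x hα hx hd
  rw [← insertion_eq, insertion_linVF_right, LinearMap.compMultilinearMap_apply,
    LinearMap.smul_apply, bracketVF_tmul C p j α x hα hx, map_smul, onFields_tmul,
    hτ.map_prod_unshuffle p α hα, TensorProduct.sum_tmul, Finset.smul_sum, Finset.smul_sum]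
  refine Finset.sum_congr rfl fun i _ => ?_
  have hd' : (fun i => ((d i : ℤ) : ZMod 2)) = fun i => (p i : ZMod 2) + (j i : ZMod 2) :=
    funext fun i => by rw [← hd i]; push_cast; rfl
  rw [onFields_tmul, sub_tmul]
  rcases hτ.degree _ _ (hα i) with h0 | ⟨r, hr, hβ⟩
  · rw [h0, TensorProduct.zero_tmul, zero_mul, smul_zero, TensorProduct.zero_tmul,
      (bracketVF C _).map_coord_zero (0 : Fin (({i} : Finset (Fin k))ᶜ.card + 1))
        (Fin.cons_zero _ _), smul_zero, smul_zero, smul_zero]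
  · rw [bracketVF_cons C hβ (hx i) (sub p {i}ᶜ) (sub j {i}ᶜ) (sub α {i}ᶜ) (sub x {i}ᶜ)
      (fun _ => hα _) (isHomog_sub hx _),
      isGradedSymm_singleton (X := fun k => ⇑(C.q k)) C.q_symm hx i, unshuffleSign_eq,
      unshuffleSign_eq, hd', TensorProduct.tmul_smul]
    simp only [← TensorProduct.smul_tmul', smul_smul]
    congr 1
    simp only [← parSign_add]
    congr 1
    rw [unshuffleExp_add {i} (fun i => (j i : ZMod 2)) (fun i => (p i : ZMod 2)), sum_cast_sub, hr]
    have e2 : (pairSum fun a l => sub (fun i => (j i : ZMod 2)) {i} a *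
        sub (fun i => (p i : ZMod 2)) {i} l) = 0 := by
      have : Subsingleton (Fin ({i} : Finset (Fin k)).card) :=
        Fin.subsingleton_iff_le_one.2 (by simp)
      refine Finset.sum_eq_zero fun a _ => Finset.sum_eq_zero fun b _ => if_neg ?_
      rw [Subsingleton.elim a b]
      exact lt_irrefl b
    have e3 : (pairSum fun a l => sub (fun i => (j i : ZMod 2)) {i}ᶜ a *
        sub (fun i => (p i : ZMod 2)) {i}ᶜ l) =
      pairSum fun a l => ((sub j {i}ᶜ a : ℤ) : ZMod 2) * ((sub p {i}ᶜ l : ℕ) : ZMod 2) := rfl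
    have e4 : ∑ l, (p l : ZMod 2) = p i + ∑ l ∈ ({i} : Finset (Fin k))ᶜ, (p l : ZMod 2) := by
      rw [← Finset.sum_add_sum_compl {i}, Finset.sum_singleton]
    rw [e2, e3, e4, Finset.sum_singleton]
    ring_nf
    simp only [CharTwo.two_eq_zero, mul_zero, add_zero]

end Brackets

/-! ### Differential operators -/

section DiffOpLemmas

variable {R M N P : Type*} [CommRing R] [Algebra ℝ R]
  [AddCommGroup M] [Module ℝ M] [Module R M] [IsScalarTower ℝ R M]
  [AddCommGroup N] [Module ℝ N] [Module R N] [IsScalarTower ℝ R N]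
  [AddCommGroup P] [Module ℝ P] [Module R P] [IsScalarTower ℝ R P]

theorem isDiffOp_zero (r : ℕ) : IsDiffOp R r (0 : M →ₗ[ℝ] N) := by
  induction r with
  | zero => intro f m; simp
  | succ r ih =>
    intro f
    rw [LinearMap.zero_comp, LinearMap.comp_zero, sub_zero]
    exact ih

theorem IsDiffOp.add {r : ℕ} {D D' : M →ₗ[ℝ] N} (h : IsDiffOp R r D) (h' : IsDiffOp R r D') :
    IsDiffOp R r (D + D') := by
  induction r generalizing D D' with
  | zero => intro f m; rw [LinearMap.add_apply, h f m, h' f m, LinearMap.add_apply, smul_add]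
  | succ r ih =>
    intro f
    rw [LinearMap.add_comp, LinearMap.comp_add, add_sub_add_comm]
    exact ih (h f) (h' f)

theorem IsDiffOp.comp_left {r : ℕ} {D : M →ₗ[ℝ] N} (h : IsDiffOp R r D) {φ : N →ₗ[ℝ] P}
    (hφ : ∀ (f : R) (m : N), φ (f • m) = f • φ m) : IsDiffOp R r (φ.comp D) := by
  induction r generalizing D with
  | zero => intro f m; rw [LinearMap.comp_apply, h f m, hφ, LinearMap.comp_apply]
  | succ r ih =>
    intro f
    have : (φ.comp D).comp (Algebra.lsmul ℝ ℝ M f) - (Algebra.lsmul ℝ ℝ P f).comp (φ.comp D) =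
        φ.comp (D.comp (Algebra.lsmul ℝ ℝ M f) - (Algebra.lsmul ℝ ℝ N f).comp D) := by
      ext m
      simp [hφ]
    rw [this]
    exact ih (h f)

theorem IsDiffOp.smul {r : ℕ} {D : M →ₗ[ℝ] N} (h : IsDiffOp R r D) (c : ℝ) :
    IsDiffOp R r (c • D) := by
  have := h.comp_left (φ := c • (LinearMap.id : N →ₗ[ℝ] N)) fun f m => by
    exact (smul_algebra_smul_comm c f m).symm
  rwa [LinearMap.smul_comp, LinearMap.id_comp] at this

theorem IsDiffOp.succ {r : ℕ} {D : M →ₗ[ℝ] N} (h : IsDiffOp R r D) : IsDiffOp R (r + 1) D := by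
  induction r generalizing D with
  | zero =>
    intro f
    have : D.comp (Algebra.lsmul ℝ ℝ M f) - (Algebra.lsmul ℝ ℝ N f).comp D = 0 := by
      ext m
      simp [h f m]
    rw [this]
    exact isDiffOp_zero 0
  | succ r ih => exact fun f => ih (h f)

theorem IsDiffOp.mono {r s : ℕ} (hrs : r ≤ s) {D : M →ₗ[ℝ] N} (h : IsDiffOp R r D) :
    IsDiffOp R s D := by
  induction hrs with
  | refl => exact h
  | step _ ih => exact ih.succ

variable {k : ℕ}

theorem isPolyDiff_zero : IsPolyDiff R (0 : MultilinearMap ℝ (fun _ : Fin k => M) N) :=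
  ⟨0, fun _ _ => isDiffOp_zero 0⟩

theorem IsPolyDiff.add {D D' : MultilinearMap ℝ (fun _ : Fin k => M) N} (h : IsPolyDiff R D)
    (h' : IsPolyDiff R D') : IsPolyDiff R (D + D') := by
  obtain ⟨r, hr⟩ := h
  obtain ⟨s, hs⟩ := h'
  exact ⟨max r s, fun e i => ((hr e i).mono (le_max_left r s)).add
    ((hs e i).mono (le_max_right r s))⟩

theorem isPolyDiff_linVF {r : ℕ} {D : M →ₗ[ℝ] M} (h : IsDiffOp R r D) (k : ℕ) :
    IsPolyDiff R (linVF D k) := by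
  by_cases hk : k = 1
  · subst hk
    refine ⟨r, fun e i => ?_⟩
    have : (linVF D 1).toLinearMap e i = D := by
      ext m
      rw [Subsingleton.elim i 0, MultilinearMap.toLinearMap_apply, linVF_one, Function.update_self]
    rwa [this]
  · rw [linVF_of_ne D hk]
    exact isPolyDiff_zero

/-- A multilinear map paired with one more argument, linearly over the algebra. -/
theorem IsPolyDiff.uncurryRight {X : MultilinearMap ℝ (fun _ : Fin k => M) N} (hX : IsPolyDiff R X)
    {φ : N →ₗ[ℝ] M →ₗ[ℝ] P} (h1 : ∀ (f : R) (a : N) (b : M), φ (f • a) b = f • φ a b)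
    (h2 : ∀ (f : R) (a : N) (b : M), φ a (f • b) = f • φ a b) :
    IsPolyDiff R (φ.compMultilinearMap X).uncurryRight := by
  obtain ⟨r, hr⟩ := hX
  refine ⟨r, fun e i => ?_⟩
  refine Fin.lastCases ?_ (fun i => ?_) i
  · refine IsDiffOp.mono (Nat.zero_le r) fun f m => ?_
    simp only [MultilinearMap.toLinearMap_apply, MultilinearMap.uncurryRight_apply,
      Fin.init_update_last, Function.update_self]
    exact h2 _ _ _
  · have : (φ.compMultilinearMap X).uncurryRight.toLinearMap e i.castSucc =
        (φ.flip (e (Fin.last k))).comp (X.toLinearMap (Fin.init e) i) := by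
      ext m
      simp only [MultilinearMap.toLinearMap_apply, MultilinearMap.uncurryRight_apply,
        Fin.init_update_castSucc, LinearMap.comp_apply, LinearMap.flip_apply,
        LinearMap.compMultilinearMap_apply]
      rw [Function.update_of_ne (Fin.castSucc_lt_last i).ne']
    rw [this]
    exact (hr _ i).comp_left fun f m => h1 f m _

end DiffOpLemmas

/-! ### Locality of the operators and of the extended brackets. -/

section FieldOperators

variable {n : ℕ} {L : Type*} [AddCommGroup L] [Module ℝ L]

theorem onFields_mulLeft_smul (β : Forms n) (g : SmoothFn n) (A : Fields n L) :
    onFields (LinearMap.mulLeft ℝ β) (g • A) = g • onFields (LinearMap.mulLeft ℝ β) A :=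
  onFields_smul (fun g α => by
    rw [LinearMap.mulLeft_apply, forms_mul_smul, LinearMap.mulLeft_apply]) g A

/-- The commutator with `g` is multiplication by a form, hence linear over the smooth functions,
hence of order zero. -/
theorem isDiffOp_of_symbol {T : Forms n →ₗ[ℝ] Forms n} (σ : SmoothFn n → Forms n)
    (h : ∀ g α, T (g • α) = σ g * α + g • T α) :
    IsDiffOp (SmoothFn n) 1 (onFields (L := L) T) := by
  intro g
  have : (onFields (L := L) T).comp (Algebra.lsmul ℝ ℝ (Fields n L) g) -
      (Algebra.lsmul ℝ ℝ (Fields n L) g).comp (onFields T) =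
      onFields (LinearMap.mulLeft ℝ (σ g)) := by
    refine TensorProduct.ext' fun α x => ?_
    rw [LinearMap.sub_apply, LinearMap.comp_apply, LinearMap.comp_apply, Algebra.lsmul_coe]
    beta_reduce
    rw [fields_smul_tmul, onFields_tmul, onFields_tmul, fields_smul_tmul, h,
      TensorProduct.add_tmul, add_sub_cancel_right, onFields_tmul, LinearMap.mulLeft_apply]
  rw [this]
  exact onFields_mulLeft_smul _

theorem isDiffOp_extD : IsDiffOp (SmoothFn n) 1 (onFields (L := L) (extD n)) :=
  isDiffOp_of_symbol _ extD_smul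

theorem isDiffOp_lieDer (ξ : Fin n → SmoothFn n) :
    IsDiffOp (SmoothFn n) 1 (onFields (L := L) (lieDer ξ)) :=
  isDiffOp_of_symbol _ (lieDer_smul ξ)

theorem isDiffOp_contrField (ξ : Fin n → SmoothFn n) :
    IsDiffOp (SmoothFn n) 1 (onFields (L := L) (contrField ξ)) :=
  IsDiffOp.succ (r := 0) (onFields_smul (contrField_smul ξ))

theorem tensorMultilinear_smul {N : Type*} [AddCommGroup N] [Module ℝ N] {k : ℕ}
    {f : MultilinearMap ℝ (fun _ : Fin k => Forms n) (Forms n)} {g : SmoothFn n} {i : Fin k}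
    (hf : ∀ a, f (Function.update a i (g • a i)) = g • f a)
    (h : MultilinearMap ℝ (fun _ : Fin k => L) N) (v : Fin k → Fields n L) :
    tensorMultilinear (Forms n) (Forms n) L N k f h (Function.update v i (g • v i)) =
      g • tensorMultilinear (Forms n) (Forms n) L N k f h v := by
  let F := tensorMultilinear (Forms n) (Forms n) L N k f h
  -- The map `s` multiplies slot `i` by `g` and fixes the others, so both sides become multilinear
  -- in `v` and can be compared on pure tensors.
  let s : Fin k → Fields n L →ₗ[ℝ] Fields n L := Function.update (fun _ => LinearMap.id) i
    (Algebra.lsmul ℝ ℝ (Fields n L) g)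
  have hs : ∀ v : Fin k → Fields n L, (fun l => s l (v l)) = Function.update v i (g • v i) := by
    intro v
    funext l
    by_cases hl : l = i
    · subst hl
      simp only [s, Function.update_self]
      rfl
    · simp only [s, Function.update_of_ne hl]
      rfl
  have key := multilinear_eq_zero_of_span (F.compLinearMap s -
    LinearMap.compMultilinearMap (Algebra.lsmul ℝ ℝ (Forms n ⊗[ℝ] N) g) F)
    (fun _ => {t | ∃ α x, α ⊗ₜ[ℝ] x = t}) ?_ v
    (fun i => by rw [TensorProduct.span_tmul_eq_top]; trivial)
  · rw [_root_.sub_apply, sub_eq_zero, MultilinearMap.compLinearMap_apply, hs] at key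
    exact key
  · intro v hv
    choose α x hv using hv
    obtain rfl : (fun i => α i ⊗ₜ[ℝ] x i) = v := funext hv
    rw [_root_.sub_apply, sub_eq_zero, MultilinearMap.compLinearMap_apply, hs]
    have e : Function.update (fun i => α i ⊗ₜ[ℝ] x i) i (g • (α i ⊗ₜ[ℝ] x i)) =
        fun l => Function.update α i (g • α i) l ⊗ₜ[ℝ] x l := by
      funext l
      by_cases hl : l = i
      · subst hl
        rw [Function.update_self, Function.update_self, fields_smul_tmul]
      · rw [Function.update_of_ne hl, Function.update_of_ne hl]
    rw [e]
    refine (tensorMultilinear_tmul k f h _ x).trans ?_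
    rw [hf, ← fields_smul_tmul]
    exact congrArg (g • ·) (tensorMultilinear_tmul k f h α x).symm

theorem wedgeExtend_smul {𝓛 : ℤ → Submodule ℝ L} [DirectSum.Decomposition 𝓛] {N : Type*}
    [AddCommGroup N] [Module ℝ N] {k : ℕ} (f : MultilinearMap ℝ (fun _ : Fin k => L) N)
    (v : Fin k → Fields n L) (i : Fin k) (g : SmoothFn n) :
    wedgeExtend 𝓛 f (Function.update v i (g • v i)) = g • wedgeExtend 𝓛 f v := by
  rw [wedgeExtend, _root_.sum_apply, _root_.sum_apply, Finset.smul_sum]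
  refine Finset.sum_congr rfl fun p _ => tensorMultilinear_smul (fun a => ?_) _ v
  rw [MultilinearMap.compLinearMap_apply, MultilinearMap.compLinearMap_apply]
  have e : (fun l => (formInv n ^ ∑ i ∈ Finset.univ.filter (fun i => i < l), (p i).val)
      (Function.update a i (g • a i) l)) = Function.update
      (fun l => (formInv n ^ ∑ i ∈ Finset.univ.filter (fun i => i < l), (p i).val) (a l)) i
      (g • (formInv n ^ ∑ l ∈ Finset.univ.filter (fun l => l < i), (p l).val) (a i)) := by
    funext l
    by_cases hl : l = i
    · subst hl
      rw [Function.update_self, Function.update_self, formInv_pow_smul]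
    · rw [Function.update_of_ne hl, Function.update_of_ne hl]
  rw [e]
  -- The product of forms is multilinear over the smooth functions, not only over the reals.
  have := (MultilinearMap.mkPiAlgebraFin (SmoothFn n) k (Forms n)).map_update_smul
    (fun l => (formInv n ^ ∑ i ∈ Finset.univ.filter (fun i => i < l), (p i).val) (a l)) i g
    ((formInv n ^ ∑ l ∈ Finset.univ.filter (fun l => l < i), (p l).val) (a i))
  rw [Function.update_eq_self] at this
  exact this

section VectorFields

variable {𝓛 : ℤ → Submodule ℝ L}

theorem IsVectorField.add {m : ℤ} {X Y : VField n L} (hX : IsVectorField 𝓛 m X)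
    (hY : IsVectorField 𝓛 m Y) : IsVectorField 𝓛 m (X + Y) where
  symm k d v hv σ := by
    have h1 := hX.symm k d v hv σ
    have h2 := hY.symm k d v hv σ
    change X k v + Y k v = koszulSign σ d • (X k (fun i => v (σ i)) + Y k (fun i => v (σ i)))
    rw [h1, h2, smul_add]
  degree k d e he := add_mem (hX.degree k d e he) (hY.degree k d e he)
  isLocal k := (hX.isLocal k).add (hY.isLocal k)

theorem isVectorField_linVF {T : Fields n L →ₗ[ℝ] Fields n L} {t : ℤ} {r : ℕ}
    (hT : ∀ (a : ℤ) (A : Fields n L), A ∈ fieldDeg n 𝓛 a → T A ∈ fieldDeg n 𝓛 (a + t))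
    (hr : IsDiffOp (SmoothFn n) r T) : IsVectorField 𝓛 t (linVF T) :=
  ⟨linVF_symm T, linVF_degree hT, isPolyDiff_linVF hr⟩

end VectorFields

/-! ### Locality and supports of the brackets and of `Q`. -/

section Brackets

variable {𝓛 : ℤ → Submodule ℝ L} [DirectSum.Decomposition 𝓛] (C : CyclicLInfty n 𝓛)

theorem bracketVF_smul {k : ℕ} (v : Fin k → Fields n L) (i : Fin k) (g : SmoothFn n) :
    bracketVF C k (Function.update v i (g • v i)) = g • bracketVF C k v := by
  rw [bracketVF, LinearMap.compMultilinearMap_apply, wedgeExtend_smul,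
    onFields_smul (fun g α => formInv_smul g α)]
  rfl

theorem isPolyDiff_bracketVF (k : ℕ) : IsPolyDiff (SmoothFn n) (bracketVF C k) := by
  refine ⟨0, fun e i g A => ?_⟩
  have := bracketVF_smul C (Function.update e i A) i g
  rwa [Function.update_idem, Function.update_self] at this

/-- Linearity over the smooth functions in the first slot already forces compact support. Without a
slot this argument is unavailable, which is why `q 0 = 0` is invoked separately for constant terms.
-/
theorem bracketVF_mem_compactFields {k : ℕ} (hk : k ≠ 0) {v : Fin k → Fields n L}
    (hv : ∀ i, v i ∈ compactFields n L) : bracketVF C k v ∈ compactFields n L := by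
  have h := compactFields_map (K := compactFields n L)
    (φ := (bracketVF C k).toLinearMap v ⟨0, Nat.pos_of_ne_zero hk⟩)
    (fun _ A hf => smul_mem_compactFields hf A) (fun g A => ?_) (hv ⟨0, Nat.pos_of_ne_zero hk⟩)
  · rwa [MultilinearMap.toLinearMap_apply, Function.update_eq_self] at h
  · have := bracketVF_smul C (Function.update v ⟨0, Nat.pos_of_ne_zero hk⟩ A)
      ⟨0, Nat.pos_of_ne_zero hk⟩ g
    rwa [Function.update_idem, Function.update_self] at this

theorem isVectorField_bracketVF : IsVectorField 𝓛 1 (bracketVF C) :=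
  ⟨bracketVF_symm C, bracketVF_degree C, isPolyDiff_bracketVF C⟩

theorem isVectorField_aksz : IsVectorField 𝓛 1 (aksz C) := by
  rw [aksz_eq]
  exact (isVectorField_bracketVF C).add (isVectorField_linVF
    (fun a A hA => onFields_mem_fieldDeg extD_degree hA) isDiffOp_extD)

end Brackets

end FieldOperators

/-! ### The action of the isometry algebra -/

section IsoAction

variable {n : ℕ}

theorem contrField_add (ξ η : Fin n → SmoothFn n) :
    contrField (ξ + η) = contrField ξ + contrField η := by
  rw [contrField, contrField, contrField, ← Finset.sum_add_distrib]
  refine Finset.sum_congr rfl fun i _ => ?_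
  rw [← TensorProduct.map_add_left]
  congr 1
  exact LinearMap.ext fun f => add_mul (ξ i) (η i) f

theorem contrField_real_smul (c : ℝ) (ξ : Fin n → SmoothFn n) :
    contrField (c • ξ) = c • contrField ξ := by
  rw [contrField, contrField, Finset.smul_sum]
  refine Finset.sum_congr rfl fun i _ => ?_
  rw [← TensorProduct.map_smul_left]
  congr 1
  refine LinearMap.ext fun f => ?_
  exact smul_mul_assoc c (ξ i) f

theorem lieDer_add (ξ η : Fin n → SmoothFn n) : lieDer (ξ + η) = lieDer ξ + lieDer η := by
  refine LinearMap.ext fun α => ?_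
  rw [LinearMap.add_apply, ← cartan, ← cartan, ← cartan, contrField_add, LinearMap.add_apply,
    LinearMap.add_apply, map_add]
  abel

theorem lieDer_real_smul (c : ℝ) (ξ : Fin n → SmoothFn n) :
    lieDer (c • ξ) = c • lieDer ξ := by
  refine LinearMap.ext fun α => ?_
  rw [LinearMap.smul_apply, ← cartan, ← cartan, contrField_real_smul, LinearMap.smul_apply,
    LinearMap.smul_apply, map_smul, smul_add]

theorem isoField_add (M N : iso n) : isoField (M + N) = isoField M + isoField N := by
  funext i
  refine SmoothFn.ext fun x => ?_
  change -(∑ j, (M.1 + N.1) (.inl i) (.inl j) * x j + (M.1 + N.1) (.inl i) (.inr ())) =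
    -(∑ j, M.1 (.inl i) (.inl j) * x j + M.1 (.inl i) (.inr ())) +
    -(∑ j, N.1 (.inl i) (.inl j) * x j + N.1 (.inl i) (.inr ()))
  simp only [Matrix.add_apply, add_mul, Finset.sum_add_distrib]
  ring

theorem isoField_smul (c : ℝ) (M : iso n) : isoField (c • M) = c • isoField M := by
  funext i
  refine SmoothFn.ext fun x => ?_
  change -(∑ j, (c • M.1) (.inl i) (.inl j) * x j + (c • M.1) (.inl i) (.inr ())) =
    c * -(∑ j, M.1 (.inl i) (.inl j) * x j + M.1 (.inl i) (.inr ()))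
  simp only [Matrix.smul_apply, smul_eq_mul, mul_assoc, ← Finset.mul_sum]
  ring

theorem iso_lie (M N : iso n) : (⁅M, N⁆ : iso n).1 = M.1 * N.1 - N.1 * M.1 := rfl

theorem partialD_isoField (M : iso n) (i j : Fin n) :
    partialD i (isoField M j) = algebraMap ℝ (SmoothFn n) (-M.1 (.inl j) (.inl i)) := by
  refine SmoothFn.ext fun x => ?_
  change fderiv ℝ (fun x : Rn n => -(∑ l, M.1 (.inl j) (.inl l) * x l + M.1 (.inl j) (.inr ()))) x
    (stdVec i) = -M.1 (.inl j) (.inl i)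
  have h : HasFDerivAt (fun x : Rn n =>
      -(∑ l, M.1 (.inl j) (.inl l) * x l + M.1 (.inl j) (.inr ())))
      (-(∑ l, M.1 (.inl j) (.inl l) • (EuclideanSpace.proj l : Rn n →L[ℝ] ℝ))) x := by
    refine HasFDerivAt.neg (HasFDerivAt.add_const _ (HasFDerivAt.fun_sum fun l _ => ?_))
    exact ((EuclideanSpace.proj l : Rn n →L[ℝ] ℝ).hasFDerivAt).const_mul _
  rw [h.fderiv]
  simp [stdVec]

/-- The fields are affine with constant derivatives, so this is the commutator of affine maps; the
vanishing last row of the matrices removes the remaining entries of the products, and the minus sign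
in `isoField` prevents an antihomomorphism. -/
theorem isoField_lie (M N : iso n) :
    isoField ⁅M, N⁆ = fieldBracket (isoField M) (isoField N) := by
  funext j
  refine SmoothFn.ext fun x => ?_
  have e : ∀ (f : Fin n → SmoothFn n), (∑ i, f i).fn x = ∑ i, (f i).fn x := fun f =>
    map_sum (AddMonoidHom.mk' (fun g : SmoothFn n => g.fn x) fun _ _ => rfl) f Finset.univ
  simp only [fieldBracket, partialD_isoField]
  rw [e]
  change -(∑ l, (⁅M, N⁆ : iso n).1 (.inl j) (.inl l) * x l + (⁅M, N⁆ : iso n).1 (.inl j) (.inr ())) =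
    ∑ i, (-(∑ l, M.1 (.inl i) (.inl l) * x l + M.1 (.inl i) (.inr ())) * -N.1 (.inl j) (.inl i) -
      -(∑ l, N.1 (.inl i) (.inl l) * x l + N.1 (.inl i) (.inr ())) * -M.1 (.inl j) (.inl i))
  have hM : M.1 (.inr ()) = 0 := funext M.2.2
  have hN : N.1 (.inr ()) = 0 := funext N.2.2
  simp only [iso_lie, Matrix.sub_apply, Matrix.mul_apply, Fintype.sum_sum_type, hM, hN,
    Finset.univ_unique, Finset.sum_singleton, Pi.zero_apply, mul_zero, add_zero,
    PUnit.default_eq_unit, sub_mul, Finset.sum_sub_distrib, Finset.sum_mul, neg_mul_neg, add_mul,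
    Finset.sum_add_distrib]
  have hc : ∀ (A B : iso n), ∑ l, ∑ i, A.1 (.inl j) (.inl i) * B.1 (.inl i) (.inl l) * x l =
      ∑ i, ∑ l, B.1 (.inl i) (.inl l) * x l * A.1 (.inl j) (.inl i) := fun A B => by
    rw [Finset.sum_comm]
    exact Finset.sum_congr rfl fun i _ => Finset.sum_congr rfl fun l _ => by ring
  have hb : ∀ (A B : iso n), ∑ i, A.1 (.inl j) (.inl i) * B.1 (.inl i) (.inr ()) =
      ∑ i, B.1 (.inl i) (.inr ()) * A.1 (.inl j) (.inl i) := fun A B =>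
    Finset.sum_congr rfl fun i _ => mul_comm _ _
  rw [hc M N, hc N M, hb M N, hb N M]
  ring

variable {L : Type*} [AddCommGroup L] [Module ℝ L]

theorem onFields_add (S T : Forms n →ₗ[ℝ] Forms n) :
    onFields (L := L) (S + T) = onFields S + onFields T := TensorProduct.map_add_left ..

theorem onFields_real_smul (c : ℝ) (T : Forms n →ₗ[ℝ] Forms n) :
    onFields (L := L) (c • T) = c • onFields T := TensorProduct.map_smul_left ..

/-- The operator `ι_X̃ - L_X` on fields, for `x = (X̃, X)` in `𝔦𝔰𝔬(n)_dR`. -/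
def isoRep : DeRham (iso n) →ₗ[ℝ] Fields n L →ₗ[ℝ] Fields n L where
  toFun x := onFields (contrField (isoField x.1)) + onFields (lieDer (isoField (-x.2)))
  map_add' x y := by
    rw [Prod.fst_add, Prod.snd_add, neg_add, isoField_add, isoField_add, contrField_add, lieDer_add,
      onFields_add, onFields_add, add_add_add_comm]
  map_smul' c x := by
    rw [Prod.smul_fst, Prod.smul_snd, ← smul_neg, isoField_smul, isoField_smul,
      contrField_real_smul, lieDer_real_smul, onFields_real_smul, onFields_real_smul, ← smul_add]
    rfl

theorem isoRep_apply (x : DeRham (iso n)) : isoRep (L := L) x =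
    onFields (contrField (isoField x.1)) + onFields (lieDer (isoField (-x.2))) := rfl

theorem isoField_zero : isoField (0 : iso n) = 0 := by
  simpa using isoField_smul (0 : ℝ) (0 : iso n)

theorem contrField_zero : contrField (0 : Fin n → SmoothFn n) = 0 := by
  simpa using contrField_real_smul (0 : ℝ) (0 : Fin n → SmoothFn n)

theorem lieDer_zero : lieDer (0 : Fin n → SmoothFn n) = 0 := by
  simpa using lieDer_real_smul (0 : ℝ) (0 : Fin n → SmoothFn n)

theorem onFields_zero : onFields (L := L) (0 : Forms n →ₗ[ℝ] Forms n) = 0 :=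
  TensorProduct.map_zero_left _

theorem isoRep_lie (X : iso n) : isoRep (L := L) (0, X) = onFields (lieDer (isoField (-X))) := by
  rw [isoRep_apply, isoField_zero, contrField_zero, onFields_zero, zero_add]

theorem isoRep_contr (X : iso n) : isoRep (L := L) (X, 0) = onFields (contrField (isoField X)) := by
  rw [isoRep_apply, neg_zero, isoField_zero, lieDer_zero, onFields_zero, add_zero]

/-- The zero element lies in every degree, so nothing about `i` follows in the last case. -/
theorem mem_drDeg_cases {𝔤 : Type*} [LieRing 𝔤] [LieAlgebra ℝ 𝔤] {i : ℤ} {x : DeRham 𝔤}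
    (hx : x ∈ drDeg 𝔤 i) : (i = 0 ∧ ∃ X : 𝔤, x = (0, X)) ∨ (i = -1 ∧ ∃ X : 𝔤, x = (X, 0)) ∨
      x = 0 := by
  rw [drDeg] at hx
  split_ifs at hx with h0 h1
  · exact Or.inl ⟨h0, x.2, Prod.ext hx rfl⟩
  · exact Or.inr (Or.inl ⟨h1, x.1, Prod.ext rfl hx⟩)
  · exact Or.inr (Or.inr hx)

variable {𝓛 : ℤ → Submodule ℝ L}

theorem isoRep_isDiffOp (x : DeRham (iso n)) : IsDiffOp (SmoothFn n) 1 (isoRep (L := L) x) := by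
  exact (isDiffOp_contrField _).add (isDiffOp_lieDer _)

theorem isoRep_degree {i : ℤ} {x : DeRham (iso n)} (hx : x ∈ drDeg (iso n) i) (a : ℤ)
    (A : Fields n L) (hA : A ∈ fieldDeg n 𝓛 a) : isoRep x A ∈ fieldDeg n 𝓛 (a + i) := by
  rcases mem_drDeg_cases hx with ⟨rfl, X, rfl⟩ | ⟨rfl, X, rfl⟩ | rfl
  · rw [isoRep_lie]
    exact onFields_mem_fieldDeg (lieDer_degree _) hA
  · rw [isoRep_contr]
    exact onFields_mem_fieldDeg (contrField_degree _) hA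
  · rw [map_zero]
    exact zero_mem _

theorem onFields_commutator {R S T : Forms n →ₗ[ℝ] Forms n} {c : ℝ}
    (h : ∀ α, R α = c • S (T α) - T (S α)) (A : Fields n L) :
    onFields R A = c • onFields S (onFields T A) - onFields T (onFields S A) := by
  induction A using TensorProduct.induction_on with
  | zero => simp only [map_zero, smul_zero, sub_zero]
  | add x y hx hy =>
    simp only [map_add, smul_add]
    rw [hx, hy, add_sub_add_comm]
  | tmul α x =>
    rw [onFields_tmul, onFields_tmul, onFields_tmul, onFields_tmul, onFields_tmul, h,
      TensorProduct.sub_tmul, TensorProduct.smul_tmul']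

theorem isoField_neg (X : iso n) : isoField (-X) = -isoField X := by
  rw [← neg_one_smul ℝ X, isoField_smul, neg_one_smul]

/-- In Taylor components the commutator of derivations reverses the order of composition. Hence `X ↦
-L_X`, not `X ↦ L_X`, is the homomorphism. -/
theorem isoRep_lie_lie (X Y : iso n) (A : Fields n L) : isoRep (0, ⁅X, Y⁆) A =
    (1 : ℝ) • isoRep (0, Y) (isoRep (0, X) A) - isoRep (0, X) (isoRep (0, Y) A) := by
  rw [isoRep_lie, isoRep_lie, isoRep_lie]
  refine onFields_commutator (fun α => ?_) A
  have h : isoField (-⁅X, Y⁆) = fieldBracket (isoField (-Y)) (isoField (-X)) := by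
    rw [← isoField_lie, neg_lie, lie_neg, neg_neg, lie_skew]
  rw [h, ← lieDer_lieDer, one_smul]

theorem isoRep_lie_contr (X Y : iso n) (A : Fields n L) : isoRep (⁅X, Y⁆, 0) A =
    (1 : ℝ) • isoRep (Y, 0) (isoRep (0, X) A) - isoRep (0, X) (isoRep (Y, 0) A) := by
  rw [isoRep_contr, isoRep_contr, isoRep_lie]
  refine onFields_commutator (fun α => ?_) A
  have h : isoField ⁅X, Y⁆ = (-1 : ℝ) • fieldBracket (isoField (-X)) (isoField Y) := by
    rw [← isoField_lie, neg_lie, isoField_neg, neg_one_smul, neg_neg]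
  rw [h, contrField_real_smul, LinearMap.smul_apply, ← lieDer_contrField, one_smul, neg_one_smul,
    neg_sub]

theorem isoRep_contr_lie (X Y : iso n) (A : Fields n L) : isoRep (⁅X, Y⁆, 0) A =
    (1 : ℝ) • isoRep (0, Y) (isoRep (X, 0) A) - isoRep (X, 0) (isoRep (0, Y) A) := by
  rw [isoRep_contr, isoRep_contr, isoRep_lie]
  refine onFields_commutator (fun α => ?_) A
  have h : isoField ⁅X, Y⁆ = fieldBracket (isoField (-Y)) (isoField X) := by
    rw [← isoField_lie, neg_lie, lie_skew]
  rw [h, ← lieDer_contrField, one_smul]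

theorem isoRep_contr_contr (X Y : iso n) (A : Fields n L) : (0 : Fields n L) =
    (-1 : ℝ) • isoRep (Y, 0) (isoRep (X, 0) A) - isoRep (X, 0) (isoRep (Y, 0) A) := by
  rw [isoRep_contr, isoRep_contr, ← onFields_commutator (R := 0) (fun α => ?_) A, onFields_zero,
    LinearMap.zero_apply]
  rw [contrField_contrField, LinearMap.zero_apply, neg_one_smul, neg_neg, sub_self]

set_option maxHeartbeats 1000000 in
theorem isoRep_bracket {i j : ℤ} {x y : DeRham (iso n)} (hx : x ∈ drDeg (iso n) i)
    (hy : y ∈ drDeg (iso n) j) (A : Fields n L) : isoRep (drBracket x y) A =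
      (-1 : ℝ) ^ (i * j) • isoRep y (isoRep x A) - isoRep x (isoRep y A) := by
  have hz : (0 : Fields n L) = (-1 : ℝ) ^ (i * j) • (0 : Fields n L) - 0 := by
    rw [smul_zero]; exact (sub_self _).symm
  have hb : ∀ x : DeRham (iso n), drBracket x 0 = 0 ∧ drBracket 0 x = 0 := fun x => by
    simp [drBracket]
  -- Zero is treated first: its degree is arbitrary, so the sign `(-1)^(i * j)` could not be
  -- evaluated in the case split below.
  by_cases hx0 : x = 0
  · subst hx0
    rw [(hb y).2, map_zero, LinearMap.zero_apply, LinearMap.zero_apply, map_zero]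
    exact hz
  by_cases hy0 : y = 0
  · subst hy0
    rw [(hb x).1, map_zero, LinearMap.zero_apply, LinearMap.zero_apply, map_zero]
    exact hz
  clear hz hb
  have hone : ∀ l : ℤ, l = 0 → (-1 : ℝ) ^ l = 1 := by rintro _ rfl; exact zpow_zero _
  rcases mem_drDeg_cases hx with ⟨rfl, X, rfl⟩ | ⟨rfl, X, rfl⟩ | rfl
  · rcases mem_drDeg_cases hy with ⟨rfl, Y, rfl⟩ | ⟨rfl, Y, rfl⟩ | rfl
    · have e : drBracket ((0, X) : DeRham (iso n)) (0, Y) = (0, ⁅X, Y⁆) := by simp [drBracket]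
      rw [e, hone _ (mul_zero _)]
      exact isoRep_lie_lie X Y A
    · have e : drBracket ((0, X) : DeRham (iso n)) (Y, 0) = (⁅X, Y⁆, 0) := by simp [drBracket]
      rw [e, hone _ (zero_mul _)]
      exact isoRep_lie_contr X Y A
    · exact absurd rfl hy0
  · rcases mem_drDeg_cases hy with ⟨rfl, Y, rfl⟩ | ⟨rfl, Y, rfl⟩ | rfl
    · have e : drBracket ((X, 0) : DeRham (iso n)) (0, Y) = (⁅X, Y⁆, 0) := by simp [drBracket]
      rw [e, hone _ (mul_zero _)]
      exact isoRep_contr_lie X Y A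
    · have e : drBracket ((X, 0) : DeRham (iso n)) (Y, 0) = 0 := by simp [drBracket]
      have e' : (-1 : ℝ) ^ ((-1 : ℤ) * -1) = -1 := by norm_num
      rw [e, e', map_zero, LinearMap.zero_apply]
      exact isoRep_contr_contr X Y A
    · exact absurd rfl hy0
  · exact absurd rfl hx0

end IsoAction

/-! ### The map of dg Lie algebras -/

section DGLieMap

variable {n : ℕ} {L : Type*} [AddCommGroup L] [Module ℝ L] {𝓛 : ℤ → Submodule ℝ L}

theorem linVF_add {V : Type*} [AddCommGroup V] [Module ℝ V] (S T : V →ₗ[ℝ] V) :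
    linVF (S + T) = linVF S + linVF T := by
  funext k
  by_cases hk : k = 1
  · subst hk; rfl
  · rw [Pi.add_apply, linVF_of_ne _ hk, linVF_of_ne _ hk, linVF_of_ne _ hk, add_zero]

theorem linVF_smul {V : Type*} [AddCommGroup V] [Module ℝ V] (c : ℝ) (T : V →ₗ[ℝ] V) :
    linVF (c • T) = c • linVF T := by
  funext k
  by_cases hk : k = 1
  · subst hk; rfl
  · rw [Pi.smul_apply, linVF_of_ne _ hk, linVF_of_ne _ hk, smul_zero]

/-- The action of `𝔦𝔰𝔬(n)_dR` on the fields by linear vector fields. -/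
def isoVF : DeRham (iso n) →ₗ[ℝ] VField n L where
  toFun x := linVF (isoRep x)
  map_add' x y := by rw [map_add, linVF_add]
  map_smul' c x := by rw [map_smul, linVF_smul]; rfl

theorem isoVF_apply (x : DeRham (iso n)) : isoVF (L := L) x = linVF (isoRep x) := rfl

theorem isVFBracket_linVF {S T U : Fields n L →ₗ[ℝ] Fields n L} {a b : ℤ}
    (h : ∀ A, U A = (-1 : ℝ) ^ (a * b) • T (S A) - S (T A)) :
    IsVFBracket 𝓛 a b (linVF S) (linVF T) (linVF U) := by
  intro k d e _
  rw [insertion_linVF_left, insertion_linVF_left]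
  by_cases hk : k = 1
  · subst hk
    exact h _
  · simp only [linVF_of_ne _ hk, _root_.zero_apply, map_zero, smul_zero, sub_zero]

variable [DirectSum.Decomposition 𝓛] (C : CyclicLInfty n 𝓛)

theorem insertion_aksz_linVF {τ : Forms n →ₗ[ℝ] Forms n} {t : ZMod 2}
    (hτ : IsFormDerivation τ t) {k : ℕ} {d : Fin k → ℤ} {v : Fin k → Fields n L}
    (hv : IsHomog (fieldDeg n 𝓛) d v) :
    insertion (fun k => ⇑(aksz C k)) (fun k => ⇑(linVF (onFields (L := L) τ) k)) d v =
      parSign t • onFields τ (bracketVF C k v) +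
        onFields (extD n) (linVF (onFields τ) k v) := by
  rw [aksz_eq, insertion_add_left, insertion_bracketVF_linVF C hτ hv, insertion_linVF_left]

/-- Three contributions: the Jacobi identities of the extended brackets; the mixed terms, which
cancel because `d` is an odd derivation; and `d² = 0`. -/
theorem insertion_aksz_self {k : ℕ} {d : Fin k → ℤ} {v : Fin k → Fields n L}
    (hv : IsHomog (fieldDeg n 𝓛) d v) :
    insertion (fun k => ⇑(aksz C k)) (fun k => ⇑(aksz C k)) d v = 0 := by
  have h : insertion (fun k => ⇑(aksz C k)) (fun k =>
      ⇑((bracketVF C + linVF (onFields (extD n)) : VField n L) k)) d v = 0 := by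
    rw [insertion_add_right, insertion_aksz_linVF C isFormDerivation_extD hv, aksz_eq,
      insertion_add_left, insertion_bracketVF_self C hv, insertion_linVF_left, parSign_one]
    have h2 : onFields (extD n) (linVF (onFields (L := L) (extD n)) k v) = 0 := by
      by_cases hk : k = 1
      · subst hk
        -- With coefficient zero the commutator lemma just transports `d ∘ d = 0` from forms to
        -- fields.
        have := onFields_commutator (L := L) (R := 0) (S := extD n) (T := extD n) (c := 0)
          (fun α => by simp [extD_extD]) (v 0)
        rwa [onFields_zero, LinearMap.zero_apply, zero_smul, zero_sub, zero_eq_neg] at this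
      · rw [linVF_of_ne _ hk, _root_.zero_apply, map_zero]
    rw [h2, add_zero, zero_add]
    exact (congrArg _ (neg_one_smul ℝ _)).trans (add_neg_cancel _)
  rwa [← aksz_eq] at h

/-- The extended brackets drop out because `τ` is a derivation, so only the linear part `d` of `Q`
contributes to the commutator. -/
theorem isVFBracket_aksz_linVF {τ : Forms n →ₗ[ℝ] Forms n} {i : ℤ} (hτ : IsFormDerivation τ i)
    {U : Fields n L →ₗ[ℝ] Fields n L}
    (hU : ∀ A, U A = parSign i • onFields τ (onFields (extD n) A) -
      onFields (extD n) (onFields τ A)) :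
    IsVFBracket 𝓛 1 i (aksz C) (linVF (onFields τ)) (linVF U) := by
  intro k d v hv
  rw [insertion_aksz_linVF C hτ hv, insertion_linVF_left, aksz_eq, one_mul, neg_one_zpow]
  change _ = _ • onFields τ (bracketVF C k v + linVF (onFields (extD n)) k v) - _
  rw [map_add, smul_add, add_sub_add_left_eq_sub]
  by_cases hk : k = 1
  · subst hk
    exact hU _
  · simp only [linVF_of_ne _ hk, _root_.zero_apply, map_zero, smul_zero, sub_zero]

theorem isDGLieMap_isoVF : IsDGLieMap 𝓛 (aksz C) (isoVF (n := n) (L := L)) where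
  isVectorField := isVectorField_aksz C
  square_zero k d e he := by
    rw [insertion_aksz_self C he, smul_zero, sub_zero]
    rfl
  degree i x hx := isVectorField_linVF (isoRep_degree hx) (isoRep_isDiffOp x)
  bracket i j x y hx hy := isVFBracket_linVF (isoRep_bracket hx hy)
  differential i x hx := by
    rw [isoVF_apply, isoVF_apply]
    rcases mem_drDeg_cases hx with ⟨rfl, X, rfl⟩ | ⟨rfl, X, rfl⟩ | rfl
    · have e : drDiff ((0, X) : DeRham (iso n)) = 0 := rfl
      rw [isoRep_lie, e, map_zero]
      refine isVFBracket_aksz_linVF C (by simpa using isFormDerivation_lieDer _) fun A => ?_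
      rw [← onFields_zero (n := n)]
      refine onFields_commutator (fun α => ?_) A
      rw [lieDer_extD, Int.cast_zero, parSign_zero, one_smul, sub_self, LinearMap.zero_apply]
    · have e : drDiff ((X, 0) : DeRham (iso n)) = (0, X) := rfl
      have hm : ((-1 : ℤ) : ZMod 2) = 1 := by decide
      rw [isoRep_contr, e, isoRep_lie]
      refine isVFBracket_aksz_linVF C (by rw [hm]; exact isFormDerivation_contrField _) fun A => ?_
      refine onFields_commutator (fun α => ?_) A
      -- Both signs are negative for an odd `τ`, so the commutator is minus `ι d + d ι`, that is
      -- `-L_X`, the operator of `(0, X)`.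
      rw [hm, parSign_one, neg_one_smul, ← neg_add', cartan, isoField_neg, ← neg_one_smul ℝ (isoField X),
        lieDer_real_smul, LinearMap.smul_apply, neg_one_smul]
    · have e : drDiff (0 : DeRham (iso n)) = 0 := rfl
      rw [e, map_zero]
      intro k d v hv
      have h0 : ∀ k, linVF (0 : Fields n L →ₗ[ℝ] Fields n L) k = 0 := fun k => by
        by_cases hk : k = 1
        · subst hk; ext; rfl
        · exact linVF_of_ne _ hk
      rw [insertion_linVF_left, LinearMap.zero_apply, smul_zero, insertion_linVF_right]
      simp only [h0, _root_.zero_apply, LinearMap.zero_apply]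
      rw [Finset.sum_eq_zero, sub_zero]
      intro i _
      rw [(aksz C _).map_coord_zero (0 : Fin (({i} : Finset (Fin k))ᶜ.card + 1))
        (Fin.cons_zero _ _), smul_zero]

end DGLieMap

/-! ### Functionals generated by vector fields -/

section Functionals

variable {n : ℕ} {L : Type*} [AddCommGroup L] [Module ℝ L]
  {𝓛 : ℤ → Submodule ℝ L} [DirectSum.Decomposition 𝓛] (C : CyclicLInfty n 𝓛)

/-- The functional whose derivative is the contraction of the symplectic form with `X`. -/
def symplFunctional (X : VField n L) : Functional n L
  | 0, _ => 0
  | k + 1, e => sympl C (X k fun i => (Fin.init e i : compactFields n L)) (e (Fin.last k))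

theorem symplFunctional_succ (X : VField n L) (k : ℕ) (e : Fin (k + 1) → compactFields n L) :
    symplFunctional C X (k + 1) e =
      sympl C (X k fun i => (e i.castSucc : Fields n L)) (e (Fin.last k)) := rfl

theorem action_eq : action C = symplFunctional C (aksz C) := by
  funext k e
  cases k <;> rfl

theorem current_eq (x : DeRham (iso n)) :
    current C x = symplFunctional C (linVF ((-1 : ℝ) • isoOp x)) := by
  funext k e
  match k with
  | 0 => rfl
  | 1 => exact (sympl_zero_left C _).symm
  | 2 =>
    rw [symplFunctional_succ, linVF_one, LinearMap.smul_apply, sympl_smul_left, neg_one_mul]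
    rfl
  | k + 3 => exact (sympl_zero_left C _).symm

theorem isHamiltonian_symplFunctional {X : VField n L}
    (hX : ∀ k, IsPolyDiff (SmoothFn n) (X k)) : IsHamiltonian C (symplFunctional C X) X := by
  refine ⟨hX, fun k e e₀ => ?_⟩
  rw [symplFunctional_succ, Fin.snoc_last]
  simp only [Fin.snoc_castSucc]

theorem isLocalFunctional_symplFunctional {m : ℤ} {X : VField n L}
    (hX : IsVectorField 𝓛 (m + 1) X)
    (hs : ∀ k, IsGradedSymm (compactDeg n 𝓛) (symplFunctional C X k)) :
    IsLocalFunctional 𝓛 m (symplFunctional C X) where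
  zero := rfl
  symm := hs
  degree k d e he hd := by
    cases k with
    | zero => rfl
    | succ k =>
      rw [Fin.sum_univ_castSucc] at hd
      refine sympl_eq_zero C ?_ (hX.degree k (fun i => d i.castSucc)
        (fun i => (e i.castSucc : Fields n L)) fun i => he i.castSucc) (he (Fin.last k))
      intro h
      exact hd (by linarith)
  isLocal k := by
    cases k with
    | zero => exact ⟨0, isPolyDiff_zero, fun e => integral_zero'.symm⟩
    | succ k =>
      let φ : Fields n L →ₗ[ℝ] Fields n L →ₗ[ℝ] SmoothFn n :=
        ((2 : ℝ) • (wedgePairing C).comp (fieldInv n 𝓛)).compr₂ (topCoeff n)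
      have hφ : ∀ A B, φ A B = (2 : ℝ) • topCoeff n (wedgePairing C (fieldInv n 𝓛 A) B) := by
        intro A B
        simp [φ]
      refine ⟨_, (hX.isLocal k).uncurryRight (φ := φ) (fun f A B => ?_) (fun f A B => ?_),
        fun e => ?_⟩
      · rw [hφ, hφ, fieldInv_smul, wedgePairing_smul_left, topCoeff_smul]
        exact smul_algebra_smul_comm (2 : ℝ) f _ |>.symm
      · rw [hφ, hφ, wedgePairing_smul_right, topCoeff_smul]
        exact smul_algebra_smul_comm (2 : ℝ) f _ |>.symm
      · rw [symplFunctional_succ, sympl_eq, ← integral_smul', integral, map_smul,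
          MultilinearMap.uncurryRight_apply, LinearMap.compMultilinearMap_apply, hφ]
        rfl

theorem isGradedSymm_two {V N : Type*} [AddCommGroup V] [Module ℝ V] [AddCommGroup N] [Module ℝ N]
    {𝒱 : ℤ → Submodule ℝ V} {f : (Fin 2 → V) → N}
    (h : ∀ (a b : ℤ) (v w : V), v ∈ 𝒱 a → w ∈ 𝒱 b → f ![v, w] = parSign (a * b) • f ![w, v]) :
    IsGradedSymm 𝒱 f := by
  intro d v hv σ
  have hσ : ∀ σ : Equiv.Perm (Fin 2), σ = 1 ∨ σ = Equiv.swap 0 1 := by decide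
  rw [koszulSign_eq]
  rcases hσ σ with rfl | rfl
  · have : koszulExp (1 : Equiv.Perm (Fin 2)) (fun i => (d i : ZMod 2)) = 0 :=
      Finset.sum_eq_zero fun i _ => Finset.sum_eq_zero fun j _ => if_neg fun h =>
        absurd h.1 h.2.not_gt
    rw [this, parSign_zero, one_smul]
    rfl
  · have e1 : koszulExp (Equiv.swap (0 : Fin 2) 1) (fun i => (d i : ZMod 2)) = d 0 * d 1 := by
      simp [koszulExp, Fin.sum_univ_two, mul_comm]
    have e2 : v = ![v 0, v 1] := by
      funext i; fin_cases i <;> rfl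
    have e3 : (fun i => v (Equiv.swap 0 1 i)) = ![v 1, v 0] := by
      funext i; fin_cases i <;> simp
    rw [e1, e3]
    conv_lhs => rw [e2]
    exact h _ _ _ _ (hv 0) (hv 1)

/-- Only the quadratic component is nonzero. Its symmetry sign should be `(-1)^(ab)`, while skewness
gives `(-1)^(ta)`; these agree whenever the term is nonzero, since then `a + t + b = 1`. -/
theorem symplFunctional_linVF_symm {T : Fields n L →ₗ[ℝ] Fields n L} {t : ℤ}
    (hT : ∀ (a : ℤ) (A : Fields n L), A ∈ fieldDeg n 𝓛 a → T A ∈ fieldDeg n 𝓛 (a + t))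
    (hskew : ∀ (a : ℤ) (A B : Fields n L), A ∈ fieldDeg n 𝓛 a → B ∈ compactFields n L →
      sympl C (T A) B = parSign (t * a) * sympl C (T B) A) (k : ℕ) :
    IsGradedSymm (compactDeg n 𝓛) (symplFunctional C (linVF T) k) := by
  by_cases hk : k ≤ 1
  · exact isGradedSymm_of_subsingleton hk _
  by_cases hk2 : k = 2
  · subst hk2
    refine isGradedSymm_two fun a b A B hA hB => ?_
    rw [symplFunctional_succ, symplFunctional_succ, linVF_one, linVF_one]
    change sympl C (T A) B = parSign (a * b) * sympl C (T B) A
    by_cases hab : a + t + b = 1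
    · rw [hskew a A B hA B.2]
      congr 2
      have : ((a + t + b : ℤ) : ZMod 2) = 1 := by rw [hab]; rfl
      push_cast at this
      have key : ∀ a b t : ZMod 2, a + t + b = 1 → t * a = a * b := by decide
      exact key _ _ _ this
    · rw [sympl_eq_zero C (B := B) hab (hT a A hA) hB,
        sympl_eq_zero C (B := A) (fun h => hab (by linarith)) (hT b B hB) hA, mul_zero]
  · obtain ⟨l, rfl⟩ : ∃ l, k = l + 3 := ⟨k - 3, by omega⟩
    have : symplFunctional C (linVF T) (l + 3) = fun _ => 0 := by
      funext e
      exact sympl_zero_left C _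
    rw [this]
    exact isGradedSymm_zero

theorem extD_skew (a : ℤ) (A B : Fields n L) (hA : A ∈ fieldDeg n 𝓛 a)
    (hB : B ∈ compactFields n L) :
    sympl C (onFields (extD n) A) B = parSign ((1 : ℤ) * a) * sympl C (onFields (extD n) B) A := by
  rw [sympl_odd C (extD_mul) isFormDerivation_extD.degree extD_formInv
    (fun _ => extD_mem_compactForms) (fun _ => integral_extD) hA hB,
    sympl_antisymm C A, mul_neg, neg_neg, Int.cast_one, one_mul]

theorem contrField_skew (ξ : Fin n → SmoothFn n) (a : ℤ) (A B : Fields n L)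
    (hA : A ∈ fieldDeg n 𝓛 a) (hB : B ∈ compactFields n L) :
    sympl C (onFields (contrField ξ) A) B =
      parSign ((-1 : ℤ) * a) * sympl C (onFields (contrField ξ) B) A := by
  have hm : ((-1 : ℤ) : ZMod 2) = 1 := by decide
  rw [sympl_odd C (contrField_mul ξ) (isFormDerivation_contrField ξ).degree (contrField_formInv ξ)
    (fun _ => contrField_mem_compactForms ξ) (fun _ _ => integral_contrField ξ _) hA hB,
    sympl_antisymm C A, mul_neg, neg_neg, hm, one_mul]

theorem lieDer_skew (ξ : Fin n → SmoothFn n) (a : ℤ) (A B : Fields n L)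
    (hB : B ∈ compactFields n L) :
    sympl C (onFields (lieDer ξ) A) B =
      parSign ((0 : ℤ) * a) * sympl C (onFields (lieDer ξ) B) A := by
  rw [sympl_even C (lieDer_mul ξ) (fun _ _ => lieDer_mem ξ) (lieDer_formInv ξ)
    (fun _ => lieDer_mem_compactForms ξ) (fun _ => integral_lieDer ξ) hB,
    sympl_antisymm C A, neg_neg, Int.cast_zero, zero_mul, parSign_zero, one_mul]

theorem isoRep_skew {i : ℤ} {x : DeRham (iso n)} (hx : x ∈ drDeg (iso n) i) (a : ℤ)
    (A B : Fields n L) (hA : A ∈ fieldDeg n 𝓛 a) (hB : B ∈ compactFields n L) :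
    sympl C (isoRep x A) B = parSign (i * a) * sympl C (isoRep x B) A := by
  rcases mem_drDeg_cases hx with ⟨rfl, X, rfl⟩ | ⟨rfl, X, rfl⟩ | rfl
  · rw [isoRep_lie]
    exact lieDer_skew C _ a A B hB
  · rw [isoRep_contr]
    exact contrField_skew C _ a A B hA hB
  · rw [map_zero, LinearMap.zero_apply, LinearMap.zero_apply, sympl_zero_left, sympl_zero_left,
      mul_zero]

/-- Explains the sign in the statement of the theorem: the current involves `-(ι + L)`, the Lie map
is `ι - L`, and they differ by `(-1)^|x|`. -/
theorem neg_isoOp {i : ℤ} {x : DeRham (iso n)} (hx : x ∈ drDeg (iso n) i) :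
    (-1 : ℝ) • isoOp (L := L) x = (-1 : ℝ) ^ i • isoRep x := by
  rcases mem_drDeg_cases hx with ⟨rfl, X, rfl⟩ | ⟨rfl, X, rfl⟩ | rfl
  · rw [isoRep_lie, isoOp, isoField_zero, contrField_zero, onFields_zero, zero_add, zpow_zero,
      one_smul, isoField_neg, ← neg_one_smul ℝ (isoField X), lieDer_real_smul, onFields_real_smul]
  · rw [isoRep_contr, isoOp, isoField_zero, lieDer_zero, onFields_zero, add_zero]
    norm_num
  · rw [map_zero, isoOp, Prod.fst_zero, Prod.snd_zero, isoField_zero, contrField_zero, lieDer_zero,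
      onFields_zero, add_zero, smul_zero, smul_zero]

theorem pairSum_succ {k : ℕ} (f : Fin (k + 1) → Fin (k + 1) → ZMod 2) :
    pairSum f = (pairSum fun i l : Fin k => f i.castSucc l.castSucc) +
      ∑ i : Fin k, f i.castSucc (Fin.last k) := by
  simp only [pairSum, Fin.sum_univ_castSucc, Fin.castSucc_lt_castSucc_iff, Fin.castSucc_lt_last,
    if_true, lt_irrefl, if_false, add_zero, Finset.sum_add_distrib]
  rw [Finset.sum_eq_zero (s := Finset.univ) (f := fun x => if Fin.last k < Fin.castSucc x then _ else _), add_zero]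
  intro i _
  exact if_neg (Fin.castSucc_lt_last i).not_gt

/-- The cyclic function `(x₀, …, x_k) ↦ ± ⟨q_k (x₀, …, x_{k-1}), x_k⟩`. -/
def cyclicForm (k : ℕ) : MultilinearMap ℝ (fun _ : Fin (k + 1) => L) ℝ :=
  ((C.pairing.comp (parityInv 𝓛)).compMultilinearMap (C.q k)).uncurryRight

/-- The interaction density is the wedge extension of the cyclic function of `L`, and therefore
inherits graded symmetry from `pairing_cyclic` through `wedgeExtend_symm`. -/
theorem wedgePairing_bracketVF {k : ℕ} {d : Fin (k + 1) → ℤ} {v : Fin (k + 1) → Fields n L}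
    (hv : IsHomog (fieldDeg n 𝓛) d v) :
    wedgePairing C (fieldInv n 𝓛 (bracketVF C k (Fin.init v))) (v (Fin.last k)) =
      TensorProduct.rid ℝ (Forms n) (wedgeExtend 𝓛 (cyclicForm C k) v) := by
  refine multilinear_ext_homog
    (φ := (((wedgePairing C).comp (fieldInv n 𝓛)).compMultilinearMap (bracketVF C k)).uncurryRight)
    (ψ := (TensorProduct.rid ℝ (Forms n)).toLinearMap.compMultilinearMap
      (wedgeExtend 𝓛 (cyclicForm C k))) ?_ hv
  intro p j α x hα hx _
  have hy := C.q_degree k (fun i => j i.castSucc) (fun i => x i.castSucc) fun i => hx i.castSucc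
  have hpy : parityInv 𝓛 (C.q k fun i => x i.castSucc) ∈ 𝓛 (∑ i, j (Fin.castSucc i) + 1 + 1) := by
    rw [parityInv_of_mem (𝓛 := 𝓛) hy]
    exact Submodule.smul_mem _ _ hy
  rw [MultilinearMap.uncurryRight_apply, LinearMap.compMultilinearMap_apply, LinearMap.comp_apply,
    LinearMap.compMultilinearMap_apply, wedgeExtend_tmul _ p j α x hα hx]
  have h1 := bracketVF_tmul C (fun i => p i.castSucc) (fun i => j i.castSucc)
    (fun i => α i.castSucc) (fun i => x i.castSucc) (fun i => hα i.castSucc)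
    (fun i => hx i.castSucc)
  have hP := ofFn_prod_mem (fun i => p (Fin.castSucc i)) (fun i => α (Fin.castSucc i))
    (fun i => hα i.castSucc)
  change wedgePairing C (fieldInv n 𝓛 (bracketVF C k fun i => α i.castSucc ⊗ₜ x i.castSucc)) _ = _
  rw [h1, map_smul, fieldInv_tmul, formInv_of_mem hP, ← TensorProduct.smul_tmul', smul_smul,
    map_smul, LinearMap.smul_apply, wedgePairing_tmul_of_mem C _ _ hpy (hα (Fin.last k)),
    ← parSign_add]
  rw [pairSum_succ, List.ofFn_succ', List.prod_concat]
  simp only [LinearEquiv.coe_coe, map_smul, TensorProduct.rid_tmul, smul_smul]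
  have hc : cyclicForm C k x = C.pairing (parityInv 𝓛 (C.q k fun i => x i.castSucc))
    (x (Fin.last k)) := rfl
  rw [hc, ← mul_assoc, ← parSign_add]
  congr 3
  push_cast
  rw [← Finset.sum_mul]
  ring_nf
  simp only [CharTwo.two_eq_zero, mul_zero, add_zero, zero_add]

theorem symplFunctional_bracketVF_symm (k : ℕ) :
    IsGradedSymm (compactDeg n 𝓛) (symplFunctional C (bracketVF C) k) := by
  cases k with
  | zero => exact isGradedSymm_zero
  | succ k =>
    have key : ∀ (d : Fin (k + 1) → ℤ) (e : Fin (k + 1) → compactFields n L),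
        IsHomog (compactDeg n 𝓛) d e → symplFunctional C (bracketVF C) (k + 1) e =
        2 * integral (TensorProduct.rid ℝ (Forms n) (wedgeExtend 𝓛 (cyclicForm C k)
          fun i => (e i : Fields n L))) := by
      intro d e he
      rw [← wedgePairing_bracketVF C (d := d) (v := fun i => (e i : Fields n L)) he]
      rfl
    intro d e he σ
    rw [key d e he, key (fun i => d (σ i)) (fun i => e (σ i)) fun i => he (σ i),
      wedgeExtend_symm (n := n) (𝓛 := 𝓛) (f := cyclicForm C k) (C.pairing_cyclic k) d
        (fun i => (e i : Fields n L)) he σ, map_smul, integral_smul', smul_eq_mul, mul_left_comm]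

theorem symplFunctional_add (X Y : VField n L) :
    symplFunctional C (X + Y) = symplFunctional C X + symplFunctional C Y := by
  funext k e
  cases k with
  | zero => exact (add_zero _).symm
  | succ k => exact sympl_add_left C _ _ (e (Fin.last k)).2

theorem isLocalFunctional_action : IsLocalFunctional 𝓛 0 (action C) := by
  rw [action_eq]
  refine isLocalFunctional_symplFunctional C (isVectorField_aksz C) fun k d e he σ => ?_
  rw [aksz_eq, symplFunctional_add]
  simp only [Pi.add_apply]
  rw [smul_add, ← symplFunctional_bracketVF_symm C k d e he σ,
    ← symplFunctional_linVF_symm C (fun a A hA => onFields_mem_fieldDeg extD_degree hA)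
      (extD_skew C) k d e he σ]

/-- The degrees differ by one because the symplectic form has degree `-1`: a functional of degree
`i` has a Hamiltonian vector field of degree `i + 1`. -/
theorem isLocalFunctional_current {i : ℤ} {x : DeRham (iso n)} (hx : x ∈ drDeg (iso n) (i + 1)) :
    IsLocalFunctional 𝓛 i (current C x) := by
  rw [current_eq, neg_isoOp hx]
  refine isLocalFunctional_symplFunctional C (isVectorField_linVF (r := 1) (fun a A hA =>
    Submodule.smul_mem _ _ (isoRep_degree hx a A hA)) ((isoRep_isDiffOp x).smul _)) ?_
  refine symplFunctional_linVF_symm C (t := i + 1) (fun a A hA =>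
    Submodule.smul_mem _ _ (isoRep_degree hx a A hA)) fun a A B hA hB => ?_
  rw [LinearMap.smul_apply, LinearMap.smul_apply, sympl_smul_left, sympl_smul_left,
    isoRep_skew C hx a A B hA hB, mul_left_comm]

theorem isHamiltonian_action : IsHamiltonian C (action C) (aksz C) := by
  rw [action_eq]
  exact isHamiltonian_symplFunctional C (isVectorField_aksz C).isLocal

theorem isHamiltonian_current {i : ℤ} {x : DeRham (iso n)} (hx : x ∈ drDeg (iso n) i) :
    IsHamiltonian C (current C x) ((-1 : ℝ) ^ i • isoVF x) := by
  rw [current_eq, neg_isoOp hx, isoVF_apply, ← linVF_smul]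
  exact isHamiltonian_symplFunctional C (isPolyDiff_linVF ((isoRep_isDiffOp x).smul _))

end Functionals

/-! ### The antibracket and the bracket of vector fields -/

section Subsets

variable {V N : Type*} {k : ℕ}

/-- A set of positions in a tuple, as positions in a longer tuple. -/
def extendPos (T : Finset (Fin k)) : Finset (Fin (k + 1)) := T.map Fin.castSuccEmb

theorem castSucc_mem_extendPos (T : Finset (Fin k)) (i : Fin k) :
    i.castSucc ∈ extendPos T ↔ i ∈ T := by
  simp [extendPos]

theorem last_notMem_extendPos (T : Finset (Fin k)) : Fin.last k ∉ extendPos T := by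
  simp [extendPos, (Fin.castSucc_lt_last _).ne]

/-- Splits the subsets by whether they contain the last position. Those containing it are
parametrised by the complement of their complement, so that both families are indexed by subsets of
`Fin k`. -/
theorem sum_finset_succ {M : Type*} [AddCommMonoid M] (f : Finset (Fin (k + 1)) → M) :
    ∑ U, f U = ∑ T, f (extendPos T) + ∑ T, f (extendPos T)ᶜ := by
  have hb : Function.Bijective (Sum.elim (extendPos (k := k)) fun T => (extendPos T)ᶜ) := by
    constructor
    · rintro (S | S) (T | T) h
      · exact congrArg Sum.inl (Finset.map_injective _ h)
      · have := last_notMem_extendPos S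
        change extendPos S = (extendPos T)ᶜ at h
        rw [h, Finset.mem_compl] at this
        exact absurd (last_notMem_extendPos T) this
      · have := last_notMem_extendPos T
        change (extendPos S)ᶜ = extendPos T at h
        rw [← h, Finset.mem_compl] at this
        exact absurd (last_notMem_extendPos S) this
      · exact congrArg Sum.inr (Finset.map_injective _ (compl_injective h))
    · intro U
      have hU : ∀ U : Finset (Fin (k + 1)), Fin.last k ∉ U →
          extendPos (Finset.univ.filter fun i : Fin k => i.castSucc ∈ U) = U := by
        intro U h
        ext i
        refine Fin.lastCases ?_ (fun i => ?_) i
        · exact iff_of_false (last_notMem_extendPos _) h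
        · rw [castSucc_mem_extendPos]; simp
      by_cases h : Fin.last k ∈ U
      · exact ⟨Sum.inr _, by
          change (extendPos _)ᶜ = U
          rw [hU Uᶜ (by simpa using h), compl_compl]⟩
      · exact ⟨Sum.inl _, hU U h⟩
  rw [← hb.sum_comp, Fintype.sum_sum_type]
  rfl

theorem sub_extendPos (W : ∀ k, (Fin k → V) → N) (e : Fin (k + 1) → V) (T : Finset (Fin k)) :
    W (extendPos T).card (sub e (extendPos T)) = W T.card (sub (Fin.init e) T) := by
  rw [← onList_ofFn W, ← onList_ofFn W, ofFn_sub, ofFn_sub, List.finRange_succ_last,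
    List.filter_append, List.filter_map, List.map_append, List.map_map]
  congr 1
  simp only [Function.comp_def, castSucc_mem_extendPos]
  rw [List.filter_cons_of_neg (by simpa using last_notMem_extendPos T)]
  simp only [List.filter_nil, List.map_nil, List.append_nil]
  rfl

theorem sub_extendPos_compl (W : ∀ k, (Fin k → V) → N) (e : Fin (k + 1) → V)
    (T : Finset (Fin k)) :
    W (extendPos T)ᶜ.card (sub e (extendPos T)ᶜ) =
      W (Tᶜ.card + 1) (Fin.snoc (α := fun _ => V) (sub (Fin.init e) Tᶜ) (e (Fin.last k))) := by
  rw [← onList_ofFn W, ← onList_ofFn W, ofFn_sub, List.ofFn_succ', List.finRange_succ_last,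
    List.filter_append, List.filter_map, List.map_append, List.map_map]
  simp only [Fin.snoc_castSucc, Fin.snoc_last]
  rw [ofFn_sub, List.concat_eq_append]
  congr 1
  simp only [Function.comp_def, Finset.mem_compl, castSucc_mem_extendPos]
  rw [List.filter_cons_of_pos (by simpa using last_notMem_extendPos T)]
  rfl

theorem sum_extendPos {M : Type*} [AddCommMonoid M] (d : Fin (k + 1) → M) (T : Finset (Fin k)) :
    ∑ i ∈ extendPos T, d i = ∑ i ∈ T, d i.castSucc := Finset.sum_map _ _ _

theorem sum_extendPos_compl {M : Type*} [AddCommMonoid M] (d : Fin (k + 1) → M)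
    (T : Finset (Fin k)) :
    ∑ i ∈ (extendPos T)ᶜ, d i = ∑ i ∈ Tᶜ, d i.castSucc + d (Fin.last k) := by
  have : (extendPos T)ᶜ = Finset.cons (Fin.last k) (extendPos Tᶜ) (last_notMem_extendPos _) := by
    ext i
    refine Fin.lastCases ?_ (fun i => ?_) i
    · simp [last_notMem_extendPos]
    · simp [castSucc_mem_extendPos, (Fin.castSucc_lt_last i).ne]
  rw [this, Finset.sum_cons, sum_extendPos, add_comm]

theorem unshuffleExp_extendPos (d : Fin (k + 1) → ZMod 2) (T : Finset (Fin k)) :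
    unshuffleExp (extendPos T) d = unshuffleExp T fun i => d i.castSucc := by
  simp only [unshuffleExp, Fin.sum_univ_castSucc, castSucc_mem_extendPos,
    last_notMem_extendPos, Fin.castSucc_lt_castSucc_iff, false_and, if_false,
    Finset.sum_const_zero, add_zero, (Fin.castSucc_lt_last _).not_gt, and_false]

/-- The rotation carries the first element past all the others, and these are its only inversions.
-/
theorem koszulExp_finRotate (d : Fin (k + 1) → ZMod 2) :
    koszulExp (finRotate (k + 1)) d = d 0 * ∑ i : Fin k, d i.succ := by
  have h1 : ∀ i : Fin k, finRotate (k + 1) i.castSucc = i.succ := fun i => by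
    rw [finRotate_apply, Fin.coeSucc_eq_succ]
  have h2 : finRotate (k + 1) (Fin.last k) = 0 := finRotate_last
  simp only [koszulExp, Fin.sum_univ_castSucc, h1, h2, Fin.castSucc_lt_castSucc_iff,
    Fin.succ_lt_succ_iff, Fin.castSucc_lt_last, Fin.succ_pos, and_self, if_true,
    (Fin.castSucc_lt_last _).not_gt, false_and, if_false, Finset.sum_const_zero, add_zero,
    lt_irrefl]
  rw [Finset.mul_sum]
  refine Finset.sum_congr rfl fun i _ => ?_
  rw [Finset.sum_eq_zero, zero_add, mul_comm]
  exact fun j _ => if_neg fun h => absurd h.1 h.2.not_gt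

theorem isGradedSymm_rotate [AddCommGroup V] [Module ℝ V] [AddCommGroup N] [Module ℝ N]
    {𝒱 : ℤ → Submodule ℝ V} {f : (Fin (k + 1) → V) → N} (hf : IsGradedSymm 𝒱 f)
    {a : ℤ} {y : V} {d : Fin k → ℤ} {v : Fin k → V} (hy : y ∈ 𝒱 a) (hv : IsHomog 𝒱 d v) :
    f (Fin.cons y v) = parSign (a * ∑ i, (d i : ZMod 2)) • f (Fin.snoc (α := fun _ => V) v y) := by
  rw [hf _ _ (isHomog_cons hy hv) (finRotate (k + 1)), koszulSign_eq, koszulExp_finRotate]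
  rw [Fin.snoc_eq_cons_rotate, Fin.cons_zero]
  simp only [Fin.cons_succ]

end Subsets

/-! ### The antibracket generates the bracket of Hamiltonian vector fields. -/

section Antibracket

variable {n : ℕ} {L : Type*} [AddCommGroup L] [Module ℝ L]
  {𝓛 : ℤ → Submodule ℝ L} [DirectSum.Decomposition 𝓛] {C : CyclicLInfty n 𝓛}

/-- Moving the first argument of a Hamiltonian vector field to the other side of the symplectic
form. -/
theorem IsHamiltonian.sympl_cons {F : Functional n L} {X : VField n L} (hF : IsHamiltonian C F X)
    (hs : ∀ k, IsGradedSymm (compactDeg n 𝓛) (F k)) {k : ℕ} {a b : ℤ} {y z : compactFields n L}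
    {d : Fin k → ℤ} {w : Fin k → compactFields n L} (hy : y ∈ compactDeg n 𝓛 a)
    (hz : z ∈ compactDeg n 𝓛 b) (hw : IsHomog (compactDeg n 𝓛) d w) :
    sympl C (X (k + 1) (Fin.cons (y : Fields n L) fun i => (w i : Fields n L))) z =
      parSign (a * (∑ i, (d i : ZMod 2) + b)) * sympl C (X (k + 1) fun i =>
        (Fin.snoc (α := fun _ => compactFields n L) w z i : compactFields n L)) y := by
  have e : (Fin.cons (y : Fields n L) fun i => (w i : Fields n L) : Fin (k + 1) → Fields n L) =
      fun i => ((Fin.cons y w : Fin (k + 1) → compactFields n L) i : Fields n L) := by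
    funext i
    refine Fin.cases ?_ (fun i => ?_) i <;> simp
  have hwz : IsHomog (compactDeg n 𝓛) (Fin.snoc (α := fun _ => ℤ) d b)
      (Fin.snoc (α := fun _ => compactFields n L) w z) := by
    intro i
    refine Fin.lastCases ?_ (fun i => ?_) i
    · simpa using hz
    · simpa using hw i
  rw [e, ← hF.2, ← Fin.cons_snoc_eq_snoc_cons, isGradedSymm_rotate (hs _) hy hwz, hF.2,
    Fin.sum_univ_castSucc]
  simp only [Fin.snoc_castSucc, Fin.snoc_last, smul_eq_mul]

set_option maxHeartbeats 1000000 in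
/-- The antibracket of two functionals generates the Lie bracket of their Hamiltonian vector
fields. -/
theorem antibracket_eq {a b : ℤ} {F G : Functional n L} {X Y Z : VField n L}
    (hF : IsHamiltonian C F X) (hG : IsHamiltonian C G Y)
    (hFs : ∀ k, IsGradedSymm (compactDeg n 𝓛) (F k))
    (hGs : ∀ k, IsGradedSymm (compactDeg n 𝓛) (G k))
    (hX : IsVectorField 𝓛 (a + 1) X) (hY : IsVectorField 𝓛 (b + 1) Y)
    (hXc : ∀ k (v : Fin k → compactFields n L), X k (fun i => (v i : Fields n L)) ∈ compactFields n L)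
    (hYc : ∀ k (v : Fin k → compactFields n L), Y k (fun i => (v i : Fields n L)) ∈ compactFields n L)
    (hZ : IsVFBracket 𝓛 (a + 1) (b + 1) X Y Z) {k : ℕ} {d : Fin (k + 1) → ℤ}
    {e : Fin (k + 1) → compactFields n L} (he : IsHomog (compactDeg n 𝓛) d e) :
    antibracket C a b F G d e = -((-1 : ℝ) ^ a *
      sympl C (Z k fun i => (e i.castSucc : Fields n L)) (e (Fin.last k))) := by
  have he' : IsHomog (fieldDeg n 𝓛) (Fin.init d) fun i => (e (Fin.castSucc i) : Fields n L) :=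
    fun i => he i.castSucc
  rw [antibracket, ← mul_neg, hZ k (Fin.init d) _ he', insertion, insertion]
  congr 1
  have hz := (e (Fin.last k)).2
  change _ = -(symplLin C _ hz _)
  rw [map_sub, map_smul, map_sum, map_sum, neg_sub, sub_eq_neg_add, sum_finset_succ]
  simp only [hamVF_eq C hF, hamVF_eq C hG]
  rw [smul_eq_mul, Finset.mul_sum, ← Finset.sum_neg_distrib]
  have hdeg : ∀ T : Finset (Fin k), ∀ W : VField n L, ∀ s, IsVectorField 𝓛 s W →
      W T.card (fun i => (sub (Fin.init e) T i : compactFields n L)) ∈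
        fieldDeg n 𝓛 (∑ i ∈ T, d i.castSucc + s) := by
    intro T W s hW
    have := hW.degree T.card (sub (Fin.init d) T) (fun i => (sub (Fin.init e) T i : compactFields n L))
      fun i => he _
    rwa [sum_sub] at this
  have hdeg' : ∀ T : Finset (Fin k), ∀ W : VField n L, ∀ s, IsVectorField 𝓛 s W →
      W (Tᶜ.card + 1) (fun i => (Fin.snoc (α := fun _ => compactFields n L)
        (sub (Fin.init e) Tᶜ) (e (Fin.last k)) i : compactFields n L)) ∈
        fieldDeg n 𝓛 (∑ i ∈ Tᶜ, d i.castSucc + d (Fin.last k) + s) := by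
    intro T W s hW
    have := hW.degree (Tᶜ.card + 1) (Fin.snoc (α := fun _ => ℤ) (sub (Fin.init d) Tᶜ)
      (d (Fin.last k))) (fun i => (Fin.snoc (α := fun _ => compactFields n L)
        (sub (Fin.init e) Tᶜ) (e (Fin.last k)) i : compactFields n L)) fun i => by
        refine Fin.lastCases ?_ (fun i => ?_) i
        · simp only [Fin.snoc_last]; exact he _
        · simp only [Fin.snoc_castSucc]; exact he _
    rw [Fin.sum_univ_castSucc] at this
    simp only [Fin.snoc_castSucc, Fin.snoc_last] at this
    rwa [sum_sub] at this
  have hw : ∀ T : Finset (Fin k), IsHomog (compactDeg n 𝓛) (sub (Fin.init d) T)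
      (sub (Fin.init e) T) := fun T i => he _
  have hsum : ∀ T : Finset (Fin k), ∑ i, ((sub (Fin.init d) T i : ℤ) : ZMod 2) =
      ∑ i ∈ T, (d i.castSucc : ZMod 2) := fun T =>
    sum_sub (fun i : Fin k => ((d i.castSucc : ℤ) : ZMod 2)) T
  congr 1
  -- The last field is an argument of `Y`. Using the symmetry of `G`, the value of `X` is moved into
  -- `Y` and the last field out to the symplectic form, which yields the insertion of `X` into `Y`.
  · refine Finset.sum_congr rfl fun T _ => ?_
    rw [sub_extendPos (fun k (v : Fin k → compactFields n L) => X k fun i => (v i : Fields n L)) e T,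
      sub_extendPos_compl (fun k (v : Fin k → compactFields n L) => Y k fun i => (v i : Fields n L)) e T, map_smul, smul_eq_mul]
    have key := hG.sympl_cons hGs (y := ⟨_, hXc T.card (sub (Fin.init e) T)⟩) (hdeg T X _ hX)
      (he (Fin.last k)) (hw Tᶜ)
    change _ = -((-1 : ℝ) ^ ((a + 1) * (b + 1)) * (_ * sympl C (Y _ (Fin.cons
      (X T.card fun i => (sub (Fin.init e) T i : compactFields n L))
      fun i => (sub (Fin.init e) Tᶜ i : compactFields n L))) (e (Fin.last k))))
    rw [key, sympl_antisymm C (Y _ _)]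
    -- The signs of the two sides agree only when the total degree is 1; in any other degree the
    -- symplectic form vanishes and so do both sides.
    by_cases hd : (∑ i ∈ T, d i.castSucc + (a + 1)) +
        (∑ i ∈ Tᶜ, d i.castSucc + d (Fin.last k) + (b + 1)) = 1
    · rw [hsum, unshuffleSign_eq, unshuffleSign_eq, unshuffleExp_extendPos, neg_one_zpow,
        neg_one_zpow, degOn, sum_extendPos]
      have hd2 := congrArg (fun m : ℤ => (m : ZMod 2)) hd
      push_cast at hd2 ⊢
      have hsign : ∀ u s t D E : ZMod 2, D + s + (E + t) = 1 → parSign u * parSign (t * D) =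
          parSign (s * t) * parSign u * parSign ((D + s) * E) := by
        intro u s t D E h
        rw [← parSign_add, ← parSign_add, ← parSign_add]
        congr 1
        revert u s t D E
        decide
      rw [hsign _ (a + 1) _ _ _ hd2]
      simp only [mul_neg, neg_neg, mul_assoc]
      rfl
    · have h0 : sympl C (X T.card fun i => (sub (Fin.init e) T i : compactFields n L))
          (Y (Tᶜ.card + 1) fun i => (Fin.snoc (α := fun _ => compactFields n L)
            (sub (Fin.init e) Tᶜ) (e (Fin.last k)) i : compactFields n L)) = 0 :=
        sympl_eq_zero C hd (hdeg T X _ hX) (hdeg' T Y _ hY)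
      simp only [h0, neg_zero, mul_zero]
  -- The last field is an argument of `X`, and the symmetry of `F` yields the insertion of `Y` into
  -- `X`. No antisymmetry is used here, and the signs agree in all degrees.
  · refine Finset.sum_congr rfl fun T _ => ?_
    rw [compl_compl, sub_extendPos (fun k (v : Fin k → compactFields n L) => Y k fun i => (v i : Fields n L)) e T,
      sub_extendPos_compl (fun k (v : Fin k → compactFields n L) => X k fun i => (v i : Fields n L)) e T, map_smul, smul_eq_mul]
    have key := hF.sympl_cons hFs (y := ⟨_, hYc T.card (sub (Fin.init e) T)⟩) (hdeg T Y _ hY)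
      (he (Fin.last k)) (hw Tᶜ)
    change _ = _ * sympl C (X _ (Fin.cons
      (Y T.card fun i => (sub (Fin.init e) T i : compactFields n L))
      fun i => (sub (Fin.init e) Tᶜ i : compactFields n L))) (e (Fin.last k))
    rw [key, hsum, unshuffleSign_eq, unshuffleSign_eq, unshuffleExp_compl, unshuffleExp_extendPos,
      neg_one_zpow, degOn, sum_extendPos, sum_extendPos_compl, sum_extendPos_compl]
    push_cast
    rw [← mul_assoc, ← parSign_add, ← parSign_add]
    congr 2
    change unshuffleExp T (fun i => ((Fin.init d i : ℤ) : ZMod 2)) + _ + _ = _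
    ring

end Antibracket

/-! ### The equivariant master equation -/

section VFBracket

variable {n : ℕ} {L : Type*} [AddCommGroup L] [Module ℝ L] {𝓛 : ℤ → Submodule ℝ L}

theorem insertion_smul_left (X Y : VField n L) (c : ℝ) {k : ℕ} (d : Fin k → ℤ)
    (v : Fin k → Fields n L) :
    insertion (fun k => ⇑((c • X) k)) (fun k => ⇑(Y k)) d v =
      c • insertion (fun k => ⇑(X k)) (fun k => ⇑(Y k)) d v := by
  simp only [insertion, Finset.smul_sum]
  exact Finset.sum_congr rfl fun T _ => smul_comm (unshuffleSign T d) c _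

theorem insertion_smul_right (X Y : VField n L) (c : ℝ) {k : ℕ} (d : Fin k → ℤ)
    (v : Fin k → Fields n L) :
    insertion (fun k => ⇑(X k)) (fun k => ⇑((c • Y) k)) d v =
      c • insertion (fun k => ⇑(X k)) (fun k => ⇑(Y k)) d v := by
  simp only [insertion, Finset.smul_sum]
  refine Finset.sum_congr rfl fun T _ => ?_
  rw [smul_comm c]
  exact congrArg (unshuffleSign T d • ·) ((X _).cons_smul (sub v Tᶜ) c (Y T.card (sub v T)))

theorem IsVFBracket.smul_left {a b : ℤ} {X Y Z : VField n L} (h : IsVFBracket 𝓛 a b X Y Z)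
    (c : ℝ) : IsVFBracket 𝓛 a b (c • X) Y (c • Z) := by
  intro k d e he
  rw [insertion_smul_left, insertion_smul_right, smul_comm]
  exact (congrArg (c • ·) (h k d e he)).trans (smul_sub c _ _)

theorem IsVFBracket.smul_right {a b : ℤ} {X Y Z : VField n L} (h : IsVFBracket 𝓛 a b X Y Z)
    (c : ℝ) : IsVFBracket 𝓛 a b X (c • Y) (c • Z) := by
  intro k d e he
  rw [insertion_smul_left, insertion_smul_right, smul_comm]
  exact (congrArg (c • ·) (h k d e he)).trans (smul_sub c _ _)

theorem IsVFBracket.swap {a b : ℤ} {X Y Z : VField n L} (h : IsVFBracket 𝓛 a b X Y Z) :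
    IsVFBracket 𝓛 b a Y X (-(-1 : ℝ) ^ (a * b) • Z) := by
  intro k d e he
  change -(-1 : ℝ) ^ (a * b) • Z k e = _
  rw [h k d e he, smul_sub, smul_smul, mul_comm b a, neg_one_zpow, neg_mul, parSign_mul_self,
    neg_smul, neg_smul, one_smul]
  abel

theorem isLocalFunctional_zero (m : ℤ) : IsLocalFunctional 𝓛 m (0 : Functional n L) where
  zero := rfl
  symm _ := isGradedSymm_zero
  degree _ _ _ _ _ := rfl
  isLocal _ := ⟨0, isPolyDiff_zero, fun _ => integral_zero'.symm⟩

end VFBracket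

/-! ### The master equation, by the number of Lie algebra arguments. -/

section MasterEquation

variable {n : ℕ} {L : Type*} [AddCommGroup L] [Module ℝ L]
  {𝓛 : ℤ → Submodule ℝ L} [DirectSum.Decomposition 𝓛] (C : CyclicLInfty n 𝓛)

/-- `F` is a graded symmetric functional of degree `a` whose Hamiltonian vector field `X` has no
constant term and preserves compact supports. -/
structure HasHamVF (a : ℤ) (F : Functional n L) (X : VField n L) : Prop where
  ham : IsHamiltonian C F X
  symm : ∀ k, IsGradedSymm (compactDeg n 𝓛) (F k)
  isVectorField : IsVectorField 𝓛 (a + 1) X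
  compact : ∀ k (v : Fin k → compactFields n L),
    X k (fun i => (v i : Fields n L)) ∈ compactFields n L
  zero : X 0 = 0

theorem antibracket_eq_symplFunctional {a b : ℤ} {F G : Functional n L} {X Y Z : VField n L}
    (hF : HasHamVF C a F X) (hG : HasHamVF C b G Y)
    (hZ : IsVFBracket 𝓛 (a + 1) (b + 1) X Y Z) {k : ℕ} {d : Fin k → ℤ}
    {e : Fin k → compactFields n L} (he : IsHomog (compactDeg n 𝓛) d e) :
    antibracket C a b F G d e = -((-1 : ℝ) ^ a * symplFunctional C Z k e) := by
  cases k with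
  | zero =>
    -- With no fields the antibracket only sees the constant terms of the vector fields, and that of
    -- `X` is zero.
    have h : ∀ m, m = 0 → X m = 0 := by rintro _ rfl; exact hF.zero
    rw [antibracket, Finset.sum_eq_zero]
    · change _ = -(_ * (0 : ℝ))
      rw [mul_zero, neg_zero]
    · intro U _
      rw [hamVF_eq C hF.ham, h U.card (by rw [Finset.eq_empty_of_isEmpty U, Finset.card_empty]),
        _root_.zero_apply, sympl_zero_left, mul_zero]
  | succ k =>
    rw [antibracket_eq hF.ham hG.ham hF.symm hG.symm hF.isVectorField hG.isVectorField hF.compact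
      hG.compact hZ he]
    rfl

theorem isHamiltonian_zero : IsHamiltonian C (0 : Functional n L) 0 :=
  ⟨fun _ => isPolyDiff_zero, fun _ _ _ => (sympl_zero_left C _).symm⟩

theorem antibracket_zero_left (a b : ℤ) (G : Functional n L) {k : ℕ} (d : Fin k → ℤ)
    (e : Fin k → compactFields n L) : antibracket C a b 0 G d e = 0 := by
  rw [antibracket, Finset.sum_eq_zero, mul_zero]
  intro U _
  rw [hamVF_eq C (isHamiltonian_zero C), Pi.zero_apply, _root_.zero_apply, sympl_zero_left, mul_zero]

theorem antibracket_zero_right (a b : ℤ) (F : Functional n L) {k : ℕ} (d : Fin k → ℤ)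
    (e : Fin k → compactFields n L) : antibracket C a b F 0 d e = 0 := by
  rw [antibracket, Finset.sum_eq_zero, mul_zero]
  intro U _
  rw [hamVF_eq C (isHamiltonian_zero C), Pi.zero_apply, _root_.zero_apply, sympl_zero_right,
    mul_zero]

theorem linVF_mem_compactFields {T : Fields n L →ₗ[ℝ] Fields n L}
    (hT : ∀ A ∈ compactFields n L, T A ∈ compactFields n L) (k : ℕ)
    (v : Fin k → compactFields n L) :
    linVF T k (fun i => (v i : Fields n L)) ∈ compactFields n L := by
  by_cases hk : k = 1
  · subst hk
    exact hT _ (v 0).2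
  · rw [linVF_of_ne T hk]
    exact zero_mem _

theorem bracketVF_zero : bracketVF C 0 = 0 := by
  refine MultilinearMap.ext fun v => ?_
  have h := bracketVF_tmul C (k := 0) 0 0 0 0 (fun i => i.elim0) (fun i => i.elim0)
  rw [C.q_zero, _root_.zero_apply, TensorProduct.tmul_zero, smul_zero] at h
  rw [Subsingleton.elim v (fun i => (0 : Fin 0 → Forms n) i ⊗ₜ[ℝ] (0 : Fin 0 → L) i), h]
  rfl

theorem hasHamVF_action : HasHamVF C 0 (action C) (aksz C) where
  ham := isHamiltonian_action C
  symm := (isLocalFunctional_action C).symm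
  isVectorField := isVectorField_aksz C
  compact k v := by
    rw [aksz_eq]
    refine add_mem ?_ (linVF_mem_compactFields
      (fun A hA => onFields_mem_compactFields (fun _ => extD_mem_compactForms) hA) k v)
    by_cases hk : k = 0
    · subst hk
      rw [bracketVF_zero]
      exact zero_mem _
    · exact bracketVF_mem_compactFields C hk fun i => (v i).2
  zero := by
    rw [aksz_eq, Pi.add_apply, bracketVF_zero, linVF_of_ne _ (by decide), add_zero]

theorem hasHamVF_current {i : ℤ} {x : DeRham (iso n)} (hx : x ∈ drDeg (iso n) (i + 1)) :
    HasHamVF C i (current C x) ((-1 : ℝ) ^ (i + 1) • isoVF x) where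
  ham := isHamiltonian_current C hx
  symm := (isLocalFunctional_current C hx).symm
  isVectorField := by
    rw [isoVF_apply, ← linVF_smul]
    exact isVectorField_linVF (r := 1) (fun a A hA =>
      Submodule.smul_mem _ _ (isoRep_degree hx a A hA)) ((isoRep_isDiffOp x).smul _)
  compact k v := Submodule.smul_mem _ _ (linVF_mem_compactFields (fun A hA => add_mem
    (onFields_mem_compactFields (fun _ => contrField_mem_compactForms _) hA)
    (onFields_mem_compactFields (fun _ => lieDer_mem_compactForms _) hA)) k v)
  zero := by
    rw [isoVF_apply, Pi.smul_apply, linVF_of_ne _ (by decide), smul_zero]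

theorem symplFunctional_smul (c : ℝ) (X : VField n L) (k : ℕ) (e : Fin k → compactFields n L) :
    symplFunctional C (c • X) k e = c * symplFunctional C X k e := by
  cases k with
  | zero => exact (mul_zero c).symm
  | succ k => exact sympl_smul_left C c _ _

theorem symplFunctional_zero (k : ℕ) (e : Fin k → compactFields n L) :
    symplFunctional C 0 k e = 0 := by
  simpa using symplFunctional_smul C 0 0 k e

theorem current_apply {i : ℤ} {x : DeRham (iso n)} (hx : x ∈ drDeg (iso n) i) (k : ℕ)
    (e : Fin k → compactFields n L) :
    current C x k e = (-1 : ℝ) ^ i * symplFunctional C (isoVF x) k e := by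
  rw [current_eq, neg_isoOp hx, linVF_smul, symplFunctional_smul, isoVF_apply]

theorem current_zero : current C (0 : DeRham (iso n)) = 0 := by
  funext k e
  rw [current_apply C (zero_mem (drDeg (iso n) 0)), map_zero, symplFunctional_zero, mul_zero]
  rfl

theorem isoOp_add (x y : DeRham (iso n)) :
    isoOp (L := L) (x + y) = isoOp x + isoOp y := by
  rw [isoOp, isoOp, isoOp, Prod.fst_add, Prod.snd_add, isoField_add, isoField_add, contrField_add,
    lieDer_add, onFields_add, onFields_add, add_add_add_comm]

theorem isoOp_smul (c : ℝ) (x : DeRham (iso n)) : isoOp (L := L) (c • x) = c • isoOp x := by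
  rw [isoOp, isoOp, Prod.smul_fst, Prod.smul_snd, isoField_smul, isoField_smul,
    contrField_real_smul, lieDer_real_smul, onFields_real_smul, onFields_real_smul, ← smul_add]

/-- The currents as a linear map. -/
def currentLin : DeRham (iso n) →ₗ[ℝ] Functional n L where
  toFun := current C
  map_add' x y := by
    rw [current_eq, current_eq, current_eq, isoOp_add, smul_add, linVF_add, symplFunctional_add]
  map_smul' c x := by
    funext k e
    rw [current_eq, current_eq, isoOp_smul, smul_comm, linVF_smul, symplFunctional_smul]
    rfl

theorem isLocalCochain_eqAction : IsLocalCochain 𝓛 (eqAction C) := by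
  intro m
  match m with
  | 0 =>
    refine ⟨⟨MultilinearMap.constOfIsEmpty ℝ _ (action C), rfl⟩,
      isGradedSymm_of_subsingleton (by decide) _, fun δ c _ => ?_⟩
    rw [Fin.sum_univ_zero]
    exact isLocalFunctional_action C
  | 1 =>
    refine ⟨⟨MultilinearMap.ofSubsingleton ℝ _ _ (0 : Fin 1) (currentLin C), rfl⟩,
      isGradedSymm_of_subsingleton le_rfl _, fun δ c hc => ?_⟩
    rw [Fin.sum_univ_one]
    exact isLocalFunctional_current C (hc 0)
  | m + 2 =>
    exact ⟨⟨0, rfl⟩, isGradedSymm_zero, fun δ c _ => isLocalFunctional_zero _⟩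

theorem eqAction_of_card_zero {m : ℕ} (hm : m = 0) (c : Fin m → DeRham (iso n)) :
    eqAction C m c = action C := by
  subst hm; rfl

theorem eqAction_of_two_le {m : ℕ} (hm : 2 ≤ m) (c : Fin m → DeRham (iso n)) :
    eqAction C m c = 0 := by
  obtain ⟨l, rfl⟩ := Nat.exists_eq_add_of_le' hm
  rfl

theorem eqAction_of_card_one {m : ℕ} (hm : m = 1) (c : Fin m → DeRham (iso n))
    {x : DeRham (iso n)} (hc : ∀ i, c i = x) : eqAction C m c = current C x := by
  subst hm
  change current C (c 0) = _
  rw [hc 0]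

theorem eqAction_singleton {m : ℕ} (c : Fin m → DeRham (iso n)) (i : Fin m) :
    eqAction C ({i} : Finset (Fin m)).card (sub c {i}) = current C (c i) :=
  eqAction_of_card_one C (Finset.card_singleton i) _ (sub_singleton_apply c i)

/-- An insertion always fills at least one slot, so the constant part `S` does not contribute; as
the cochain is at most linear, that slot must take all arguments. -/
theorem dCE_eqAction {m : ℕ} (δ : Fin m → ℤ) (c : Fin m → DeRham (iso n)) :
    dCE (eqAction C) δ c = -current C (drQ m c) := by
  rw [dCE, insertion, Finset.sum_eq_single Finset.univ]
  · have h1 : unshuffleSign (Finset.univ : Finset (Fin m)) δ = 1 := by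
      rw [unshuffleSign_eq, unshuffleExp]
      simp [parSign_zero]
    have h2 : drQ (Finset.univ : Finset (Fin m)).card (sub c Finset.univ) = drQ m c := by
      rw [← onList_ofFn drQ, ofFn_sub]
      simp only [Finset.mem_univ, decide_true, List.filter_true]
      rw [← onList_ofFn drQ c, List.ofFn_eq_map]
    have h3 : (Finset.univ : Finset (Fin m))ᶜ.card = 0 := by simp
    rw [h1, one_smul]
    congr 1
    refine eqAction_of_card_one C (by rw [h3]) _ fun i => ?_
    refine Fin.cases h2 (fun i => ?_) i
    rw [h3] at i
    exact i.elim0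
  · intro S _ hS
    rw [eqAction_of_two_le, smul_zero]
    have : Sᶜ.Nonempty := by
      rw [Finset.nonempty_iff_ne_empty]
      exact fun h => hS (by simpa using h)
    have := this.card_pos
    omega
  · simp

theorem drDiff_mem {𝔤 : Type*} [LieRing 𝔤] [LieAlgebra ℝ 𝔤] {i : ℤ} {x : DeRham 𝔤}
    (hx : x ∈ drDeg 𝔤 i) : drDiff x ∈ drDeg 𝔤 (i + 1) := by
  rcases mem_drDeg_cases hx with ⟨rfl, X, rfl⟩ | ⟨rfl, X, rfl⟩ | rfl
  · exact zero_mem _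
  · rw [drDeg, if_pos (by norm_num)]
    rfl
  · exact zero_mem _

theorem drBracket_mem {𝔤 : Type*} [LieRing 𝔤] [LieAlgebra ℝ 𝔤] {i j : ℤ} {x y : DeRham 𝔤}
    (hx : x ∈ drDeg 𝔤 i) (hy : y ∈ drDeg 𝔤 j) : drBracket x y ∈ drDeg 𝔤 (i + j) := by
  have hz : ∀ {x : DeRham 𝔤}, drBracket x 0 = 0 ∧ drBracket 0 x = 0 := fun {x} => by
    simp [drBracket]
  rcases mem_drDeg_cases hx with ⟨rfl, X, rfl⟩ | ⟨rfl, X, rfl⟩ | rfl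
  · rcases mem_drDeg_cases hy with ⟨rfl, Y, rfl⟩ | ⟨rfl, Y, rfl⟩ | rfl
    · simp [drBracket, drDeg]
    · simp [drBracket, drDeg]
    · rw [hz.1]; exact zero_mem _
  · rcases mem_drDeg_cases hy with ⟨rfl, Y, rfl⟩ | ⟨rfl, Y, rfl⟩ | rfl
    · simp [drBracket, drDeg]
    · have h : drBracket ((X, 0) : DeRham 𝔤) (Y, 0) = 0 := by simp [drBracket]
      rw [h]; exact zero_mem _
    · rw [hz.1]; exact zero_mem _
  · rw [hz.2]; exact zero_mem _

theorem drQ_two {𝔤 : Type*} [LieRing 𝔤] [LieAlgebra ℝ 𝔤] {i : ℤ} (c : Fin 2 → DeRham 𝔤)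
    (hx : c 0 ∈ drDeg 𝔤 i) : drQ 2 c = (-1 : ℝ) ^ i • drBracket (c 0) (c 1) := by
  change drBracket (-(c 0).1, (c 0).2) (c 1) = _
  rcases mem_drDeg_cases hx with ⟨rfl, X, h⟩ | ⟨rfl, X, h⟩ | h
  · rw [h]; simp [drBracket]
  · rw [h]; simp [drBracket]
  · rw [h]; simp [drBracket]

theorem zmod_two_cases (z : ZMod 2) : z = 0 ∨ z = 1 := by
  revert z; decide

/-- The ordinary classical master equation, which is `[Q, Q] = 0`. -/
theorem masterEquation_zero {δ : Fin 0 → ℤ} {c : Fin 0 → DeRham (iso n)}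
    {k : ℕ} {d : Fin k → ℤ}
    {e : Fin k → compactFields n L} (he : IsHomog (compactDeg n 𝓛) d e) :
    dCE (eqAction C) δ c k e + 1 / 2 * cochainBracket C (eqAction C) (eqAction C) δ c d e = 0 := by
  rw [dCE_eqAction]
  have h0 := antibracket_eq_symplFunctional C (hasHamVF_action C) (hasHamVF_action C)
    (isDGLieMap_isoVF C).square_zero he
  rw [symplFunctional_zero, mul_zero, neg_zero] at h0
  have hq : drQ 0 c = 0 := rfl
  rw [cochainBracket, Finset.sum_eq_zero, hq, current_zero]
  · simp
  · intro T _
    obtain rfl := Finset.eq_empty_of_isEmpty T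
    have h1 : ∀ U : Finset (Fin 0), eqAction C U.card (sub c U) = action C := fun U =>
      eqAction_of_card_zero C (by simp [Finset.eq_empty_of_isEmpty U]) _
    have h2 : ∀ U : Finset (Fin 0), degOn δ U = 0 := fun U => by
      rw [Finset.eq_empty_of_isEmpty U]; rfl
    rw [h1, h1, h2, h2, h0, mul_zero]

/-- The compatibility of `ρ` with the differentials. The two orders of the antibracket contribute
equally and cancel the factor one half. -/
theorem masterEquation_one {δ : Fin 1 → ℤ} {c : Fin 1 → DeRham (iso n)}
    (hc : IsHomog (shift (drDeg (iso n))) δ c) {k : ℕ} {d : Fin k → ℤ}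
    {e : Fin k → compactFields n L} (he : IsHomog (compactDeg n 𝓛) d e) :
    dCE (eqAction C) δ c k e + 1 / 2 * cochainBracket C (eqAction C) (eqAction C) δ c d e = 0 := by
  rw [dCE_eqAction]
  have hx : c 0 ∈ drDeg (iso n) (δ 0 + 1) := hc 0
  have hZ := ((isDGLieMap_isoVF C).differential _ _ hx).smul_right ((-1 : ℝ) ^ (δ 0 + 1))
  have h1 := antibracket_eq_symplFunctional C (hasHamVF_action C) (hasHamVF_current C hx) hZ he
  have h2 := antibracket_eq_symplFunctional C (hasHamVF_current C hx) (hasHamVF_action C)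
    hZ.swap he
  have hu : (Finset.univ : Finset (Finset (Fin 1))) = {∅, {0}} := by decide
  have e0 : (∅ : Finset (Fin 1))ᶜ = {0} := by decide
  have e1 : ({0} : Finset (Fin 1))ᶜ = ∅ := by decide
  have d0 : degOn δ ∅ = 0 := Finset.sum_empty
  have d1 : degOn δ {0} = δ 0 := Finset.sum_singleton _ _
  have s0 : unshuffleSign ∅ δ = 1 := Finset.prod_empty
  have s1 : unshuffleSign {0} δ = 1 := by
    rw [unshuffleSign_eq, unshuffleExp_singleton]
    simp [parSign_zero]
  rw [cochainBracket, hu, Finset.sum_pair (by decide), e0, e1, d0, d1, s0, s1,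
    eqAction_singleton, eqAction_of_card_zero C Finset.card_empty, h1, h2]
  have hq : drQ 1 c = drDiff (c 0) := rfl
  rw [hq, Pi.neg_apply, Pi.neg_apply, current_apply C (drDiff_mem hx), symplFunctional_smul,
    symplFunctional_smul, symplFunctional_smul]
  generalize symplFunctional C (isoVF (drDiff (c 0))) k e = w
  simp only [neg_one_zpow]
  push_cast
  generalize ((δ 0 : ℤ) : ZMod 2) = a
  rcases zmod_two_cases a with rfl | rfl <;>
    simp only [zero_add, CharTwo.add_self_eq_zero, parSign_zero, parSign_one, mul_one, one_mul] <;>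
    ring

set_option maxHeartbeats 1000000 in
-- The compatibility of `ρ` with the brackets. Only splittings with one Lie algebra argument on each
-- side matter, since the cochain has no quadratic part.
theorem masterEquation_two {δ : Fin 2 → ℤ} {c : Fin 2 → DeRham (iso n)}
    (hc : IsHomog (shift (drDeg (iso n))) δ c) {k : ℕ} {d : Fin k → ℤ}
    {e : Fin k → compactFields n L} (he : IsHomog (compactDeg n 𝓛) d e) :
    dCE (eqAction C) δ c k e + 1 / 2 * cochainBracket C (eqAction C) (eqAction C) δ c d e = 0 := by
  rw [dCE_eqAction]
  have hx : c 0 ∈ drDeg (iso n) (δ 0 + 1) := hc 0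
  have hy : c 1 ∈ drDeg (iso n) (δ 1 + 1) := hc 1
  have hZ := (((isDGLieMap_isoVF C).bracket _ _ _ _ hx hy).smul_left
    ((-1 : ℝ) ^ (δ 0 + 1))).smul_right ((-1 : ℝ) ^ (δ 1 + 1))
  have h1 := antibracket_eq_symplFunctional C (hasHamVF_current C hx) (hasHamVF_current C hy)
    hZ he
  have h2 := antibracket_eq_symplFunctional C (hasHamVF_current C hy) (hasHamVF_current C hx)
    hZ.swap he
  have hu : (Finset.univ : Finset (Finset (Fin 2))) = {∅, Finset.univ, {0}, {1}} := by decide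
  have e0 : ({0} : Finset (Fin 2))ᶜ = {1} := by decide
  have e1 : ({1} : Finset (Fin 2))ᶜ = {0} := by decide
  have d0 : degOn δ {0} = δ 0 := Finset.sum_singleton _ _
  have d1 : degOn δ {1} = δ 1 := Finset.sum_singleton _ _
  have s0 : unshuffleSign {0} δ = 1 := by
    rw [unshuffleSign_eq, unshuffleExp_singleton]
    simp [parSign_zero]
  have s1 : unshuffleSign {1} δ = parSign (δ 1 * δ 0) := by
    rw [unshuffleSign_eq, unshuffleExp_singleton]
    simp
  rw [cochainBracket, hu, Finset.sum_insert (by decide), Finset.sum_insert (by decide),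
    Finset.sum_pair (by decide), e0, e1, d0, d1, s0, s1, eqAction_singleton, eqAction_singleton,
    h1, h2, eqAction_of_two_le C (m := (∅ : Finset (Fin 2))ᶜ.card) (by simp),
    eqAction_of_two_le C (m := (Finset.univ : Finset (Fin 2)).card) (by simp),
    antibracket_zero_left, antibracket_zero_right, drQ_two c hx, Pi.neg_apply, Pi.neg_apply,
    current_apply C (Submodule.smul_mem _ _ (drBracket_mem hx hy)), map_smul]
  simp only [symplFunctional_smul]
  generalize symplFunctional C (isoVF (drBracket (c 0) (c 1))) k e = w
  simp only [neg_one_zpow]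
  push_cast
  generalize ((δ 0 : ℤ) : ZMod 2) = a
  generalize ((δ 1 : ℤ) : ZMod 2) = b
  rcases zmod_two_cases a with rfl | rfl <;> rcases zmod_two_cases b with rfl | rfl <;>
    simp only [zero_add, add_zero, CharTwo.add_self_eq_zero, parSign_zero, parSign_one, mul_one,
      one_mul, mul_zero] <;>
    ring

/-- In any splitting one side receives at least two arguments, where the cochain is zero; and `drQ`
has no operation beyond the binary one. -/
theorem masterEquation_of_three_le {m : ℕ} (δ : Fin (m + 3) → ℤ) (c : Fin (m + 3) → DeRham (iso n)) {k : ℕ} (d : Fin k → ℤ)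
    (e : Fin k → compactFields n L) :
    dCE (eqAction C) δ c k e + 1 / 2 * cochainBracket C (eqAction C) (eqAction C) δ c d e = 0 := by
  rw [dCE_eqAction]
  have hq : drQ (m + 3) c = 0 := rfl
  rw [cochainBracket, Finset.sum_eq_zero, hq, current_zero]
  · simp
  · intro T _
    have hT := Finset.card_add_card_compl T
    rw [Fintype.card_fin] at hT
    by_cases h : 2 ≤ T.card
    · rw [eqAction_of_two_le C h, antibracket_zero_left, mul_zero]
    · rw [eqAction_of_two_le C (m := Tᶜ.card) (by omega), antibracket_zero_right, mul_zero]

theorem equivariantCME_eqAction : EquivariantCME C (eqAction C) := by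
  intro m δ c hc k d e he
  match m with
  | 0 => exact masterEquation_zero C he
  | 1 => exact masterEquation_one C hc he
  | 2 => exact masterEquation_two C hc he
  | m + 3 => exact masterEquation_of_three_le C δ c d e

end MasterEquation

end AKSZ

end

/-! ### The theorem, with `isoVF` as the map of dg Lie algebras. -/

theorem mainTheorem8 (n : ℕ) {L : Type*} [AddCommGroup L] [Module ℝ L]
    (𝓛 : ℤ → Submodule ℝ L) [DirectSum.Decomposition 𝓛] (C : AKSZ.CyclicLInfty n 𝓛) :
    AKSZ.IsLocalCochain 𝓛 (AKSZ.eqAction C) ∧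
    AKSZ.EquivariantCME C (AKSZ.eqAction C) ∧
    AKSZ.IsHamiltonian C (AKSZ.eqAction C 0 ![]) (AKSZ.aksz C) ∧
    ∃ ρ : AKSZ.DeRham (AKSZ.iso n) →ₗ[ℝ] AKSZ.VField n L,
      (∀ (i : ℤ) (x : AKSZ.DeRham (AKSZ.iso n)), x ∈ AKSZ.drDeg (AKSZ.iso n) i →
        AKSZ.IsHamiltonian C (AKSZ.eqAction C 1 ![x]) ((-1 : ℝ) ^ i • ρ x)) ∧
      AKSZ.IsDGLieMap 𝓛 (AKSZ.aksz C) ρ :=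
  ⟨AKSZ.isLocalCochain_eqAction C, AKSZ.equivariantCME_eqAction C, AKSZ.isHamiltonian_action C,
    AKSZ.isoVF, fun _ _ hx => AKSZ.isHamiltonian_current C hx, AKSZ.isDGLieMap_isoVF C⟩
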